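/- Let $k$ be a field and let $\iota:\Gamma\hookrightarrow\mathbb{P}^2=\mathbb{P}^2_k$ be the closed embedding of a $(d_1,d_2)$-complete intersection, i.e. $\Gamma$ is the scheme-theoretic intersection of two plane curves of degrees $d_1,d_2\ge 1$ without common component. Then $\Gamma$ is a finite $k$-scheme; let $\gamma=\dim_k H^0(\Gamma,\mathcal{O}_\Gamma)$ be its length and $K_\Gamma=\operatorname{Hom}_k(\mathcal{O}_\Gamma,k)$ its canonical module, with trace map $\operatorname{tr}:H^0(\Gamma,K_\Gamma)\to k$, $\operatorname{tr}(\lambda)=\lambda(1)$. There is an isomorphism of $\mathcal{O}_\Gamma$-modules $\varphi:\mathcal{O}(d_1+d_2-3)|_\Gamma\cong K_\Gamma$ such that $\operatorname{tr}(\varphi(s|_\Gamma))=0$ for all $s\in H^0(\mathbb{P}^2,\mathcal{O}(d_1+d_2-3))$ and such that the following holds for every integer $d$. Put $e=d_1+d_2-d-3$ and $L=\mathcal{O}(d)$. Through $\varphi$, identify $K_\Gamma\otimes L|_\Gamma^\vee$ with $\mathcal{O}(e)|_\Gamma$; the Serre duality map $H^0(\Gamma,L|_\Gamma)\to H^0(\Gamma,\mathcal{O}(e)|_\Gamma)^\vee$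 is then $s\mapsto(t\mapsto\operatorname{tr}(\varphi(st)))$. Let $W\subset H^0(\mathbb{P}^2,\mathcal{O}(d))$ be a linear series (a linear subspace) complementary to the kernel of the restriction map $H^0(\mathbb{P}^2,\mathcal{O}(d))\to H^0(\Gamma,\mathcal{O}(d)|_\Gamma)$. Then there exists a linear series $W^\perp\subset H^0(\mathbb{P}^2,\mathcal{O}(d_1+d_2-d-3))$ for which the Serre duality map is an isomorphism and the sequence $$0\to W\xrightarrow{\operatorname{res}}H^0(\Gamma,L|_\Gamma)\cong H^0(\Gamma,K_\Gamma\otimes L|_\Gamma^\vee)^\vee\xrightarrow{\operatorname{res}^\vee}(W^\perp)^\vee\to 0$$ is exact. Moreover, every linear series $W^\perp\subset H^0(\mathbb{P}^2,\mathcal{O}(d_1+d_2-d-3))$ with this property satisfies the following. (1) $W^\perp$ is complementary to the kernel of the restriction map $H^0(\mathbb{P}^2,\mathcal{O}(d_1+d_2-d-3))\to H^0(\Gamma,\mathcal{O}(d_1+d_2-d-3)|_\Gamma)$, and $\dim W+\dim W^\perp=\gamma$. (2) The two maps of the Gale dual pair factor through $\mathbb{P}^2$: if $\dim W=r+1\ge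 1$, then for every choice of a basis of $W$, $\Gamma$ is disjoint from the base locus of $W$, the rational map $\mathbb{P}^2\dashrightarrow\mathbb{P}^r$ defined by $W$ is regular away from this base locus, and there is exactly one morphism $\Gamma\to\mathbb{P}^r$ defined by the restriction of $W$ to $\Gamma$, namely the composite $\Gamma\xrightarrow{\iota}\mathbb{P}^2\dashrightarrow\mathbb{P}^r$; and likewise, if $\dim W^\perp=s+1\ge 1$, for $\Gamma\xrightarrow{\iota}\mathbb{P}^2\dashrightarrow\mathbb{P}^s$ and $W^\perp$. -/

import Mathlib

open CategoryTheory AlgebraicGeometry MvPolynomial TopologicalSpace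

universe u

attribute [local instance] MvPolynomial.gradedAlgebra

noncomputable section

namespace GoppaDuality

/-! ### Projective space -/

/-- The standard grading of the polynomial ring `k[x₀, …, xₙ]`. -/
abbrev grading (k : Type u) [Field k] (n : ℕ) :
    ℕ → Submodule k (MvPolynomial (Fin (n + 1)) k) :=
  homogeneousSubmodule (Fin (n + 1)) k

/-- Projective `n`-space `ℙⁿ = Proj k[x₀, …, xₙ]`. -/
abbrev PSpace (k : Type u) [Field k] (n : ℕ) : Scheme.{u} := Proj (grading k n)

variable {k : Type u} [Field k] {n : ℕ}

/-- The structure morphism `ℙⁿ ⟶ Spec k`. -/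
def toSpecField (k : Type u) [Field k] (n : ℕ) : PSpace k n ⟶ Spec (CommRingCat.of k) :=
  Proj.toSpecZero (grading k n) ≫
    Spec.map (CommRingCat.ofHom (algebraMap k (grading k n 0)))

/-- The standard affine chart `D₊(xᵢ)` of `ℙⁿ`. -/
def chart (k : Type u) [Field k] (n : ℕ) (i : Fin (n + 1)) : (PSpace k n).Opens :=
  Proj.basicOpen (grading k n) (X i)

/-- The regular function `F / xᵢᵐ` on the chart `D₊(xᵢ)`, for `F` homogeneous of degree `m`. -/
def dehom (i : Fin (n + 1)) {m : ℕ} (F : MvPolynomial (Fin (n + 1)) k) (hF : F.IsHomogeneous m) :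
    Γ(PSpace k n, chart k n i) :=
  (Proj.awayToSection (grading k n) (X i)).hom
    (HomogeneousLocalization.Away.mk (grading k n)
      ((mem_homogeneousSubmodule 1 _).2 (isHomogeneous_X k i)) m F
      ((mem_homogeneousSubmodule _ _).2 (by simpa using hF)))

/-- The regular function `xⱼ / xᵢ` on the chart `D₊(xᵢ)`. -/
def ratio (k : Type u) [Field k] {n : ℕ} (i j : Fin (n + 1)) : Γ(PSpace k n, chart k n i) :=
  dehom i (X j) (isHomogeneous_X k j)

lemma ratio_mul_ratio (i j : Fin (n + 1)) :
    ((PSpace k n).presheaf.map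
        (homOfLE (inf_le_left : chart k n i ⊓ chart k n j ≤ chart k n i)).op).hom (ratio k i j) *
      ((PSpace k n).presheaf.map
        (homOfLE (inf_le_right : chart k n i ⊓ chart k n j ≤ chart k n j)).op).hom (ratio k j i)
      = 1 := by
  have hi : (X i : MvPolynomial (Fin (n + 1)) k) ∈ grading k n 1 :=
    (mem_homogeneousSubmodule 1 _).2 (isHomogeneous_X k i)
  have hj : (X j : MvPolynomial (Fin (n + 1)) k) ∈ grading k n 1 :=
    (mem_homogeneousSubmodule 1 _).2 (isHomogeneous_X k j)
  have hle : chart k n i ⊓ chart k n j ≤ Proj.basicOpen (grading k n) (X i * X j) :=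
    (Proj.basicOpen_mul (grading k n) (X i) (X j)).ge
  have h1 := ConcreteCategory.congr_hom (Proj.awayMap_awayToSection (𝒜 := grading k n)
    (f := X i) hj (x := X i * X j) rfl)
    (HomogeneousLocalization.Away.mk (grading k n) hi 1 (X j) (by simpa using hj))
  have h2 := ConcreteCategory.congr_hom (Proj.awayMap_awayToSection (𝒜 := grading k n)
    (f := X j) hi (x := X i * X j) (mul_comm _ _))
    (HomogeneousLocalization.Away.mk (grading k n) hj 1 (X i) (by simpa using hi))
  have h3 : HomogeneousLocalization.awayMap (grading k n) hj (rfl : X i * X j = X i * X j)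
      (HomogeneousLocalization.Away.mk (grading k n) hi 1 (X j) (by simpa using hj)) *
      HomogeneousLocalization.awayMap (grading k n) hi (mul_comm (X i) (X j))
      (HomogeneousLocalization.Away.mk (grading k n) hj 1 (X i) (by simpa using hi)) = 1 := by
    apply HomogeneousLocalization.val_injective
    rw [HomogeneousLocalization.val_mul, HomogeneousLocalization.val_one,
      HomogeneousLocalization.awayMap_mk, HomogeneousLocalization.awayMap_mk,
      HomogeneousLocalization.Away.val_mk, HomogeneousLocalization.Away.val_mk,
      Localization.mk_mul, ← Localization.mk_one, Localization.mk_eq_mk_iff,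
      Localization.r_iff_exists]
    refine ⟨1, ?_⟩
    simp
    ring
  have h4 := congrArg (fun a => ((PSpace k n).presheaf.map (homOfLE hle).op).hom
    ((Proj.awayToSection (grading k n) (X i * X j)).hom a)) h3
  simp only [map_mul, map_one] at h4
  refine Eq.trans ?_ h4
  congr 1
  · refine Eq.trans ?_ (congrArg ((PSpace k n).presheaf.map (homOfLE hle).op).hom h1).symm
    rw [← CommRingCat.comp_apply, Category.assoc, ← Functor.map_comp]
    rfl
  · refine Eq.trans ?_ (congrArg ((PSpace k n).presheaf.map (homOfLE hle).op).hom h2).symm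
    rw [← CommRingCat.comp_apply, Category.assoc, ← Functor.map_comp]
    rfl

lemma appLE_appLE {X₁ X₂ X₃ : Scheme.{u}} (h : X₁ ⟶ X₂) (f : X₂ ⟶ X₃) {U : X₃.Opens}
    {V : X₂.Opens} {W : X₁.Opens} (e : V ≤ f ⁻¹ᵁ U) (e' : W ≤ h ⁻¹ᵁ V) (e'' : W ≤ (h ≫ f) ⁻¹ᵁ U)
    (a : Γ(X₃, U)) :
    (h.appLE V W e').hom ((f.appLE U V e).hom a) = ((h ≫ f).appLE U W e'').hom a := by
  rw [← CommRingCat.comp_apply, Scheme.Hom.appLE_comp_appLE]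

lemma map_appLE {X₁ X₂ : Scheme.{u}} (h : X₁ ⟶ X₂) {U V : X₂.Opens} {W : X₁.Opens} (i : V ≤ U)
    (e : W ≤ h ⁻¹ᵁ V) (e' : W ≤ h ⁻¹ᵁ U) (a : Γ(X₂, U)) :
    (h.appLE V W e).hom ((X₂.presheaf.map (homOfLE i).op).hom a) = (h.appLE U W e').hom a := by
  rw [← CommRingCat.comp_apply, Scheme.Hom.map_appLE]

lemma map_map {X₁ : Scheme.{u}} {U V W : X₁.Opens} (e : V ≤ U) (e' : W ≤ V) (a : Γ(X₁, U)) :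
    (X₁.presheaf.map (homOfLE e').op).hom ((X₁.presheaf.map (homOfLE e).op).hom a) =
      (X₁.presheaf.map (homOfLE (e'.trans e)).op).hom a := by
  rw [← CommRingCat.comp_apply, ← Functor.map_comp]
  rfl

lemma appLE_map {X₁ X₂ : Scheme.{u}} (h : X₁ ⟶ X₂) {U : X₂.Opens} {V W : X₁.Opens} (i : W ≤ V)
    (e : V ≤ h ⁻¹ᵁ U) (e' : W ≤ h ⁻¹ᵁ U) (a : Γ(X₂, U)) :
    (X₁.presheaf.map (homOfLE i).op).hom ((h.appLE U V e).hom a) = (h.appLE U W e').hom a := by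
  rw [← CommRingCat.comp_apply, Scheme.Hom.appLE_map]

/-! ### Regular functions on a scheme over projective space

Throughout, `f : Y ⟶ ℙⁿ` is a morphism of schemes, and `Y` is regarded as a `k`-scheme via `f`. -/

variable {Y Z : Scheme.{u}}

/-- The ring `Γ(U, 𝒪_Y)` of regular functions on an open `U` of `Y`, as an algebra over `k`. -/
@[nolint unusedArguments]
def Reg (_f : Y ⟶ PSpace k n) (U : Y.Opens) : Type u := Γ(Y, U)

instance (f : Y ⟶ PSpace k n) (U : Y.Opens) : CommRing (Reg f U) :=
  inferInstanceAs (CommRing Γ(Y, U))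

/-- The constant functions. -/
def constants (f : Y ⟶ PSpace k n) (U : Y.Opens) : k →+* Reg f U :=
  ((f ≫ toSpecField k n).appLE ⊤ U le_top).hom.comp
    (Scheme.ΓSpecIso (CommRingCat.of k)).inv.hom

instance (f : Y ⟶ PSpace k n) (U : Y.Opens) : Algebra k (Reg f U) :=
  (constants f U).toAlgebra

/-- Pullback of regular functions along a morphism `h` of schemes over `ℙⁿ`. -/
def Reg.pull {f : Y ⟶ PSpace k n} {g : Z ⟶ PSpace k n} (h : Z ⟶ Y) (w : h ≫ f = g)
    (U : Y.Opens) (V : Z.Opens) (e : V ≤ h ⁻¹ᵁ U) : Reg f U →ₐ[k] Reg g V where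
  __ := (show Reg f U →+* Reg g V from (h.appLE U V e).hom)
  commutes' c := by
    subst w
    have h₁ : V ≤ (h ≫ f ≫ toSpecField k n) ⁻¹ᵁ ⊤ := fun _ _ => trivial
    refine (appLE_appLE h (f ≫ toSpecField k n) (U := ⊤) (V := U) (fun _ _ => trivial) e h₁
      ((Scheme.ΓSpecIso (CommRingCat.of k)).inv.hom c)).trans ?_
    simp only [← Category.assoc]
    rfl

/-- Restriction of regular functions to a smaller open. -/
def Reg.res (f : Y ⟶ PSpace k n) {U V : Y.Opens} (e : V ≤ U) : Reg f U →ₐ[k] Reg f V :=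
  { (show Reg f U →+* Reg f V from (Y.presheaf.map (homOfLE e).op).hom) with
    commutes' := fun c => appLE_map (f ≫ toSpecField k n) (U := ⊤) e (fun _ _ => trivial)
      (fun _ _ => trivial) ((Scheme.ΓSpecIso (CommRingCat.of k)).inv.hom c) }

/-! ### The line bundles `𝒪(d)` and their global sections -/

/-- The open `f⁻¹(D₊(xᵢ))` of `Y`. -/
abbrev piece (f : Y ⟶ PSpace k n) (i : Fin (n + 1)) : Y.Opens := f ⁻¹ᵁ chart k n i

/-- The regular function `f^*(xⱼ / xᵢ)` on an open contained in `f⁻¹(D₊(xᵢ))`. -/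
def ratioOn (f : Y ⟶ PSpace k n) (i j : Fin (n + 1)) {V : Y.Opens} (e : V ≤ piece f i) :
    Reg f V :=
  (f.appLE (chart k n i) V e).hom (ratio k i j)

lemma ratioOn_mul_ratioOn (f : Y ⟶ PSpace k n) (i j : Fin (n + 1)) {V : Y.Opens}
    (ei : V ≤ piece f i) (ej : V ≤ piece f j) : ratioOn f i j ei * ratioOn f j i ej = 1 := by
  have h := congrArg (f.appLE (chart k n i ⊓ chart k n j) V (le_inf ei ej)).hom
    (ratio_mul_ratio (k := k) i j)
  rw [map_mul, map_one] at h
  exact (congrArg₂ (· * ·) (map_appLE f inf_le_left _ ei _).symm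
    (map_appLE f inf_le_right _ ej _).symm).trans h

/-- The transition function `xⱼ / xᵢ` of `f^*𝒪(1)` as a unit on
`f⁻¹(D₊(xᵢ)) ∩ f⁻¹(D₊(xⱼ))`. -/
def transition (f : Y ⟶ PSpace k n) (i j : Fin (n + 1)) : (Reg f (piece f i ⊓ piece f j))ˣ where
  val := ratioOn f i j inf_le_left
  inv := ratioOn f j i inf_le_right
  val_inv := ratioOn_mul_ratioOn f i j _ _
  inv_val := ratioOn_mul_ratioOn f j i _ _

/-- Regular functions on `f⁻¹(D₊(xᵢ))` form an algebra over the global ones, by restriction. -/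
instance (f : Y ⟶ PSpace k n) (i : Fin (n + 1)) : Algebra (Reg f ⊤) (Reg f (piece f i)) :=
  (Reg.res f (le_top : piece f i ≤ ⊤)).toRingHom.toAlgebra

instance (f : Y ⟶ PSpace k n) (i : Fin (n + 1)) :
    IsScalarTower k (Reg f ⊤) (Reg f (piece f i)) :=
  IsScalarTower.of_algebraMap_eq fun c =>
    ((Reg.res f (le_top : piece f i ≤ ⊤)).commutes c).symm

lemma res_res (f : Y ⟶ PSpace k n) {U V W : Y.Opens} (e : V ≤ U) (e' : W ≤ V) (a : Reg f U) :
    Reg.res f e' (Reg.res f e a) = Reg.res f (e'.trans e) a :=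
  map_map e e' a

/-- `H⁰(Y, f^*𝒪(d))`. The line bundle `𝒪(d)` is trivialised on `D₊(xᵢ)` by the generator `xᵢᵈ`, so
a section of its pullback is a family of regular functions `tᵢ` on the `f⁻¹(D₊(xᵢ))` with
`tᵢ xᵢᵈ = tⱼ xⱼᵈ`, that is `tᵢ = (xⱼ / xᵢ)ᵈ tⱼ`, on the overlaps. -/
def H0 (f : Y ⟶ PSpace k n) (d : ℤ) : Submodule (Reg f ⊤) (∀ i, Reg f (piece f i)) where
  carrier := {t | ∀ i j, Reg.res f (inf_le_left : piece f i ⊓ piece f j ≤ _) (t i) =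
    ((transition f i j ^ d : (Reg f (piece f i ⊓ piece f j))ˣ) : Reg f (piece f i ⊓ piece f j)) *
      Reg.res f (inf_le_right : piece f i ⊓ piece f j ≤ _) (t j)}
  add_mem' {s t} hs ht i j := by
    simp only [Pi.add_apply, map_add, hs i j, ht i j, mul_add]
  zero_mem' i j := by simp only [Pi.zero_apply, map_zero, mul_zero]
  smul_mem' a t ht i j := by
    simp only [Pi.smul_apply, Algebra.smul_def, map_mul, ht i j]
    change Reg.res f _ (Reg.res f _ a) * _ = _ * (Reg.res f _ (Reg.res f _ a) * _)
    rw [res_res, res_res, mul_left_comm]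

/-- The multiplication `H⁰(Y, f^*𝒪(d)) × H⁰(Y, f^*𝒪(e)) → H⁰(Y, f^*𝒪(m))`, for `d + e = m`. -/
def H0.mul (f : Y ⟶ PSpace k n) {d e m : ℤ} (h : d + e = m) :
    H0 f d →ₗ[k] H0 f e →ₗ[k] H0 f m :=
  LinearMap.mk₂ k
    (fun s t => ⟨fun i => s.1 i * t.1 i, fun i j => by
      subst h
      rw [map_mul, map_mul, s.2 i j, t.2 i j, zpow_add, Units.val_mul, mul_mul_mul_comm]⟩)
    (fun s s' t => by ext i; simp [add_mul])
    (fun c s t => by ext i; simp)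
    (fun s t t' => by ext i; simp [mul_add])
    (fun c s t => by ext i; simp)

lemma pull_transition {f : Y ⟶ PSpace k n} {g : Z ⟶ PSpace k n} (h : Z ⟶ Y) (w : h ≫ f = g)
    (i j : Fin (n + 1)) (e : piece g i ⊓ piece g j ≤ h ⁻¹ᵁ (piece f i ⊓ piece f j)) :
    Units.map (Reg.pull h w _ _ e : _ →* _) (transition f i j) = transition g i j := by
  subst w
  apply Units.ext
  exact appLE_appLE h f _ _ _ _

lemma piece_le {f : Y ⟶ PSpace k n} {g : Z ⟶ PSpace k n} (h : Z ⟶ Y) (w : h ≫ f = g)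
    (i : Fin (n + 1)) : piece g i ≤ h ⁻¹ᵁ piece f i := by
  subst w; exact le_rfl

lemma pull_res {f : Y ⟶ PSpace k n} {g : Z ⟶ PSpace k n} (h : Z ⟶ Y) (w : h ≫ f = g)
    {U U' : Y.Opens} {V V' : Z.Opens} (e : V ≤ h ⁻¹ᵁ U) (e' : V' ≤ h ⁻¹ᵁ U') (hU : U' ≤ U)
    (hV : V' ≤ V) (a : Reg f U) :
    Reg.res g hV (Reg.pull h w U V e a) = Reg.pull h w U' V' e' (Reg.res f hU a) := by
  have e₀ : V' ≤ h ⁻¹ᵁ U := hV.trans e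
  exact (appLE_map h hV e e₀ a).trans (map_appLE h hU e' e₀ a).symm

/-- Pullback of sections `H⁰(Y, f^*𝒪(d)) → H⁰(Z, g^*𝒪(d))` along a morphism `h : Z ⟶ Y` with
`g = h ≫ f`. -/
def H0.pull {f : Y ⟶ PSpace k n} {g : Z ⟶ PSpace k n} (h : Z ⟶ Y) (w : h ≫ f = g) (d : ℤ) :
    H0 f d →ₗ[k] H0 g d where
  toFun t := ⟨fun i => Reg.pull h w _ _ (piece_le h w i) (t.1 i), fun i j => by
    have e : piece g i ⊓ piece g j ≤ h ⁻¹ᵁ (piece f i ⊓ piece f j) :=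
      inf_le_inf (piece_le h w i) (piece_le h w j)
    rw [pull_res h w _ e inf_le_left, pull_res h w _ e inf_le_right, t.2 i j, map_mul,
      ← pull_transition h w i j e, ← map_zpow]
    rfl⟩
  map_add' s t := by ext i; simp
  map_smul' c t := by ext i; simp

/-- The open set of points of `Y` where a section of `f^*𝒪(d)` does not vanish. -/
def nonvanishing (f : Y ⟶ PSpace k n) {d : ℤ} (s : H0 f d) : Y.Opens :=
  ⨆ i, Y.basicOpen (show Γ(Y, piece f i) from s.1 i)

/-! ### Linear series on projective space -/

/-- The space `H⁰(ℙⁿ, 𝒪(d))`. -/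
abbrev H0P (k : Type u) [Field k] (n : ℕ) (d : ℤ) : Type u := H0 (𝟙 (PSpace k n)) d

/-- The restriction map `H⁰(ℙⁿ, 𝒪(d)) → H⁰(Γ, 𝒪(d)|_Γ)` along `ι : Γ ⟶ ℙⁿ`. -/
def restr (ι : Y ⟶ PSpace k n) (d : ℤ) : H0P k n d →ₗ[k] H0 ι d :=
  H0.pull ι (Category.comp_id ι) d

/-- A morphism of `k`-schemes `g : Y ⟶ ℙʳ` is the one given by sections `s₀, …, sᵣ` of the line
bundle `f^*𝒪(d)`: the preimage of `D₊(yᵢ)` is the locus `sᵢ ≠ 0`, and there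
`sⱼ = g^*(yⱼ / yᵢ) sᵢ`. -/
structure IsInducedBy {r : ℕ} (g : Y ⟶ PSpace k r) (f : Y ⟶ PSpace k n) {d : ℤ}
    (s : Fin (r + 1) → H0 f d) : Prop where
  over_base : g ≫ toSpecField k r = f ≫ toSpecField k n
  preimage : ∀ i, g ⁻¹ᵁ chart k r i = nonvanishing f (s i)
  ratio : ∀ i j l,
    Reg.res f (inf_le_right : g ⁻¹ᵁ chart k r i ⊓ piece f l ≤ _) ((s j).1 l) =
      (show Reg f (g ⁻¹ᵁ chart k r i ⊓ piece f l) from ratioOn g i j inf_le_left) *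
        Reg.res f (inf_le_right : g ⁻¹ᵁ chart k r i ⊓ piece f l ≤ _) ((s i).1 l)

/-- The complement in `ℙⁿ` of the base locus of a linear series `W ⊆ H⁰(ℙⁿ, 𝒪(d))`. -/
def baseFreeLocus {d : ℤ} (W : Submodule k (H0P k n d)) : (PSpace k n).Opens :=
  ⨆ s ∈ W, nonvanishing (𝟙 (PSpace k n)) s

/-- For every basis of the linear series `W ⊆ H⁰(ℙⁿ, 𝒪(d))` (that is, for every choice of
coordinates on `ℙ(Wᵛ) = ℙʳ`), the linear series defines a rational map `ℙⁿ ⇢ ℙʳ`, regular away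
from the base locus; the image of `ι : Γ ⟶ ℙⁿ` avoids the base locus; and there is exactly one
morphism `Γ ⟶ ℙʳ` defined by the restriction of `W` to `Γ`, namely the composite
`Γ ⟶ ℙⁿ ⇢ ℙʳ`. -/
def MapFactors (ι : Y ⟶ PSpace k n) {d : ℤ} (W : Submodule k (H0P k n d)) : Prop :=
  ∀ (r : ℕ) (b : Module.Basis (Fin (r + 1)) k W),
    ∃ π : (PSpace k n).PartialMap (PSpace k r),
      π.domain = baseFreeLocus W ∧
      IsInducedBy π.hom π.domain.ι
        (fun i => H0.pull π.domain.ι (Category.comp_id _) d (b i : H0P k n d)) ∧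
      ∃ ι' : Y ⟶ π.domain.toScheme, ι' ≫ π.domain.ι = ι ∧
        ∀ α : Y ⟶ PSpace k r,
          IsInducedBy α ι (fun i => restr ι d (b i : H0P k n d)) ↔ α = ι' ≫ π.hom

/-! ### Complete intersections and duality -/

/-- `ι : Γ ⟶ ℙ²` is the closed embedding of a `(d₁, d₂)`-complete intersection: `Γ` is the
scheme-theoretic intersection of two plane curves `F = 0` and `G = 0`, of positive degrees `d₁` and
`d₂`, without common component. -/
structure IsCompleteIntersection (ι : Y ⟶ PSpace k 2) (d₁ d₂ : ℕ) : Prop where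
  isClosedImmersion : IsClosedImmersion ι
  pos₁ : 0 < d₁
  pos₂ : 0 < d₂
  exists_equations : ∃ (F G : MvPolynomial (Fin 3) k) (hF : F.IsHomogeneous d₁)
    (hG : G.IsHomogeneous d₂), IsRelPrime F G ∧
      ∀ i, RingHom.ker (ι.app (chart k 2 i)).hom = Ideal.span {dehom i F hF, dehom i G hG}

/-- The canonical module `H⁰(Γ, K_Γ) = Hom_k(H⁰(Γ, 𝒪_Γ), k)` of a finite `k`-scheme `Γ`. -/
def CanonicalModule (ι : Y ⟶ PSpace k n) : Type u := Module.Dual k (Reg ι ⊤)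

namespace CanonicalModule

variable (ι : Y ⟶ PSpace k n)

instance : AddCommGroup (CanonicalModule ι) :=
  inferInstanceAs (AddCommGroup (Module.Dual k (Reg ι ⊤)))

instance : Module k (CanonicalModule ι) :=
  inferInstanceAs (Module k (Module.Dual k (Reg ι ⊤)))

/-- The module structure `(a • φ)(x) = φ(a x)`. -/
instance : Module (Reg ι ⊤) (CanonicalModule ι) where
  smul a φ := LinearMap.comp (M₂ := Reg ι ⊤) φ (LinearMap.mulLeft k a)
  one_smul φ := LinearMap.ext fun x => congrArg (DFunLike.coe (F := Module.Dual k (Reg ι ⊤)) φ)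
    (one_mul x)
  mul_smul a b φ := LinearMap.ext fun x =>
    congrArg (DFunLike.coe (F := Module.Dual k (Reg ι ⊤)) φ)
      (show a * b * x = b * (a * x) by ring)
  smul_zero _ := rfl
  smul_add _ _ _ := rfl
  add_smul a b φ := LinearMap.ext fun x =>
    (congrArg (DFunLike.coe (F := Module.Dual k (Reg ι ⊤)) φ) (add_mul a b x)).trans
      (map_add (show Module.Dual k (Reg ι ⊤) from φ) (a * x) (b * x))
  zero_smul φ := LinearMap.ext fun x =>
    (congrArg (DFunLike.coe (F := Module.Dual k (Reg ι ⊤)) φ) (zero_mul x)).trans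
      (map_zero (show Module.Dual k (Reg ι ⊤) from φ))

/-- The trace map `H⁰(Γ, K_Γ) → k`, evaluation at `1`. -/
def trace : CanonicalModule ι →ₗ[k] k := Module.Dual.eval k (Reg ι ⊤) 1

end CanonicalModule

instance (ι : Y ⟶ PSpace k n) : IsScalarTower k (Reg ι ⊤) (CanonicalModule ι) where
  smul_assoc c a φ := LinearMap.ext fun x =>
    (congrArg (DFunLike.coe (F := Module.Dual k (Reg ι ⊤)) φ) (smul_mul_assoc c a x)).trans
      (map_smul (show Module.Dual k (Reg ι ⊤) from φ) c (a * x))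

/-- The Serre duality map `H⁰(Γ, 𝒪(d)|_Γ) → H⁰(Γ, 𝒪(e)|_Γ)ᵛ`, `s ↦ (t ↦ trace (φ (s t)))`, where
`d + e = m` and the isomorphism `φ : 𝒪(m)|_Γ ≅ K_Γ` identifies `𝒪(e)|_Γ` with
`K_Γ ⊗ 𝒪(d)|_Γᵛ`. -/
def serreMap (ι : Y ⟶ PSpace k n) {d e m : ℤ} (h : d + e = m)
    (φ : H0 ι m ≃ₗ[Reg ι ⊤] CanonicalModule ι) : H0 ι d →ₗ[k] Module.Dual k (H0 ι e) :=
  (H0.mul ι h).compr₂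
    ((CanonicalModule.trace ι).comp ((φ : H0 ι m →ₗ[Reg ι ⊤] CanonicalModule ι).restrictScalars k))

/-- The map `W → H⁰(Γ, 𝒪(d)|_Γ)` given by restriction to `Γ`. -/
def resSeries (ι : Y ⟶ PSpace k n) {d : ℤ} (W : Submodule k (H0P k n d)) : W →ₗ[k] H0 ι d :=
  (restr ι d).comp W.subtype

/-- The exact sequence of a Gale dual pair
`0 → W → H⁰(Γ, 𝒪(d)|_Γ) ≅ H⁰(Γ, 𝒪(e)|_Γ)ᵛ → (W')ᵛ → 0`. -/
structure IsGaleSequence (ι : Y ⟶ PSpace k n) {d e m : ℤ} (h : d + e = m)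
    (φ : H0 ι m ≃ₗ[Reg ι ⊤] CanonicalModule ι)
    (W : Submodule k (H0P k n d)) (W' : Submodule k (H0P k n e)) : Prop where
  injective : Function.Injective (resSeries ι W)
  bijective : Function.Bijective (serreMap ι h φ)
  exact : Function.Exact (resSeries ι W) ((resSeries ι W').dualMap.comp (serreMap ι h φ))
  surjective : Function.Surjective ((resSeries ι W').dualMap.comp (serreMap ι h φ))

end GoppaDuality

end

open GoppaDuality

/-! Let S = k[x₀, x₁, x₂], let M be the direct sum of the H⁰(Γ, 𝒪(n)), let R be the image of S in M,
and put D = d₁ + d₂ - 3. Everything rests on how far R is from M. If v ∈ M_n has all xᵢ v ∈ R, lift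
these products to forms rᵢ of degree n + 1. The differences xⱼ rᵢ - xᵢ rⱼ lie in (F, G), and since
the syzygies of (F, G) are the multiples of (G, -F), they produce a form c of degree n + 3 - d₁ - d₂
(`IsObstruction`). If c lies in (x₀, x₁, x₂), then v ∈ R. Hence the socle of M / R sits in degree D
only (`mem_map_of_X_mul`), M and R agree above D (`le_map`), and R_D has codimension at most one in
M_D. So some functional l has R_D as its kernel on M_D (`exists_functional`).

This l plays the role of the residue. Let d + e = D. If l(st) = 0 for all t ∈ M_e, the socle
statement gives s M_{e-j} ⊆ R_{D-j} for all j. In negative degrees R is zero while M contains units,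
so s = 0 (`eq_zero_of_forall_mul`). A similar induction shows that R_d is the annihilator of R_e
(`mem_map_of_forall_mul`). The units also give all M_d the same finite dimension, that of M_0 =
H⁰(Γ, 𝒪_Γ), so injectivity of the pairing maps is enough: e = 0 yields φ, and general e yields Serre
duality.

Units exist because Γ is finite, which follows from the bound d₁d₂ on its Hilbert function in large
degrees. A line missing Γ need not exist over a finite field, so a unit of degree 1 is patched from
the coordinates by means of Drazin inverses (`exists_unit_of_finite`).

A complement of the kernel of restriction has the same image on Γ as the space of all forms. The
Gale sequence is therefore linear algebra (`exact_of_isCompl`, `isCompl_of_exact`). In particular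
such a W contains sections with the same restriction to Γ as the powers xᵢᵈ, so it has no base point
on Γ. Sections without common zero define exactly one morphism (`exists_isInducedBy`,
`IsInducedBy.unique`), and uniqueness identifies it with the composite through the plane. -/

noncomputable section
namespace GoppaDuality

/-! ### Koszul relations modulo two relatively prime ternary forms -/

section Koszul

variable {k : Type u} [Field k]

/-- The homogeneous polynomials of integer degree `n`. -/
def homogeneousPart (k : Type u) [Field k] (n : ℤ) : Submodule k (MvPolynomial (Fin 3) k) where
  carrier := {p | ∀ d, coeff d p ≠ 0 → (d.degree : ℤ) = n}
  add_mem' {p q} hp hq d hd := by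
    by_cases h : coeff d p = 0
    · exact hq d fun h' => hd (by simp [h, h'])
    · exact hp d h
  zero_mem' d hd := absurd (coeff_zero d) hd
  smul_mem' c p hp d hd := hp d fun h => hd (by simp [h])

lemma mem_homogeneousPart_natCast {n : ℕ} {p : MvPolynomial (Fin 3) k} :
    p ∈ homogeneousPart k n ↔ p.IsHomogeneous n := by
  simp only [homogeneousPart, Submodule.mem_mk, AddSubmonoid.mem_mk, AddSubsemigroup.mem_mk,
    Set.mem_ofPred_eq, Nat.cast_inj]
  refine ⟨fun h d hd => ?_, fun h d hd => ?_⟩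
  · exact (DFunLike.congr_fun Finsupp.degree_eq_weight_one d).symm.trans (h d hd)
  · exact (DFunLike.congr_fun Finsupp.degree_eq_weight_one d).trans (h hd)

lemma homogeneousPart_of_neg {n : ℤ} (hn : n < 0) {p : MvPolynomial (Fin 3) k}
    (hp : p ∈ homogeneousPart k n) : p = 0 := by
  ext d
  by_contra h
  have := hp d h
  omega

lemma X_mem_homogeneousPart (i : Fin 3) :
    (X i : MvPolynomial (Fin 3) k) ∈ homogeneousPart k 1 := by
  exact_mod_cast mem_homogeneousPart_natCast.2 (isHomogeneous_X k i)

lemma mul_mem_homogeneousPart {n m : ℤ} {p q : MvPolynomial (Fin 3) k}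
    (hp : p ∈ homogeneousPart k n) (hq : q ∈ homogeneousPart k m) :
    p * q ∈ homogeneousPart k (n + m) := by
  rcases lt_or_ge n 0 with hn | hn
  · rw [homogeneousPart_of_neg hn hp, zero_mul]; exact zero_mem _
  rcases lt_or_ge m 0 with hm | hm
  · rw [homogeneousPart_of_neg hm hq, mul_zero]; exact zero_mem _
  lift n to ℕ using hn
  lift m to ℕ using hm
  exact_mod_cast mem_homogeneousPart_natCast.2
    ((mem_homogeneousPart_natCast.1 hp).mul (mem_homogeneousPart_natCast.1 hq))

lemma X_mul_mem_homogeneousPart {n m : ℤ} (h : n + 1 = m) (i : Fin 3) {p : MvPolynomial (Fin 3) k}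
    (hp : p ∈ homogeneousPart k n) : X i * p ∈ homogeneousPart k m := by
  rw [← h, mul_comm]
  exact mul_mem_homogeneousPart hp (X_mem_homogeneousPart i)

/-- The component of integer degree `n` of a polynomial. -/
noncomputable def intComponent (n : ℤ) : MvPolynomial (Fin 3) k →ₗ[k] MvPolynomial (Fin 3) k :=
  if 0 ≤ n then homogeneousComponent n.toNat else 0

lemma coeff_intComponent (n : ℤ) (p : MvPolynomial (Fin 3) k) (d : Fin 3 →₀ ℕ) :
    coeff d (intComponent n p) = if (d.degree : ℤ) = n then coeff d p else 0 := by
  unfold intComponent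
  split_ifs with h h' h'
  · rw [coeff_homogeneousComponent, if_pos (by omega)]
  · rw [coeff_homogeneousComponent, if_neg (by omega)]
  · omega
  · simp

lemma intComponent_mem (n : ℤ) (p : MvPolynomial (Fin 3) k) :
    intComponent n p ∈ homogeneousPart k n := by
  intro d hd
  rw [coeff_intComponent] at hd
  by_contra h
  exact hd (if_neg h)

lemma intComponent_of_mem {n m : ℤ} {p : MvPolynomial (Fin 3) k} (hp : p ∈ homogeneousPart k m) :
    intComponent n p = if m = n then p else 0 := by
  ext d
  rw [coeff_intComponent]
  by_cases h : coeff d p = 0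
  · split_ifs <;> simp [h]
  · rw [hp d h]
    split_ifs <;> simp

lemma intComponent_self {n : ℤ} {p : MvPolynomial (Fin 3) k} (hp : p ∈ homogeneousPart k n) :
    intComponent n p = p := by
  rw [intComponent_of_mem hp, if_pos rfl]

/-- Lets any relation with homogeneous coefficients F, G, xᵢ be replaced by its part in the one
relevant degree. Integer degrees make the negative cases uniform. -/
lemma intComponent_mul {m : ℤ} {F : MvPolynomial (Fin 3) k} (hF : F ∈ homogeneousPart k m) (n : ℤ)
    (p : MvPolynomial (Fin 3) k) : intComponent n (p * F) = intComponent (n - m) p * F := by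
  induction p using MvPolynomial.induction_on' with
  | monomial d c =>
    have hd : monomial d c ∈ homogeneousPart k (d.degree : ℤ) :=
      mem_homogeneousPart_natCast.2 (isHomogeneous_monomial c rfl)
    rw [intComponent_of_mem (mul_mem_homogeneousPart hd hF), intComponent_of_mem hd]
    by_cases h : (d.degree : ℤ) + m = n
    · rw [if_pos h, if_pos (by omega)]
    · rw [if_neg h, if_neg (by omega), zero_mul]
  | add p q hp hq => rw [add_mul, map_add, map_add, hp, hq, add_mul]

lemma intComponent_mul' {m : ℤ} {F : MvPolynomial (Fin 3) k} (hF : F ∈ homogeneousPart k m) (n : ℤ)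
    (p : MvPolynomial (Fin 3) k) : intComponent n (F * p) = F * intComponent (n - m) p := by
  rw [mul_comm, intComponent_mul hF, mul_comm]

lemma X_dvd_of_dvd_X_mul {i j : Fin 3} (hij : i ≠ j) {p : MvPolynomial (Fin 3) k}
    (h : X i ∣ X j * p) : X i ∣ p := by
  refine ((X_prime (R := k) (i := i)).dvd_or_dvd h).resolve_left fun h' => hij ?_
  rwa [X_dvd_X] at h'

/-- Exactness of the Koszul complex of the coordinates in the last spot. -/
lemma exists_eq_X_mul {p q r : MvPolynomial (Fin 3) k} (hq : X 1 * p = X 0 * q)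
    (hr : X 2 * p = X 0 * r) : ∃ w, p = X 0 * w ∧ q = X 1 * w ∧ r = X 2 * w := by
  obtain ⟨w, rfl⟩ : X 0 ∣ p := X_dvd_of_dvd_X_mul (j := 1) (by decide) ⟨q, hq⟩
  refine ⟨w, rfl, mul_left_cancel₀ (X_ne_zero (R := k) 0) ?_,
    mul_left_cancel₀ (X_ne_zero (R := k) 0) ?_⟩
  · linear_combination -hq
  · linear_combination -hr

/-- x₂ is a nonzerodivisor modulo (x₀, x₁): that ideal is monomial, and multiplying a monomial by x₂
does not change its divisibility by x₀ or x₁. -/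
lemma exists_of_X_mul_mem {p a b : MvPolynomial (Fin 3) k} (h : X 2 * p = X 0 * a + X 1 * b) :
    ∃ a' b', p = X 0 * a' + X 1 * b' := by
  have h1 : X 2 * p ∈ Ideal.span (X '' {0, 1} : Set (MvPolynomial (Fin 3) k)) := by
    rw [h]
    refine add_mem (Ideal.mul_mem_right _ _ (Ideal.subset_span ⟨0, by simp, rfl⟩))
      (Ideal.mul_mem_right _ _ (Ideal.subset_span ⟨1, by simp, rfl⟩))
  have h2 : p ∈ Ideal.span (X '' {0, 1} : Set (MvPolynomial (Fin 3) k)) := by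
    rw [mem_ideal_span_X_image] at h1 ⊢
    intro m hm
    obtain ⟨i, hi, hne⟩ := h1 (Finsupp.single 2 1 + m) (by
      rw [mem_support_iff, coeff_X_mul]
      exact mem_support_iff.1 hm)
    refine ⟨i, hi, fun h0 => hne ?_⟩
    rcases hi with rfl | rfl <;> simp [h0]
  rw [Set.image_pair, Ideal.mem_span_pair] at h2
  obtain ⟨a', b', hab⟩ := h2
  exact ⟨a', b', by rw [← hab]; ring⟩

/-- Exactness of the Koszul complex of the coordinates in the middle. -/
lemma exists_koszul {p q r : MvPolynomial (Fin 3) k} (h : X 2 * p + X 0 * q + X 1 * r = 0) :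
    ∃ a₀ a₁ a₂, p = X 1 * a₀ - X 0 * a₁ ∧ q = X 2 * a₁ - X 1 * a₂ ∧ r = X 0 * a₂ - X 2 * a₀ := by
  obtain ⟨a, b, hp⟩ := exists_of_X_mul_mem (p := p) (a := -q) (b := -r) (by linear_combination h)
  have h1 : X 1 * (r + X 2 * b) = X 0 * (-q - X 2 * a) := by
    rw [hp] at h
    linear_combination h
  obtain ⟨c, hc⟩ : X 1 ∣ -q - X 2 * a :=
    X_dvd_of_dvd_X_mul (j := 0) (by decide) ⟨_, h1.symm⟩
  refine ⟨b, -a, c, by rw [hp]; ring, by linear_combination -hc, ?_⟩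
  refine mul_left_cancel₀ (X_ne_zero (R := k) 1) ?_
  rw [hc] at h1
  linear_combination h1

/-- The syzygies of a pair of relatively prime polynomials. -/
lemma exists_syzygy {F G a b : MvPolynomial (Fin 3) k} (hFG : IsRelPrime F G) (hF : F ≠ 0)
    (h : a * F + b * G = 0) : ∃ c, a = c * G ∧ b = -(c * F) := by
  obtain ⟨c, hc⟩ : F ∣ b := hFG.dvd_of_dvd_mul_right ⟨-a, by linear_combination h⟩
  refine ⟨-c, mul_right_cancel₀ hF ?_, by rw [hc]; ring⟩
  rw [hc] at h
  linear_combination h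

/-- `R = k[x₀, x₁, x₂]/(F, G)` has positive depth. -/
lemma mem_span_of_forall_X_mul_mem {F G p : MvPolynomial (Fin 3) k} (hFG : IsRelPrime F G)
    (hF : F ≠ 0) (h : ∀ i, X i * p ∈ Ideal.span {F, G}) : p ∈ Ideal.span {F, G} := by
  simp only [Ideal.mem_span_pair] at h
  choose a b hab using h
  have key (i j) : ∃ c, X j * a i - X i * a j = c * G ∧ X j * b i - X i * b j = -(c * F) :=
    exists_syzygy hFG hF (by linear_combination X j * hab i - X i * hab j)
  obtain ⟨c₀, h₀, h₀'⟩ := key 0 1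
  obtain ⟨c₁, h₁, h₁'⟩ := key 1 2
  obtain ⟨c₂, h₂, h₂'⟩ := key 2 0
  -- The weighted cyclic sum of the differences xⱼ bᵢ - xᵢ bⱼ vanishes identically, and F can be
  -- cancelled.
  have hcyc : X 2 * c₀ + X 0 * c₁ + X 1 * c₂ = 0 := by
    refine (mul_eq_zero_iff_right hF).1 ?_
    linear_combination X 2 * h₀' + X 0 * h₁' + X 1 * h₂'
  obtain ⟨e₀, e₁, e₂, rfl, rfl, rfl⟩ := exists_koszul hcyc
  -- Corrected by the eᵢ, the coefficients become proportional to the coordinates: aᵢ - eᵢ G = xᵢ u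
  -- and bᵢ + eᵢ F = xᵢ v. The corrections cancel in aᵢ F + bᵢ G.
  obtain ⟨u, hu, -⟩ := exists_eq_X_mul (p := a 0 - e₀ * G) (q := a 1 - e₁ * G)
    (r := a 2 - e₂ * G) (by linear_combination h₀) (by linear_combination -h₂)
  obtain ⟨v, hv, -⟩ := exists_eq_X_mul (p := b 0 + e₀ * F) (q := b 1 + e₁ * F)
    (r := b 2 + e₂ * F) (by linear_combination h₀') (by linear_combination -h₂')
  refine Ideal.mem_span_pair.2 ⟨u, v, mul_left_cancel₀ (X_ne_zero (R := k) 0) ?_⟩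
  linear_combination hab 0 - F * hu - G * hv

/-- `c` is an obstruction to the existence of `w` with `rᵢ ≡ xᵢ w` modulo `(F, G)`. -/
def IsObstruction (F G : MvPolynomial (Fin 3) k) (r : Fin 3 → MvPolynomial (Fin 3) k)
    (c : MvPolynomial (Fin 3) k) : Prop :=
  ∃ α β : Fin 3 → MvPolynomial (Fin 3) k,
    (∀ i, X (i + 1) * r i - X i * r (i + 1) = α i * F + β i * G) ∧
    X 2 * α 0 + X 0 * α 1 + X 1 * α 2 = c * G ∧ X 2 * β 0 + X 0 * β 1 + X 1 * β 2 = -(c * F)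

namespace IsObstruction

variable {F G c c' : MvPolynomial (Fin 3) k} {r r' : Fin 3 → MvPolynomial (Fin 3) k}

/-- The cyclic sum of the three relations, weighted by x₂, x₀, x₁, has zero left side. What remains
is a syzygy of (F, G), and c is its multiplier. -/
lemma exists_of_mem (hFG : IsRelPrime F G) (hF : F ≠ 0)
    (h : ∀ i j, X j * r i - X i * r j ∈ Ideal.span {F, G}) : ∃ c, IsObstruction F G r c := by
  have h' (i : Fin 3) := Ideal.mem_span_pair.1 (h i (i + 1))
  choose α β hαβ using h'
  have h0 := hαβ 0
  have h1 := hαβ 1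
  have h2 := hαβ 2
  simp only [zero_add, show (1 + 1 : Fin 3) = 2 from rfl, show (2 + 1 : Fin 3) = 0 from rfl]
    at h0 h1 h2
  obtain ⟨c, hc, hc'⟩ := exists_syzygy (a := X 2 * α 0 + X 0 * α 1 + X 1 * α 2)
    (b := X 2 * β 0 + X 0 * β 1 + X 1 * β 2) hFG hF
    (by linear_combination X 2 * h0 + X 0 * h1 + X 1 * h2)
  exact ⟨c, α, β, fun i => (hαβ i).symm, hc, hc'⟩

lemma combine (h : IsObstruction F G r c) (h' : IsObstruction F G r' c')
    (s s' : MvPolynomial (Fin 3) k) :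
    IsObstruction F G (fun i => s * r i + s' * r' i) (s * c + s' * c') := by
  obtain ⟨α, β, h1, h2, h3⟩ := h
  obtain ⟨α', β', h1', h2', h3'⟩ := h'
  refine ⟨fun i => s * α i + s' * α' i, fun i => s * β i + s' * β' i, fun i => ?_, ?_, ?_⟩
  · linear_combination s * h1 i + s' * h1' i
  · linear_combination s * h2 + s' * h2'
  · linear_combination s * h3 + s' * h3'

/-- When c is in the irrelevant ideal, shifting α by multiples of G and β by multiples of F turns
both into Koszul cycles. These are boundaries, and subtracting the resulting multiples of F and G
leaves rᵢ proportional to xᵢ. -/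
lemma exists_solution (h : IsObstruction F G r c)
    (hc : ∃ c₀ c₁ c₂, c = X 0 * c₀ + X 1 * c₁ + X 2 * c₂) :
    ∃ w, ∀ i, r i - X i * w ∈ Ideal.span {F, G} := by
  obtain ⟨α, β, h1, h2, h3⟩ := h
  obtain ⟨c₀, c₁, c₂, rfl⟩ := hc
  obtain ⟨a₀, a₁, a₂, ha₀, ha₁, ha₂⟩ := exists_koszul (p := α 0 - c₂ * G) (q := α 1 - c₀ * G)
    (r := α 2 - c₁ * G) (by linear_combination h2)
  obtain ⟨b₀, b₁, b₂, hb₀, hb₁, hb₂⟩ := exists_koszul (p := β 0 + c₂ * F) (q := β 1 + c₀ * F)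
    (r := β 2 + c₁ * F) (by linear_combination h3)
  have e0 := h1 0
  have e1 := h1 1
  have e2 := h1 2
  simp only [zero_add, show (1 + 1 : Fin 3) = 2 from rfl, show (2 + 1 : Fin 3) = 0 from rfl]
    at e0 e1 e2
  obtain ⟨w, hw₀, hw₁, hw₂⟩ := exists_eq_X_mul (p := r 0 - a₀ * F - b₀ * G)
    (q := r 1 - a₁ * F - b₁ * G) (r := r 2 - a₂ * F - b₂ * G)
    (by linear_combination e0 + F * ha₀ + G * hb₀)
    (by linear_combination -e2 - F * ha₂ - G * hb₂)
  refine ⟨w, fun i => ?_⟩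
  fin_cases i
  · exact Ideal.mem_span_pair.2 ⟨a₀, b₀, by dsimp; rw [← hw₀]; ring⟩
  · exact Ideal.mem_span_pair.2 ⟨a₁, b₁, by dsimp; rw [← hw₁]; ring⟩
  · exact Ideal.mem_span_pair.2 ⟨a₂, b₂, by dsimp; rw [← hw₂]; ring⟩

/-- The degree is forced: the relations among the rᵢ have degree n + 2, so α has degree n + 2 - d, β
has degree n + 2 - e, and one more coordinate factor gives c. -/
lemma intComponent {d e n : ℤ} (hF : F ∈ homogeneousPart k d) (hG : G ∈ homogeneousPart k e)
    (hr : ∀ i, r i ∈ homogeneousPart k (n + 1)) (h : IsObstruction F G r c) :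
    IsObstruction F G r (intComponent (n + 3 - d - e) c) := by
  obtain ⟨α, β, h1, h2, h3⟩ := h
  refine ⟨fun i => GoppaDuality.intComponent (n + 2 - d) (α i),
    fun i => GoppaDuality.intComponent (n + 2 - e) (β i), fun i => ?_, ?_, ?_⟩
  · have := congrArg (GoppaDuality.intComponent (n + 2)) (h1 i)
    rw [map_add, intComponent_mul hF, intComponent_mul hG, intComponent_self] at this
    · exact this
    · exact sub_mem (X_mul_mem_homogeneousPart (by ring) _ (hr _))
        (X_mul_mem_homogeneousPart (by ring) _ (hr _))
  · have := congrArg (GoppaDuality.intComponent (n + 3 - d)) h2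
    simp only [map_add, intComponent_mul' (X_mem_homogeneousPart _), intComponent_mul hG] at this
    rwa [show n + 3 - d - 1 = n + 2 - d by ring] at this
  · have := congrArg (GoppaDuality.intComponent (n + 3 - e)) h3
    simp only [map_add, map_neg, intComponent_mul' (X_mem_homogeneousPart _),
      intComponent_mul hF] at this
    rwa [show n + 3 - e - 1 = n + 2 - e by ring,
      show n + 3 - e - d = n + 3 - d - e by ring] at this

end IsObstruction

lemma exists_X_combination {n : ℤ} (hn : n ≠ 0) {c : MvPolynomial (Fin 3) k}
    (hc : c ∈ homogeneousPart k n) : ∃ c₀ c₁ c₂, c = X 0 * c₀ + X 1 * c₁ + X 2 * c₂ := by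
  have h : c ∈ Ideal.span (X '' Set.univ : Set (MvPolynomial (Fin 3) k)) := by
    rw [mem_ideal_span_X_image]
    intro m hm
    by_contra! h
    have h0 : m = 0 := Finsupp.ext fun i => h i trivial
    have := hc m (mem_support_iff.1 hm)
    subst h0
    simp at this
    exact hn this.symm
  rw [Set.image_univ, Ideal.mem_span_range_iff_exists_fun] at h
  obtain ⟨a, ha⟩ := h
  exact ⟨a 0, a 1, a 2, by rw [← ha, Fin.sum_univ_three]; ring⟩

lemma exists_C_of_mem_homogeneousPart_zero {c : MvPolynomial (Fin 3) k}
    (hc : c ∈ homogeneousPart k 0) : ∃ a : k, c = C a := by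
  refine ⟨coeff 0 c, ?_⟩
  have h := mem_homogeneousPart_natCast.1 (show c ∈ homogeneousPart k ((0 : ℕ) : ℤ) from hc)
  rw [← homogeneousComponent_zero, homogeneousComponent_eq_self h]

lemma exists_homogeneous_solution {d e n : ℤ} {F G : MvPolynomial (Fin 3) k}
    (hF : F ∈ homogeneousPart k d) (hG : G ∈ homogeneousPart k e)
    {r : Fin 3 → MvPolynomial (Fin 3) k} (hr : ∀ i, r i ∈ homogeneousPart k (n + 1))
    (h : ∃ w, ∀ i, r i - X i * w ∈ Ideal.span {F, G}) :
    ∃ w ∈ homogeneousPart k n, ∀ i, r i - X i * w ∈ Ideal.span {F, G} := by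
  obtain ⟨w, hw⟩ := h
  refine ⟨_, intComponent_mem n w, fun i => ?_⟩
  obtain ⟨a, b, hab⟩ := Ideal.mem_span_pair.1 (hw i)
  have := congrArg (intComponent (n + 1)) hab
  rw [map_add, map_sub, intComponent_mul hF, intComponent_mul hG, intComponent_self (hr i),
    intComponent_mul' (X_mem_homogeneousPart i), add_sub_cancel_right] at this
  rw [← this]
  exact Ideal.mem_span_pair.2 ⟨_, _, rfl⟩

end Koszul

end GoppaDuality

namespace GoppaDuality

/-! ### The Hilbert function of a complete intersection -/

section HilbertFunction

variable {k : Type u} [Field k]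

lemma homogeneousPart_natCast_eq (n : ℕ) :
    homogeneousPart k n = restrictSupport k {d : Fin 3 →₀ ℕ | d.degree = n} := by
  ext p
  rw [mem_homogeneousPart_natCast, ← mem_homogeneousSubmodule,
    homogeneousSubmodule_eq_finsupp_supported]
  rfl

lemma coe_finsuppAntidiag_univ (n : ℕ) :
    ((Finset.univ.finsuppAntidiag n : Finset (Fin 3 →₀ ℕ)) : Set (Fin 3 →₀ ℕ)) =
      {d : Fin 3 →₀ ℕ | d.degree = n} := by
  ext d
  simp [Finset.mem_finsuppAntidiag, Finsupp.degree_eq_sum]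

instance (n : ℤ) : Module.Finite k (homogeneousPart k n) := by
  rcases lt_or_ge n 0 with hn | hn
  · have : homogeneousPart k n = ⊥ := (Submodule.eq_bot_iff _).2 fun p hp =>
      homogeneousPart_of_neg hn hp
    rw [this]
    infer_instance
  · lift n to ℕ using hn
    have : homogeneousPart k n = homogeneousSubmodule (Fin 3) k n :=
      Submodule.ext fun p => mem_homogeneousPart_natCast
    rw [this, Module.Finite.iff_fg]
    exact homogeneousSubmodule_fg _ _ n

lemma finrank_homogeneousPart (n : ℕ) :
    Module.finrank k (homogeneousPart k n) = (n + 2).choose 2 := by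
  rw [homogeneousPart_natCast_eq, Module.finrank_eq_nat_card_basis
    (basisRestrictSupport k {d : Fin 3 →₀ ℕ | d.degree = n}), ← coe_finsuppAntidiag_univ]
  simp only [SetLike.coe_sort_coe, Nat.card_eq_fintype_card, Fintype.card_coe,
    Finset.card_finsuppAntidiag_nat_eq_choose, Finset.card_univ, Fintype.card_fin]
  rw [show 3 + n - 1 = n + 2 by omega, ← Nat.choose_symm (by omega : 2 ≤ n + 2)]
  simp

/-- The numerical form of the resolution of S/(F, G): the alternating sum of the dimensions of its
four terms in degree m + d₁ + d₂. -/
lemma choose_two_identity (m d₁ d₂ : ℕ) :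
    (m + d₁ + d₂ + 2).choose 2 + (m + 2).choose 2 =
      (m + d₁ + 2).choose 2 + (m + d₂ + 2).choose 2 + d₁ * d₂ := by
  have h (x : ℕ) : 2 * (x + 2).choose 2 = (x + 2) * (x + 1) := by
    rw [Nat.choose_two_right, Nat.mul_div_cancel' ]
    · rfl
    · simpa [mul_comm] using Nat.two_dvd_mul_add_one (x + 1)
  refine Nat.eq_of_mul_eq_mul_left two_pos ?_
  simp only [mul_add, h]
  ring

/-- In large degrees, the Hilbert function of a complete intersection is at most `d₁ d₂`. -/
lemma finrank_map_homogeneousPart_le {V : Type*} [AddCommGroup V] [Module k V]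
    (T : MvPolynomial (Fin 3) k →ₗ[k] V) {d₁ d₂ : ℕ} {F G : MvPolynomial (Fin 3) k}
    (hF : F.IsHomogeneous d₁) (hG : G.IsHomogeneous d₂) (hFG : IsRelPrime F G) (hF0 : F ≠ 0)
    (hT : ∀ p ∈ Ideal.span {F, G}, T p = 0) (m : ℕ) :
    Module.finrank k ((homogeneousPart k (m + d₁ + d₂ : ℕ)).map T) ≤ d₁ * d₂ := by
  have hF' := mem_homogeneousPart_natCast.2 hF
  have hG' := mem_homogeneousPart_natCast.2 hG
  let φ : (homogeneousPart k (m + d₂ : ℕ) × homogeneousPart k (m + d₁ : ℕ)) →ₗ[k]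
      MvPolynomial (Fin 3) k :=
    ((LinearMap.mulRight k F).comp (Submodule.subtype _)).coprod
      ((LinearMap.mulRight k G).comp (Submodule.subtype _))
  have hφ (a b) : φ (a, b) = a.1 * F + b.1 * G := rfl
  have h1 := LinearMap.finrank_range_add_finrank_ker φ
  -- Syzygies are multiples c · (G, -F), so the kernel of (a, b) ↦ aF + bG is no larger than the
  -- space of forms c of degree m.
  have h2 : Module.finrank k (LinearMap.ker φ) ≤ Module.finrank k (homogeneousPart k (m : ℕ)) := by
    let ψ : homogeneousPart k (m : ℕ) →ₗ[k]
        (homogeneousPart k (m + d₂ : ℕ) × homogeneousPart k (m + d₁ : ℕ)) :=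
      LinearMap.prod
        (LinearMap.codRestrict _ ((LinearMap.mulRight k G).comp (Submodule.subtype _))
          fun c => by push_cast; exact mul_mem_homogeneousPart c.2 hG')
        (LinearMap.codRestrict _ (-(LinearMap.mulRight k F).comp (Submodule.subtype _))
          fun c => by push_cast; exact neg_mem (mul_mem_homogeneousPart c.2 hF'))
    have hψ : LinearMap.ker φ ≤ LinearMap.range ψ := by
      rintro ⟨⟨a, ha⟩, b, hb⟩ hab
      rw [LinearMap.mem_ker, hφ] at hab
      obtain ⟨c, rfl, rfl⟩ := exists_syzygy hFG hF0 hab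
      refine ⟨⟨intComponent (m : ℕ) c, intComponent_mem _ _⟩, ?_⟩
      have e1 := intComponent_mul hG' ((m + d₂ : ℕ) : ℤ) c
      have e2 := intComponent_mul hF' ((m + d₁ : ℕ) : ℤ) (-c)
      rw [intComponent_self ha] at e1
      rw [neg_mul, intComponent_self hb] at e2
      simp only [Nat.cast_add, add_sub_cancel_right, map_neg] at e1 e2
      ext1
      · exact Subtype.ext e1.symm
      · exact Subtype.ext ((e2.trans (neg_mul _ _)).symm)
    exact (Submodule.finrank_mono hψ).trans (LinearMap.finrank_range_le ψ)
  let T' := T.comp (homogeneousPart k (m + d₁ + d₂ : ℕ)).subtype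
  have h3 := LinearMap.finrank_range_add_finrank_ker T'
  have h4 : Module.finrank k (LinearMap.range φ) ≤ Module.finrank k (LinearMap.ker T') := by
    refine (Submodule.finrank_mono (t := (LinearMap.ker T').map (Submodule.subtype _)) ?_).trans
      (Submodule.finrank_map_le _ _)
    rintro _ ⟨⟨a, b⟩, rfl⟩
    refine ⟨⟨φ (a, b), ?_⟩, ?_, rfl⟩
    · rw [hφ]
      refine add_mem ?_ ?_
      · have := mul_mem_homogeneousPart a.2 hF'
        rwa [← Nat.cast_add, show m + d₂ + d₁ = m + d₁ + d₂ by ring] at this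
      · have := mul_mem_homogeneousPart b.2 hG'
        rwa [← Nat.cast_add] at this
    · exact hT _ (Ideal.mem_span_pair.2 ⟨a, b, rfl⟩)
  have h5 : LinearMap.range T' = (homogeneousPart k (m + d₁ + d₂ : ℕ)).map T := by
    rw [LinearMap.range_comp, Submodule.range_subtype]
  rw [h5, finrank_homogeneousPart] at h3
  rw [Module.finrank_prod, finrank_homogeneousPart, finrank_homogeneousPart] at h1
  rw [finrank_homogeneousPart] at h2
  have := choose_two_identity m d₁ d₂
  omega

end HilbertFunction

/-! ### Finite-dimensionality criteria and Drazin inverses -/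

section FiniteDimensional

variable {k : Type u} [Field k]

/-- A vector space that is a directed union of subspaces of bounded dimension is
finite-dimensional. -/
lemma finite_of_directed_of_finrank_le {V : Type*} [AddCommGroup V] [Module k V]
    (E : ℕ → Submodule k V) (hE : Monotone E) (hfin : ∀ n, Module.Finite k (E n)) (C : ℕ)
    (hC : ∀ n, Module.finrank k (E n) ≤ C) (hcov : ∀ v, ∃ n, v ∈ E n) : Module.Finite k V := by
  -- Bounded ranks attain a maximum, and by monotonicity the chain is constant from there on.
  obtain ⟨n, hn⟩ : ∃ n, ∀ m, Module.finrank k (E m) ≤ Module.finrank k (E n) := by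
    by_contra! h
    have (N : ℕ) : ∃ n, N ≤ Module.finrank k (E n) := by
      induction N with
      | zero => exact ⟨0, Nat.zero_le _⟩
      | succ N ih =>
        obtain ⟨n, hn⟩ := ih
        obtain ⟨m, hm⟩ := h n
        exact ⟨m, by omega⟩
    obtain ⟨n, hn⟩ := this (C + 1)
    have := hC n
    omega
  have htop : E n = ⊤ := by
    refine eq_top_iff.2 fun v _ => ?_
    obtain ⟨m, hm⟩ := hcov v
    have := hfin (max n m)
    have h := Submodule.eq_of_le_of_finrank_le (hE (le_max_left n m)) (hn _)
    rw [h]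
    exact hE (le_max_right n m) hm
  have := hfin n
  rw [htop] at this
  exact Module.Finite.equiv (Submodule.topEquiv (R := k) (M := V))

/-- `b` is the Drazin inverse of `a`. -/
def IsDrazinInverse {A : Type*} [CommRing A] (a b : A) : Prop :=
  b * (a * b) = b ∧ ∃ N, a ^ N * (a * b) = a ^ N

namespace IsDrazinInverse

variable {A B : Type*} [CommRing A] [CommRing B]

/-- The powers of a generate a stationary chain of ideals, so aᴺ = aᴺ⁺¹ b for some b. The factor
(ab)ᴺ cuts b down to the part where a is invertible. -/
lemma exists_of_finite [Algebra k A] [Module.Finite k A] (a : A) :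
    ∃ b, IsDrazinInverse a b := by
  have : IsArtinianRing A := IsArtinianRing.of_finite k A
  obtain ⟨N, b, hb⟩ := IsArtinian.exists_pow_succ_smul_dvd a (1 : A)
  simp only [smul_eq_mul, mul_one, pow_succ] at hb
  have key (m : ℕ) : a ^ N * (a * b) ^ m = a ^ N := by
    induction m with
    | zero => simp
    | succ m ih => rw [pow_succ]; linear_combination hb * (1 : A) + (a * b) * ih
  refine ⟨b * (a * b) ^ N, ?_, N, ?_⟩
  · have h := key (N + 1)
    rw [mul_pow] at h ⊢
    have h' := key N
    rw [mul_pow] at h'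
    linear_combination b ^ (N + 1) * h
  · have h := key (N + 1)
    rw [pow_succ] at h
    linear_combination h

lemma pow_mul {a b : A} (h : b * (a * b) = b) (N : ℕ) : a * b = (a * b) ^ (N + 1) := by
  induction N with
  | zero => simp
  | succ N ih => rw [pow_succ, ← ih]; linear_combination -a * h

/-- Both ab and ab' are idempotents, and each absorbs the other because some power of a is fixed by
both. They are therefore equal, and b and b' are recovered from this common idempotent. -/
lemma unique {a b b' : A} (h : IsDrazinInverse a b) (h' : IsDrazinInverse a b') : b = b' := by
  obtain ⟨h1, N, hN⟩ := h
  obtain ⟨h1', N', hN'⟩ := h'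
  have e := pow_mul h1 N'
  have e' := pow_mul h1' N
  have e1 : a * b = a * b * (a * b') := by
    have : (a * b) ^ (N' + 1) * (a * b') = (a * b) ^ (N' + 1) := by
      rw [mul_pow, pow_succ]
      linear_combination a * b ^ (N' + 1) * hN'
    rw [← e] at this
    exact this.symm
  have e2 : a * b' = a * b' * (a * b) := by
    have : (a * b') ^ (N + 1) * (a * b) = (a * b') ^ (N + 1) := by
      rw [mul_pow, pow_succ]
      linear_combination a * b' ^ (N + 1) * hN
    rw [← e'] at this
    exact this.symm
  have heq : a * b = a * b' := by linear_combination e1 - e2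
  linear_combination -h1 + h1' + (b + b') * heq

lemma map {a b : A} (h : IsDrazinInverse a b) (f : A →+* B) : IsDrazinInverse (f a) (f b) := by
  obtain ⟨h1, N, hN⟩ := h
  exact ⟨by rw [← map_mul, ← map_mul, h1], N, by rw [← map_mul, ← map_pow, ← map_mul, hN]⟩

lemma unit_mul {a b : A} (h : IsDrazinInverse a b) (r : Aˣ) :
    IsDrazinInverse (r * a) (↑r⁻¹ * b) := by
  obtain ⟨h1, N, hN⟩ := h
  have hr : (r : A) * ↑r⁻¹ = 1 := r.mul_inv
  refine ⟨?_, N, ?_⟩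
  · linear_combination ↑r⁻¹ * h1 + ↑r⁻¹ * b * a * b * hr
  · rw [mul_pow]
    linear_combination (r : A) ^ N * hN + (r : A) ^ N * a ^ N * a * b * hr

end IsDrazinInverse

end FiniteDimensional

end GoppaDuality

namespace GoppaDuality

/-! ### The section ring of a complete intersection and its duality -/

section SectionRing

variable {k : Type u} [Field k] {P : Type*} [CommRing P] [Algebra k P]

/-- The family `M` of spaces of sections of the `𝒪(d)`, inside an ambient ring `P`, with the
coordinates of projective space acting through `ev`. -/
structure IsSectionFamily (M : ℤ → Submodule k P) (ev : MvPolynomial (Fin 3) k →ₐ[k] P) :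
    Prop where
  mul_mem {d e : ℤ} {a b : P} : a ∈ M d → b ∈ M e → a * b ∈ M (d + e)
  map_le (d : ℤ) : (homogeneousPart k d).map ev.toLinearMap ≤ M d
  eq_zero_of_X_mul {v : P} : (∀ i, ev (X i) * v = 0) → v = 0
  exists_pow {d : ℤ} {v : P} : v ∈ M d →
    ∃ N : ℕ, ∀ i, ev (X i) ^ N * v ∈ (homogeneousPart k (d + N)).map ev.toLinearMap

namespace IsSectionFamily

variable {M : ℤ → Submodule k P} {ev : MvPolynomial (Fin 3) k →ₐ[k] P}

lemma X_mem (hM : IsSectionFamily M ev) (i : Fin 3) : ev (X i) ∈ M 1 :=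
  hM.map_le 1 ⟨X i, X_mem_homogeneousPart i, rfl⟩

lemma X_mul_mem (hM : IsSectionFamily M ev) {d e : ℤ} (h : d + 1 = e) (i : Fin 3) {v : P}
    (hv : v ∈ M d) : ev (X i) * v ∈ M e := by
  rw [← h, mul_comm]
  exact hM.mul_mem hv (hM.X_mem i)

lemma map_mul_mem {d e m : ℤ} (h : d + e = m) {p : MvPolynomial (Fin 3) k}
    (hp : p ∈ homogeneousPart k d) {v : P} (hv : v ∈ (homogeneousPart k e).map ev.toLinearMap) :
    ev p * v ∈ (homogeneousPart k m).map ev.toLinearMap := by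
  obtain ⟨q, hq, rfl⟩ := hv
  exact ⟨p * q, h ▸ mul_mem_homogeneousPart hp hq, map_mul ev p q⟩

/-- If the image of the polynomials is saturated in all degrees at least `n₀`, then all sections
of these degrees are polynomials. -/
lemma le_map_of_saturated (hM : IsSectionFamily M ev) (n₀ : ℤ)
    (hsat : ∀ n, n₀ ≤ n → ∀ v ∈ M n,
      (∀ i, ev (X i) * v ∈ (homogeneousPart k (n + 1)).map ev.toLinearMap) →
        v ∈ (homogeneousPart k n).map ev.toLinearMap) (n : ℤ) (hn : n₀ ≤ n) :
    M n ≤ (homogeneousPart k n).map ev.toLinearMap := by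
  -- Saturation removes one coordinate at a time from a monomial of degree K that multiplies v into
  -- the image.
  have key (K : ℕ) : ∀ n, n₀ ≤ n → ∀ v ∈ M n, (∀ m : Fin 3 →₀ ℕ, m.degree = K →
      ev (monomial m 1) * v ∈ (homogeneousPart k (n + K)).map ev.toLinearMap) →
        v ∈ (homogeneousPart k n).map ev.toLinearMap := by
    induction K with
    | zero =>
      intro n hn v hv h
      simpa using h 0 (map_zero _)
    | succ K ih =>
      intro n hn v hv h
      refine hsat n hn v hv fun i => ih (n + 1) (by omega) _ (hM.X_mul_mem rfl i hv) fun m hm => ?_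
      have := h (m + Finsupp.single i 1) (by simp [hm])
      rw [← mul_one (1 : k), ← monomial_mul, map_mul, mul_assoc] at this
      rw [show n + 1 + (K : ℤ) = n + (K + 1 : ℕ) by push_cast; ring]
      exact this
  intro v hv
  obtain ⟨N, hN⟩ := hM.exists_pow hv
  -- Among three variables, a monomial of degree 3N is divisible by some xᵢᴺ.
  refine key (3 * N) n hn v hv fun m hm => ?_
  obtain ⟨i, hi⟩ : ∃ i, N ≤ m i := by
    by_contra! h
    rw [Finsupp.degree_eq_sum, Fin.sum_univ_three] at hm
    have := h 0
    have := h 1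
    have := h 2
    omega
  obtain ⟨m', rfl⟩ : ∃ m', m = m' + Finsupp.single i N :=
    ⟨m - Finsupp.single i N, (tsub_add_cancel_of_le (by simpa using hi)).symm⟩
  have hdeg : m'.degree + N = 3 * N := by simpa using hm
  have hmem : monomial m' (1 : k) ∈ homogeneousPart k (m'.degree : ℤ) :=
    mem_homogeneousPart_natCast.2 (isHomogeneous_monomial 1 rfl)
  have := map_mul_mem (ev := ev) (m := n + (3 * N : ℕ)) (by rw [← hdeg]; push_cast; ring) hmem
    (hN i)
  rwa [← mul_assoc, ← map_pow, ← map_mul, X_pow_eq_monomial, monomial_mul, mul_one] at this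

end IsSectionFamily

/-- The sections of the `𝒪(d)` on a complete intersection `F = G = 0`. -/
structure IsCompleteIntersectionFamily (M : ℤ → Submodule k P)
    (ev : MvPolynomial (Fin 3) k →ₐ[k] P) (d₁ d₂ : ℕ) (F G : MvPolynomial (Fin 3) k) : Prop
    extends IsSectionFamily M ev where
  isHomogeneous₁ : F.IsHomogeneous d₁
  isHomogeneous₂ : G.IsHomogeneous d₂
  ne_zero : F ≠ 0
  isRelPrime : IsRelPrime F G
  map_eq_zero {p : MvPolynomial (Fin 3) k} : p ∈ Ideal.span {F, G} → ev p = 0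
  exists_pow_mul_mem {n : ℤ} {p : MvPolynomial (Fin 3) k} : p ∈ homogeneousPart k n → ev p = 0 →
    ∃ N : ℕ, ∀ i, X i ^ N * p ∈ Ideal.span {F, G}
  exists_unit : ∃ u ∈ M 1, ∃ w ∈ M (-1), u * w = 1

namespace IsCompleteIntersectionFamily

variable {M : ℤ → Submodule k P} {ev : MvPolynomial (Fin 3) k →ₐ[k] P} {d₁ d₂ : ℕ}
  {F G : MvPolynomial (Fin 3) k}

/-- Positive depth of S/(F, G) means that (F, G) is saturated, and powers of every coordinate
multiply p into it. So R is S/(F, G) in each degree. -/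
lemma mem_span_of_map_eq_zero (hM : IsCompleteIntersectionFamily M ev d₁ d₂ F G) {n : ℤ}
    {p : MvPolynomial (Fin 3) k} (hp : p ∈ homogeneousPart k n) (h : ev p = 0) :
    p ∈ Ideal.span {F, G} := by
  have key (K : ℕ) : ∀ p : MvPolynomial (Fin 3) k, (∀ m : Fin 3 →₀ ℕ, m.degree = K →
      monomial m 1 * p ∈ Ideal.span {F, G}) → p ∈ Ideal.span {F, G} := by
    induction K with
    | zero =>
      intro p h
      simpa using h 0 (map_zero _)
    | succ K ih =>
      intro p h
      refine mem_span_of_forall_X_mul_mem hM.isRelPrime hM.ne_zero fun i => ih _ fun m hm => ?_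
      have := h (m + Finsupp.single i 1) (by simp [hm])
      rw [← mul_one (1 : k), ← monomial_mul, mul_assoc] at this
      exact this
  obtain ⟨N, hN⟩ := hM.exists_pow_mul_mem hp h
  refine key (3 * N) p fun m hm => ?_
  obtain ⟨i, hi⟩ : ∃ i, N ≤ m i := by
    by_contra! h
    rw [Finsupp.degree_eq_sum, Fin.sum_univ_three] at hm
    have := h 0
    have := h 1
    have := h 2
    omega
  obtain ⟨m', rfl⟩ : ∃ m', m = m' + Finsupp.single i N :=
    ⟨m - Finsupp.single i N, (tsub_add_cancel_of_le (by simpa using hi)).symm⟩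
  rw [← mul_one (1 : k), ← monomial_mul, ← X_pow_eq_monomial, mul_assoc]
  exact Ideal.mul_mem_left _ _ (hN i)

lemma exists_obstruction (hM : IsCompleteIntersectionFamily M ev d₁ d₂ F G) {n : ℤ} {v : P}
    {r : Fin 3 → MvPolynomial (Fin 3) k} (hr : ∀ i, r i ∈ homogeneousPart k (n + 1))
    (h : ∀ i, ev (r i) = ev (X i) * v) :
    ∃ c ∈ homogeneousPart k (n + 3 - d₁ - d₂), IsObstruction F G r c := by
  obtain ⟨c, hc⟩ := IsObstruction.exists_of_mem (r := r) hM.isRelPrime hM.ne_zero fun i j =>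
    hM.mem_span_of_map_eq_zero (n := n + 1 + 1)
      (sub_mem (X_mul_mem_homogeneousPart rfl _ (hr _)) (X_mul_mem_homogeneousPart rfl _ (hr _)))
      (by rw [map_sub, map_mul, map_mul, h, h]; ring)
  exact ⟨_, intComponent_mem _ c, hc.intComponent (mem_homogeneousPart_natCast.2 hM.isHomogeneous₁)
    (mem_homogeneousPart_natCast.2 hM.isHomogeneous₂) hr⟩

/-- The solution w of the lifted problem has the same products with all coordinates as v, and no
nonzero element is killed by all coordinates. -/
lemma mem_map_of_obstruction (hM : IsCompleteIntersectionFamily M ev d₁ d₂ F G) {n : ℤ} {v : P}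
    {r : Fin 3 → MvPolynomial (Fin 3) k} (hr : ∀ i, r i ∈ homogeneousPart k (n + 1))
    (h : ∀ i, ev (r i) = ev (X i) * v) {c : MvPolynomial (Fin 3) k} (hc : IsObstruction F G r c)
    (hc' : ∃ c₀ c₁ c₂, c = X 0 * c₀ + X 1 * c₁ + X 2 * c₂) :
    v ∈ (homogeneousPart k n).map ev.toLinearMap := by
  obtain ⟨w, hw, hwr⟩ := exists_homogeneous_solution
    (mem_homogeneousPart_natCast.2 hM.isHomogeneous₁)
    (mem_homogeneousPart_natCast.2 hM.isHomogeneous₂) hr (hc.exists_solution hc')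
  refine ⟨w, hw, (sub_eq_zero.1 (hM.eq_zero_of_X_mul fun i => ?_)).symm⟩
  have := hM.map_eq_zero (hwr i)
  rw [map_sub, map_mul, h] at this
  rw [mul_sub]
  exact this

/-- The socle of `⨁ M_n / R_n` is concentrated in degree `d₁ + d₂ - 3`. -/
lemma mem_map_of_X_mul (hM : IsCompleteIntersectionFamily M ev d₁ d₂ F G) {n : ℤ}
    (hn : n ≠ d₁ + d₂ - 3) {v : P}
    (h : ∀ i, ev (X i) * v ∈ (homogeneousPart k (n + 1)).map ev.toLinearMap) :
    v ∈ (homogeneousPart k n).map ev.toLinearMap := by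
  choose r hr hrv using h
  obtain ⟨c, hc, hobs⟩ := hM.exists_obstruction hr hrv
  exact hM.mem_map_of_obstruction hr hrv hobs (exists_X_combination (by omega) hc)

lemma le_map (hM : IsCompleteIntersectionFamily M ev d₁ d₂ F G) {n : ℤ}
    (hn : (d₁ : ℤ) + d₂ - 3 < n) : M n ≤ (homogeneousPart k n).map ev.toLinearMap :=
  hM.le_map_of_saturated ((d₁ : ℤ) + d₂ - 3 + 1)
    (fun _ hm _ _ h => hM.mem_map_of_X_mul (by omega) h) n (by omega)

/-- In degree `d₁ + d₂ - 3` the polynomials have codimension at most one. -/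
lemma exists_functional (hM : IsCompleteIntersectionFamily M ev d₁ d₂ F G) :
    ∃ l : P →ₗ[k] k,
      (∀ v ∈ (homogeneousPart k ((d₁ : ℤ) + d₂ - 3)).map ev.toLinearMap, l v = 0) ∧
      ∀ v ∈ M ((d₁ : ℤ) + d₂ - 3), l v = 0 →
        v ∈ (homogeneousPart k ((d₁ : ℤ) + d₂ - 3)).map ev.toLinearMap := by
  set D : ℤ := (d₁ : ℤ) + d₂ - 3 with hD
  have key (v : P) (hv : v ∈ M D) : ∃ (r : Fin 3 → MvPolynomial (Fin 3) k) (a : k),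
      (∀ i, r i ∈ homogeneousPart k (D + 1)) ∧ (∀ i, ev (r i) = ev (X i) * v) ∧
        IsObstruction F G r (C a) := by
    have h (i) := hM.le_map (show D < D + 1 by omega) (hM.X_mul_mem rfl i hv)
    choose r hr hrv using h
    obtain ⟨c, hc, hobs⟩ := hM.exists_obstruction hr hrv
    rw [show D + 3 - d₁ - d₂ = 0 by omega] at hc
    obtain ⟨a, rfl⟩ := exists_C_of_mem_homogeneousPart_zero hc
    exact ⟨r, a, hr, hrv, hobs⟩
  -- If every section of degree D is a form, the zero functional already has the required kernel.
  by_cases htriv : M D ≤ (homogeneousPart k D).map ev.toLinearMap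
  · exact ⟨0, fun _ _ => rfl, fun v hv _ => htriv hv⟩
  obtain ⟨v₀, hv₀, hv₀'⟩ := Set.not_subset.1 htriv
  obtain ⟨l, hl, hlR⟩ := Submodule.exists_le_ker_of_notMem hv₀'
  obtain ⟨r₀, a₀, hr₀, hrv₀, hobs₀⟩ := key v₀ hv₀
  refine ⟨l, fun v hv => hlR hv, fun v hv hlv => ?_⟩
  obtain ⟨r, a, hr, hrv, hobs⟩ := key v hv
  -- The obstructions a of v and a₀ of v₀ are constants, and this combination cancels them. As l is
  -- nonzero at v₀, l v = 0 then forces a = 0.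
  have hcomb : a₀ • v - a • v₀ ∈ (homogeneousPart k D).map ev.toLinearMap := by
    refine hM.mem_map_of_obstruction (r := fun i => C a₀ * r i + C (-a) * r₀ i) (fun i => ?_)
      (fun i => ?_) (hobs.combine hobs₀ (C a₀) (C (-a))) ⟨0, 0, 0, ?_⟩
    · simp only [← smul_eq_C_mul]
      exact add_mem (Submodule.smul_mem _ _ (hr i)) (Submodule.smul_mem _ _ (hr₀ i))
    · simp only [map_add, map_neg, map_mul, neg_mul, hrv, hrv₀, ← algebraMap_eq, AlgHom.commutes,
        Algebra.smul_def]
      ring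
    · simp only [mul_zero, add_zero, ← C_mul, ← C_add]
      rw [show a₀ * a + -a * a₀ = 0 by ring, C_0]
  have h1 := hlR hcomb
  rw [LinearMap.mem_ker, map_sub, map_smul, map_smul, hlv, smul_zero, zero_sub, neg_eq_zero,
    smul_eq_mul] at h1
  obtain rfl : a = 0 := (mul_eq_zero.1 h1).resolve_right hl
  exact hM.mem_map_of_obstruction hr hrv hobs ⟨0, 0, 0, by simp⟩

lemma pow_mem (hM : IsCompleteIntersectionFamily M ev d₁ d₂ F G) {d : ℤ} {a : P} (ha : a ∈ M d)
    (n : ℕ) : a ^ n ∈ M (n * d) := by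
  have h0 : (1 : P) ∈ M 0 := by
    obtain ⟨u, hu, w, hw, h⟩ := hM.exists_unit
    rw [← h]
    exact hM.mul_mem hu hw
  induction n with
  | zero => simpa using h0
  | succ n ih =>
    rw [pow_succ]
    have := hM.mul_mem ih ha
    rwa [show (n : ℤ) * d + d = ((n + 1 : ℕ) : ℤ) * d by push_cast; ring] at this

/-- A functional vanishing exactly on the polynomials induces a nondegenerate pairing. -/
lemma eq_zero_of_forall_mul (hM : IsCompleteIntersectionFamily M ev d₁ d₂ F G) {l : P →ₗ[k] k}
    (hl : ∀ v ∈ M ((d₁ : ℤ) + d₂ - 3), l v = 0 →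
      v ∈ (homogeneousPart k ((d₁ : ℤ) + d₂ - 3)).map ev.toLinearMap)
    {d e : ℤ} (hde : d + e = (d₁ : ℤ) + d₂ - 3) {s : P} (hs : s ∈ M d)
    (h : ∀ t ∈ M e, l (s * t) = 0) : s = 0 := by
  -- Downward induction on the degree of t. After the first step the products st lie below degree D,
  -- where M / R has no socle.
  have key (j : ℕ) : ∀ t ∈ M (e - j), s * t ∈ (homogeneousPart k (d + (e - j))).map
      ev.toLinearMap := by
    induction j with
    | zero =>
      intro t ht
      simp only [Nat.cast_zero, sub_zero] at ht ⊢
      have := hM.mul_mem hs ht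
      rw [hde] at this ⊢
      exact hl _ this (h t ht)
    | succ j ih =>
      intro t ht
      refine hM.mem_map_of_X_mul (by push_cast; omega) fun i => ?_
      have := ih (ev (X i) * t) (hM.X_mul_mem (by push_cast; ring) i ht)
      rw [mul_left_comm, show d + (e - (j + 1 : ℕ)) + 1 = d + (e - j) by push_cast; ring]
      exact this
  obtain ⟨u, hu, w, hw, huw⟩ := hM.exists_unit
  -- The bound e ≤ j provides the unit wʲ⁻ᵉ of degree e - j. The bound d + e < j makes its product
  -- with s of negative degree, where the only form is zero.
  obtain ⟨j, hj⟩ : ∃ j : ℕ, e ≤ j ∧ d + e < j :=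
    ⟨(max e (d + e + 1)).toNat, by omega, by omega⟩
  obtain ⟨m, hm⟩ := Int.eq_ofNat_of_zero_le (show 0 ≤ (j : ℤ) - e by omega)
  obtain ⟨p, hp, hpw⟩ := key j (w ^ m) (by
    have := hM.pow_mem hw m
    rwa [show (m : ℤ) * -1 = e - j by omega] at this)
  rw [homogeneousPart_of_neg (by omega) hp, map_zero] at hpw
  calc s = s * w ^ m * u ^ m := by rw [mul_assoc, ← mul_pow, mul_comm w, huw, one_pow, mul_one]
    _ = 0 := by rw [← hpw, zero_mul]

/-- The polynomials of degree `d` are the annihilator of the polynomials of degree `e`. -/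
lemma mem_map_of_forall_mul (hM : IsCompleteIntersectionFamily M ev d₁ d₂ F G) {l : P →ₗ[k] k}
    (hl : ∀ v ∈ M ((d₁ : ℤ) + d₂ - 3), l v = 0 →
      v ∈ (homogeneousPart k ((d₁ : ℤ) + d₂ - 3)).map ev.toLinearMap)
    {d e : ℤ} (hde : d + e = (d₁ : ℤ) + d₂ - 3) {s : P} (hs : s ∈ M d)
    (h : ∀ t ∈ (homogeneousPart k e).map ev.toLinearMap, l (s * t) = 0) :
    s ∈ (homogeneousPart k d).map ev.toLinearMap := by
  rcases lt_or_ge e 0 with he | he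
  -- For e < 0 the hypothesis is empty, but then d > d₁ + d₂ - 3 and every section is a form.
  · exact hM.le_map (by omega) hs
  -- Induction on j, the degree of the test forms: each xᵢ s satisfies the hypothesis for j - 1, so
  -- xᵢ s is a form, and s lies strictly below the socle degree.
  have key (j : ℕ) : ∀ d, d + j = (d₁ : ℤ) + d₂ - 3 → ∀ s ∈ M d,
      (∀ t ∈ (homogeneousPart k j).map ev.toLinearMap,
        s * t ∈ (homogeneousPart k ((d₁ : ℤ) + d₂ - 3)).map ev.toLinearMap) →
      s ∈ (homogeneousPart k d).map ev.toLinearMap := by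
    induction j with
    | zero =>
      intro d hd s hs h
      rw [Nat.cast_zero, add_zero] at hd
      rw [hd]
      have := h 1 ⟨1, mem_homogeneousPart_natCast.2 (isHomogeneous_one _ _), map_one ev⟩
      rwa [mul_one] at this
    | succ j ih =>
      intro d hd s hs h
      refine hM.mem_map_of_X_mul (by push_cast at hd; omega) fun i =>
        ih _ (by push_cast at hd; omega) _ (hM.X_mul_mem rfl i hs) fun t ht => ?_
      rw [mul_comm (ev (X i)), mul_assoc]
      exact h _ (IsSectionFamily.map_mul_mem (by push_cast; ring) (X_mem_homogeneousPart i) ht)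
  lift e to ℕ using he
  refine key e d hde s hs fun t ht => hl _ ?_ (h t ht)
  rw [← hde]
  exact hM.mul_mem hs (hM.map_le _ ht)

/-- All spaces of sections are isomorphic. -/
lemma nonempty_linearEquiv (hM : IsCompleteIntersectionFamily M ev d₁ d₂ F G) (d : ℤ) (j : ℕ) :
    Nonempty (M d ≃ₗ[k] M (d + j)) := by
  obtain ⟨u, hu, w, hw, huw⟩ := hM.exists_unit
  have hu' := hM.pow_mem hu j
  have hw' := hM.pow_mem hw j
  refine ⟨LinearEquiv.ofLinearMap
    (((LinearMap.mulRight k (u ^ j)).comp (M d).subtype).codRestrict _ fun v => ?_)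
    (((LinearMap.mulRight k (w ^ j)).comp (M (d + j)).subtype).codRestrict _ fun v => ?_) ?_ ?_⟩
  · have := hM.mul_mem v.2 hu'
    rwa [mul_one] at this
  · have := hM.mul_mem v.2 hw'
    rwa [show d + j + (j : ℤ) * -1 = d by ring] at this
  · ext v
    change v.1 * w ^ j * u ^ j = v.1
    rw [mul_assoc, ← mul_pow, mul_comm w, huw, one_pow, mul_one]
  · ext v
    change v.1 * u ^ j * w ^ j = v.1
    rw [mul_assoc, ← mul_pow, huw, one_pow, mul_one]

/-- A power of the unit moves degree d beyond d₁ + d₂ - 3, where all sections come from a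
finite-dimensional space of forms. -/
lemma finite (hM : IsCompleteIntersectionFamily M ev d₁ d₂ F G) (d : ℤ) :
    Module.Finite k (M d) := by
  obtain ⟨j, hj⟩ : ∃ j : ℕ, (d₁ : ℤ) + d₂ - 3 < d + j :=
    ⟨((d₁ : ℤ) + d₂ - 2 - d).toNat, by omega⟩
  obtain ⟨e⟩ := hM.nonempty_linearEquiv d j
  have : M (d + j) = (homogeneousPart k (d + j)).map ev.toLinearMap :=
    le_antisymm (hM.le_map hj) (hM.map_le _)
  have : Module.Finite k (M (d + j)) := by
    rw [this]
    infer_instance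
  exact Module.Finite.equiv e.symm

lemma finrank_eq (hM : IsCompleteIntersectionFamily M ev d₁ d₂ F G) (d e : ℤ) :
    Module.finrank k (M d) = Module.finrank k (M e) := by
  wlog h : d ≤ e generalizing d e
  · exact (this e d (by omega)).symm
  obtain ⟨j, hj⟩ := Int.le.dest h
  obtain ⟨f⟩ := hM.nonempty_linearEquiv d j
  rw [f.finrank_eq, hj]

end IsCompleteIntersectionFamily

end SectionRing

end GoppaDuality

namespace GoppaDuality

/-! ### Functions on the standard charts of projective space -/

variable {k : Type u} [Field k] {n : ℕ}

/-- The constants of the coordinate ring of `D₊(g)`. -/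
def awayConstants (k : Type u) [Field k] (n : ℕ) (g : MvPolynomial (Fin (n + 1)) k) :
    k →+* HomogeneousLocalization.Away (grading k n) g :=
  (HomogeneousLocalization.fromZeroRingHom (grading k n) _).comp (algebraMap k (grading k n 0))

lemma chart_ι_toSpecField (i : Fin (n + 1)) :
    (chart k n i).ι ≫ toSpecField k n = (chart k n i).toSpecΓ ≫ Spec.map
      (CommRingCat.ofHom (awayConstants k n (X i)) ≫ Proj.awayToSection (grading k n) (X i)) := by
  have h := Proj.awayι_toSpecZero (grading k n) (X i)
    ((mem_homogeneousSubmodule 1 _).2 (isHomogeneous_X k i)) one_pos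
  rw [← Proj.basicOpenIsoSpec_inv_ι, Category.assoc, Iso.inv_comp_eq,
    Proj.basicOpenIsoSpec_hom, Proj.basicOpenToSpec] at h
  rw [toSpecField]
  rw [← Category.assoc]
  refine (congrArg (· ≫ _) h).trans ?_
  simp only [Category.assoc, ← Spec.map_comp]
  rfl

lemma isAffineOpen_chart (i : Fin (n + 1)) : IsAffineOpen (chart k n i) :=
  Proj.isAffineOpen_basicOpen _ _ ((mem_homogeneousSubmodule 1 _).2 (isHomogeneous_X k i)) one_pos

lemma ι_comp_toSpec {Y : Scheme.{u}} {R : CommRingCat.{u}} (f : Y ⟶ Spec R) (V : Y.Opens) :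
    V.ι ≫ f = V.toSpecΓ ≫ Spec.map ((Scheme.ΓSpecIso R).inv ≫ f.appLE ⊤ V le_top) := by
  have e : V ≤ f ⁻¹ᵁ ⊤ := fun _ _ => trivial
  change _ = _ ≫ Spec.map (_ ≫ f.appLE ⊤ V e)
  rw [Spec.map_comp, Scheme.Opens.toSpecΓ_SpecMap_appLE_assoc, Scheme.Opens.toSpecΓ_top]
  simp only [Category.assoc, toSpecΓ_SpecMap_ΓSpecIso_inv, Category.comp_id]
  rw [Scheme.Hom.resLE_comp_ι]

/-- Reconciles the scalars coming from the structure morphism with the constants of the homogeneous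
localization. The chart is affine, so it suffices to compare after applying Spec. -/
lemma toSpecField_appLE (i : Fin (n + 1)) :
    (Scheme.ΓSpecIso (CommRingCat.of k)).inv ≫
      (toSpecField k n).appLE ⊤ (chart k n i) le_top =
    CommRingCat.ofHom (awayConstants k n (X i)) ≫ Proj.awayToSection (grading k n) (X i) := by
  have h := (ι_comp_toSpec (toSpecField k n) (chart k n i)).symm.trans
    (chart_ι_toSpecField (k := k) i)
  have : IsIso (chart k n i).toSpecΓ := by
    rw [← (isAffineOpen_chart i).isoSpec_hom]
    infer_instance
  rw [cancel_epi] at h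
  exact Spec.map_injective h

variable {Y : Scheme.{u}}

/-- Evaluation of polynomials at the functions `f^*(xⱼ / xᵢ)` on an open contained in
`f⁻¹(D₊(xᵢ))`. -/
def evalOn (f : Y ⟶ PSpace k n) (i : Fin (n + 1)) {V : Y.Opens} (e : V ≤ piece f i) :
    MvPolynomial (Fin (n + 1)) k →ₐ[k] Reg f V :=
  aeval fun j => ratioOn f i j e

/-- The regular function `F / xᵢᵐ`, as an element of the degree zero part of a localization. -/
def awayDehom (i : Fin (n + 1)) {m : ℕ} (F : MvPolynomial (Fin (n + 1)) k)
    (hF : F.IsHomogeneous m) : HomogeneousLocalization.Away (grading k n) (X i) :=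
  HomogeneousLocalization.Away.mk (grading k n)
    ((mem_homogeneousSubmodule 1 _).2 (isHomogeneous_X k i)) m F
    ((mem_homogeneousSubmodule _ _).2 (by simpa using hF))

/-- Each monomial of a form of degree m contributes the same factor cᵐ. It is applied with c = 1/xᵢ
for dehomogenization, and with a ratio of coordinates for a change of chart. -/
lemma eval₂_mul_inv {L : Type*} [CommRing L] (g : MvPolynomial (Fin (n + 1)) k →+* L) (c : L)
    {m : ℕ} {F : MvPolynomial (Fin (n + 1)) k} (hF : F.IsHomogeneous m) :
    eval₂ (g.comp C) (fun j => g (X j) * c) F = g F * c ^ m := by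
  have h1 : g F = eval₂ (g.comp C) (fun j => g (X j)) F := by
    conv_lhs => rw [← eval₂_eta F]
    exact hom_eval₂ F C g X
  rw [h1, eval₂_eq, eval₂_eq, Finset.sum_mul]
  refine Finset.sum_congr rfl fun d hd => ?_
  have hdeg := (DFunLike.congr_fun Finsupp.degree_eq_weight_one d).trans
    (hF (mem_support_iff.1 hd))
  rw [Finsupp.degree_eq_sum] at hdeg
  simp only [mul_pow]
  rw [Finset.prod_mul_distrib, Finset.prod_pow_eq_pow_sum, mul_assoc]
  congr 3
  rw [← hdeg]
  exact Finset.sum_subset (Finset.subset_univ _) fun j _ hj => Finsupp.notMem_support_iff.1 hj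

lemma awayDehom_eq_eval₂ (i : Fin (n + 1)) {m : ℕ} {F : MvPolynomial (Fin (n + 1)) k}
    (hF : F.IsHomogeneous m) :
    awayDehom i F hF =
      eval₂ (awayConstants k n (X i)) (fun j => awayDehom i (X j) (isHomogeneous_X k j)) F := by
  apply HomogeneousLocalization.val_injective
  have h := hom_eval₂ F (awayConstants k n (X i)) (algebraMap
    (HomogeneousLocalization.Away (grading k n) (X i)) (Localization.Away (X i : MvPolynomial (Fin (n + 1)) k)))
    (fun j => awayDehom i (X j) (isHomogeneous_X k j))
  refine Eq.trans ?_ h.symm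
  let c : Localization.Away (X i : MvPolynomial (Fin (n + 1)) k) :=
    Localization.mk 1 ⟨X i, 1, pow_one _⟩
  have h1 := eval₂_mul_inv (algebraMap (MvPolynomial (Fin (n + 1)) k) (Localization.Away (X i : MvPolynomial (Fin (n + 1)) k)))
    c hF
  have h2 (m : ℕ) (G : MvPolynomial (Fin (n + 1)) k) (hG : G.IsHomogeneous m) :
      algebraMap (HomogeneousLocalization.Away (grading k n) (X i)) (Localization.Away (X i : MvPolynomial (Fin (n + 1)) k))
        (awayDehom i G hG) =
          algebraMap (MvPolynomial (Fin (n + 1)) k) (Localization.Away (X i : MvPolynomial (Fin (n + 1)) k)) G * c ^ m := by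
    rw [HomogeneousLocalization.algebraMap_apply, awayDehom, HomogeneousLocalization.Away.val_mk,
      Localization.mk_pow, ← Localization.mk_one_eq_algebraMap, Localization.mk_mul]
    simp
    rfl
  refine (h2 m F hF).trans (h1.symm.trans ?_)
  congr 1
  funext j
  exact ((h2 1 (X j) (isHomogeneous_X k j)).trans (by rw [pow_one])).symm

lemma algebraMap_eq_awayToSection (f : Y ⟶ PSpace k n) (i : Fin (n + 1)) {V : Y.Opens}
    (e : V ≤ piece f i) (c : k) : algebraMap k (Reg f V) c =
      (f.appLE (chart k n i) V e).hom ((Proj.awayToSection (grading k n) (X i)).hom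
        (awayConstants k n (X i) c)) := by
  have h := ConcreteCategory.congr_hom (toSpecField_appLE (k := k) i) c
  refine Eq.trans ?_ (congrArg (f.appLE (chart k n i) V e).hom h)
  exact (appLE_appLE f (toSpecField k n) (U := ⊤) (fun _ _ => trivial) e (fun _ _ => trivial) _).symm

/-- Dehomogenization is evaluation at the ratios of coordinates. -/
lemma appLE_dehom (f : Y ⟶ PSpace k n) (i : Fin (n + 1)) {V : Y.Opens} (e : V ≤ piece f i) {m : ℕ}
    {F : MvPolynomial (Fin (n + 1)) k} (hF : F.IsHomogeneous m) :
    (f.appLE (chart k n i) V e).hom (dehom i F hF) = evalOn f i e F := by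
  have h := hom_eval₂ F (awayConstants k n (X i))
    ((f.appLE (chart k n i) V e).hom.comp (Proj.awayToSection (grading k n) (X i)).hom)
    (fun j => awayDehom i (X j) (isHomogeneous_X k j))
  rw [← awayDehom_eq_eval₂ i hF] at h
  refine h.trans ?_
  change eval₂ _ _ F = eval₂ (algebraMap k (Reg f V)) _ F
  congr 1
  ext c
  exact (algebraMap_eq_awayToSection f i e c).symm

/-- All functions on `D₊(xᵢ)` are of the form `F / xᵢᵐ`. -/
lemma exists_dehom (i : Fin (n + 1)) (a : Γ(PSpace k n, chart k n i)) :
    ∃ (m : ℕ) (F : MvPolynomial (Fin (n + 1)) k) (hF : F.IsHomogeneous m), dehom i F hF = a := by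
  have hi : (X i : MvPolynomial (Fin (n + 1)) k) ∈ grading k n 1 :=
    (mem_homogeneousSubmodule 1 _).2 (isHomogeneous_X k i)
  let E := Proj.basicOpenIsoAway (grading k n) (X i) hi one_pos
  obtain ⟨m, F, hF, h⟩ := HomogeneousLocalization.Away.mk_surjective (grading k n) hi (E.inv.hom a)
  refine ⟨m, F, (mem_homogeneousSubmodule _ _).1 (by simpa using hF), ?_⟩
  have h' := congrArg E.hom.hom h
  exact h'.trans (ConcreteCategory.congr_hom E.inv_hom_id a)

/-- Exhibits the overlap as the locus where xⱼ/xᵢ is invertible, so that vanishing on it means being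
killed by a power of that ratio. -/
lemma chart_inf_chart (i j : Fin (n + 1)) :
    chart k n i ⊓ chart k n j = (PSpace k n).basicOpen (ratio k i j) := by
  have hi : (X i : MvPolynomial (Fin (n + 1)) k) ∈ grading k n 1 :=
    (mem_homogeneousSubmodule 1 _).2 (isHomogeneous_X k i)
  have hj : (X j : MvPolynomial (Fin (n + 1)) k) ∈ grading k n 1 :=
    (mem_homogeneousSubmodule 1 _).2 (isHomogeneous_X k j)
  have h1 := Proj.awayι_preimage_basicOpen (grading k n) hi one_pos hj one_pos
  have h2 := Scheme.Opens.toSpecΓ_preimage_basicOpen (chart k n i) (ratio k i j)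
  rw [← Proj.basicOpenIsoSpec_inv_ι] at h1
  have h3 : (chart k n i).ι ⁻¹ᵁ (chart k n j) =
      (chart k n i).ι ⁻¹ᵁ (PSpace k n).basicOpen (ratio k i j) := by
    rw [← h2]
    have h4 := congrArg (fun U => (Proj.basicOpenIsoSpec (grading k n) (X i) hi one_pos).hom ⁻¹ᵁ U) h1
    simp only [← Scheme.Hom.comp_preimage, Iso.hom_inv_id_assoc] at h4
    refine h4.trans ?_
    rw [Proj.basicOpenIsoSpec_hom, Proj.basicOpenToSpec]
    refine congrArg (fun U => (chart k n i).toSpecΓ ⁻¹ᵁ U)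
      (congrArg PrimeSpectrum.basicOpen (?_ : (Proj.awayToSection (grading k n) (X i)).hom
        (HomogeneousLocalization.Away.isLocalizationElem hi hj) = ratio k i j))
    refine congrArg (Proj.awayToSection (grading k n) (X i)).hom ?_
    apply HomogeneousLocalization.val_injective
    rw [HomogeneousLocalization.Away.val_mk, HomogeneousLocalization.Away.val_mk]
    simp only [pow_one]
  have h5 := congrArg (fun U => (chart k n i).ι ''ᵁ U) h3
  simp only [Scheme.Hom.image_preimage_eq_opensRange_inf, Scheme.Opens.opensRange_ι] at h5
  rw [h5]
  exact inf_eq_right.2 (Scheme.basicOpen_le _ _)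

lemma awayMap_ratio (i j l : Fin (n + 1)) :
    ((PSpace k n).presheaf.map
        (homOfLE (inf_le_left : chart k n i ⊓ chart k n j ≤ chart k n i)).op).hom (ratio k i l) =
    ((PSpace k n).presheaf.map
        (homOfLE (inf_le_left : chart k n i ⊓ chart k n j ≤ chart k n i)).op).hom (ratio k i j) *
      ((PSpace k n).presheaf.map
        (homOfLE (inf_le_right : chart k n i ⊓ chart k n j ≤ chart k n j)).op).hom (ratio k j l) := by
  have hi : (X i : MvPolynomial (Fin (n + 1)) k) ∈ grading k n 1 :=
    (mem_homogeneousSubmodule 1 _).2 (isHomogeneous_X k i)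
  have hj : (X j : MvPolynomial (Fin (n + 1)) k) ∈ grading k n 1 :=
    (mem_homogeneousSubmodule 1 _).2 (isHomogeneous_X k j)
  have hle : chart k n i ⊓ chart k n j ≤ Proj.basicOpen (grading k n) (X i * X j) :=
    (Proj.basicOpen_mul (grading k n) (X i) (X j)).ge
  have h1 (a) := ConcreteCategory.congr_hom (Proj.awayMap_awayToSection (𝒜 := grading k n)
    (f := X i) hj (x := X i * X j) rfl) a
  have h2 (a) := ConcreteCategory.congr_hom (Proj.awayMap_awayToSection (𝒜 := grading k n)
    (f := X j) hi (x := X i * X j) (mul_comm _ _)) a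
  have h1' (a) : ((PSpace k n).presheaf.map
      (homOfLE (inf_le_left : chart k n i ⊓ chart k n j ≤ chart k n i)).op).hom
        ((Proj.awayToSection (grading k n) (X i)).hom a) =
      ((PSpace k n).presheaf.map (homOfLE hle).op).hom
        ((Proj.awayToSection (grading k n) (X i * X j)).hom
          (HomogeneousLocalization.awayMap (grading k n) hj rfl a)) := by
    refine Eq.trans ?_ (congrArg ((PSpace k n).presheaf.map (homOfLE hle).op).hom (h1 a)).symm
    rw [← CommRingCat.comp_apply, Category.assoc, ← Functor.map_comp]
    rfl
  have h2' (a) : ((PSpace k n).presheaf.map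
      (homOfLE (inf_le_right : chart k n i ⊓ chart k n j ≤ chart k n j)).op).hom
        ((Proj.awayToSection (grading k n) (X j)).hom a) =
      ((PSpace k n).presheaf.map (homOfLE hle).op).hom
        ((Proj.awayToSection (grading k n) (X i * X j)).hom
          (HomogeneousLocalization.awayMap (grading k n) hi (mul_comm (X i) (X j)) a)) := by
    refine Eq.trans ?_ (congrArg ((PSpace k n).presheaf.map (homOfLE hle).op).hom (h2 a)).symm
    rw [← CommRingCat.comp_apply, Category.assoc, ← Functor.map_comp]
    rfl
  rw [ratio, ratio, ratio, dehom, dehom, dehom, h1', h1', h2', ← map_mul, ← map_mul]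
  congr 2
  apply HomogeneousLocalization.val_injective
  rw [HomogeneousLocalization.val_mul, HomogeneousLocalization.awayMap_mk,
    HomogeneousLocalization.awayMap_mk, HomogeneousLocalization.awayMap_mk,
    HomogeneousLocalization.Away.val_mk, HomogeneousLocalization.Away.val_mk,
    HomogeneousLocalization.Away.val_mk,
    Localization.mk_mul, Localization.mk_eq_mk_iff, Localization.r_iff_exists]
  refine ⟨1, ?_⟩
  simp
  ring

/-- F/xᵢᵐ = 0 means that a power of xᵢ kills F, and the polynomial ring is a domain. -/
lemma eq_zero_of_dehom_eq_zero (i : Fin (n + 1)) {m : ℕ} {F : MvPolynomial (Fin (n + 1)) k}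
    (hF : F.IsHomogeneous m) (h : dehom i F hF = 0) : F = 0 := by
  have hi : (X i : MvPolynomial (Fin (n + 1)) k) ∈ grading k n 1 :=
    (mem_homogeneousSubmodule 1 _).2 (isHomogeneous_X k i)
  let E := Proj.basicOpenIsoAway (grading k n) (X i) hi one_pos
  have h1 : awayDehom i F hF = 0 := by
    exact (ConcreteCategory.congr_hom E.hom_inv_id _).symm.trans
      ((congrArg E.inv.hom h).trans (map_zero E.inv.hom))
  have h2 := congrArg HomogeneousLocalization.val h1
  rw [awayDehom, HomogeneousLocalization.Away.val_mk, HomogeneousLocalization.val_zero,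
    Localization.mk_eq_mk', IsLocalization.mk'_eq_zero_iff] at h2
  obtain ⟨⟨_, N, rfl⟩, hN⟩ := h2
  exact (mul_eq_zero.1 hN).resolve_left (pow_ne_zero N (X_ne_zero i))

lemma ratioOn_eq_mul (f : Y ⟶ PSpace k n) (i j l : Fin (n + 1)) {V : Y.Opens}
    (ei : V ≤ piece f i) (ej : V ≤ piece f j) :
    ratioOn f i l ei = ratioOn f i j ei * ratioOn f j l ej := by
  have h := congrArg (f.appLE (chart k n i ⊓ chart k n j) V (le_inf ei ej)).hom
    (awayMap_ratio (k := k) i j l)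
  rw [map_mul] at h
  exact (map_appLE f inf_le_left _ ei _).symm.trans (h.trans
    (congrArg₂ (· * ·) (map_appLE f inf_le_left _ ei _) (map_appLE f inf_le_right _ ej _)))

lemma ratioOn_self (f : Y ⟶ PSpace k n) (i : Fin (n + 1)) {V : Y.Opens} (e : V ≤ piece f i) :
    ratioOn f i i e = 1 := by
  have h := ratioOn_mul_ratioOn f i i e e
  rwa [← ratioOn_eq_mul] at h

lemma res_ratioOn (f : Y ⟶ PSpace k n) (i j : Fin (n + 1)) {V W : Y.Opens} (e : V ≤ piece f i)
    (h : W ≤ V) : Reg.res f h (ratioOn f i j e) = ratioOn f i j (h.trans e) :=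
  appLE_map f h e (h.trans e) _

lemma pull_ratioOn {Z : Scheme.{u}} {f : Y ⟶ PSpace k n} {g : Z ⟶ PSpace k n} (h : Z ⟶ Y)
    (w : h ≫ f = g) (i j : Fin (n + 1)) {U : Y.Opens} {V : Z.Opens} (e : V ≤ h ⁻¹ᵁ U)
    (eU : U ≤ piece f i) (eV : V ≤ piece g i) :
    Reg.pull h w U V e (ratioOn f i j eU) = ratioOn g i j eV := by
  subst w
  exact appLE_appLE h f _ _ _ _

lemma piece_inf_piece (f : Y ⟶ PSpace k n) (i j : Fin (n + 1)) :
    piece f i ⊓ piece f j = Y.basicOpen (show Γ(Y, piece f i) from ratioOn f i j le_rfl) := by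
  have h := congrArg (fun U => f ⁻¹ᵁ U) (chart_inf_chart (k := k) i j)
  refine h.trans ((Scheme.preimage_basicOpen f _).trans ?_)
  rw [Scheme.Hom.app_eq_appLE]
  rfl

end GoppaDuality

namespace GoppaDuality

/-! ### Sections of the 𝒪(d) as families of functions -/

section Sections

variable {k : Type u} [Field k] {n : ℕ} {Y : Scheme.{u}}

lemma res_evalOn (f : Y ⟶ PSpace k n) (i : Fin (n + 1)) {V W : Y.Opens} (e : V ≤ piece f i)
    (h : W ≤ V) (p : MvPolynomial (Fin (n + 1)) k) :
    Reg.res f h (evalOn f i e p) = evalOn f i (h.trans e) p := by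
  rw [evalOn, evalOn, ← AlgHom.comp_apply, comp_aeval]
  simp only [res_ratioOn]

lemma pull_evalOn {Z : Scheme.{u}} {f : Y ⟶ PSpace k n} {g : Z ⟶ PSpace k n} (h : Z ⟶ Y)
    (w : h ≫ f = g) (i : Fin (n + 1)) {U : Y.Opens} {V : Z.Opens} (e : V ≤ h ⁻¹ᵁ U)
    (eU : U ≤ piece f i) (eV : V ≤ piece g i) (p : MvPolynomial (Fin (n + 1)) k) :
    Reg.pull h w U V e (evalOn f i eU p) = evalOn g i eV p := by
  rw [evalOn, evalOn, ← AlgHom.comp_apply, comp_aeval]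
  simp only [pull_ratioOn h w i _ e eU eV]

lemma evalOn_eq_pow_mul (f : Y ⟶ PSpace k n) (i j : Fin (n + 1)) {V : Y.Opens}
    (ei : V ≤ piece f i) (ej : V ≤ piece f j) {m : ℕ} {p : MvPolynomial (Fin (n + 1)) k}
    (hp : p.IsHomogeneous m) :
    evalOn f i ei p = ratioOn f i j ei ^ m * evalOn f j ej p := by
  have h := eval₂_mul_inv (evalOn f j ej).toRingHom (ratioOn f i j ei) hp
  rw [mul_comm]
  refine Eq.trans ?_ h
  change eval₂ (algebraMap k (Reg f V)) (fun l => ratioOn f i l ei) p = _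
  congr 1
  · ext c
    exact ((evalOn f j ej).commutes c).symm
  · funext l
    refine (ratioOn_eq_mul f i j l ei ej).trans ?_
    rw [mul_comm]
    exact congrArg (· * _) (aeval_X (fun j' => ratioOn f j j' ej) l).symm

/-- Polynomials as families of functions on the standard pieces. -/
def evalAll (f : Y ⟶ PSpace k n) :
    MvPolynomial (Fin (n + 1)) k →ₐ[k] (∀ i, Reg f (piece f i)) :=
  AlgHom.pi fun i => evalOn f i le_rfl

/-- The space of sections `H⁰(Y, f^*𝒪(d))` as a space of families of functions. -/
def sectionSpace (f : Y ⟶ PSpace k n) (d : ℤ) : Submodule k (∀ i, Reg f (piece f i)) :=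
  (H0 f d).restrictScalars k

lemma evalAll_apply (f : Y ⟶ PSpace k n) (p : MvPolynomial (Fin (n + 1)) k) (i : Fin (n + 1)) :
    evalAll f p i = evalOn f i le_rfl p := rfl

lemma evalAll_X (f : Y ⟶ PSpace k n) (j i : Fin (n + 1)) :
    evalAll f (X j) i = ratioOn f i j le_rfl :=
  aeval_X _ _

lemma evalAll_X_self (f : Y ⟶ PSpace k n) (i : Fin (n + 1)) : evalAll f (X i) i = 1 := by
  rw [evalAll_X, ratioOn_self]

lemma mem_sectionSpace (f : Y ⟶ PSpace k n) {d : ℤ} {t : ∀ i, Reg f (piece f i)} :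
    t ∈ sectionSpace f d ↔ ∀ i j, Reg.res f (inf_le_left : piece f i ⊓ piece f j ≤ _) (t i) =
    ((transition f i j ^ d : (Reg f (piece f i ⊓ piece f j))ˣ) : Reg f (piece f i ⊓ piece f j)) *
      Reg.res f (inf_le_right : piece f i ⊓ piece f j ≤ _) (t j) := Iff.rfl

lemma evalAll_mem (f : Y ⟶ PSpace k n) {m : ℕ} {p : MvPolynomial (Fin (n + 1)) k}
    (hp : p.IsHomogeneous m) : evalAll f p ∈ sectionSpace f m := by
  rw [mem_sectionSpace]
  intro i j
  rw [evalAll_apply, evalAll_apply, res_evalOn, res_evalOn,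
    evalOn_eq_pow_mul f i j inf_le_left inf_le_right hp, zpow_natCast, Units.val_pow_eq_pow_val]
  rfl

lemma mul_mem_sectionSpace (f : Y ⟶ PSpace k n) {d e : ℤ} {s t : ∀ i, Reg f (piece f i)}
    (hs : s ∈ sectionSpace f d) (ht : t ∈ sectionSpace f e) : s * t ∈ sectionSpace f (d + e) :=
  (H0.mul f rfl ⟨s, hs⟩ ⟨t, ht⟩).2

lemma eq_zero_of_X_mul (f : Y ⟶ PSpace k n) {v : ∀ i, Reg f (piece f i)}
    (h : ∀ j, evalAll f (X j) * v = 0) : v = 0 := by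
  funext i
  have := congrFun (h i) i
  rwa [Pi.mul_apply, evalAll_X_self, one_mul] at this

/-- A section that vanishes on `D₊(xᵢ)` is killed by a power of `xᵢ`. -/
lemma exists_pow_mul_eq_zero (f : Y ⟶ PSpace k n) (hf : ∀ i, IsAffineOpen (piece f i)) {d : ℤ}
    {z : ∀ i, Reg f (piece f i)} (hz : z ∈ sectionSpace f d) (i : Fin (n + 1)) (hi : z i = 0) :
    ∃ N : ℕ, evalAll f (X i) ^ N * z = 0 := by
  have key (l : Fin (n + 1)) : ∃ N : ℕ, ratioOn f l i le_rfl ^ N * z l = 0 := by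
    have h := hz l i
    rw [hi, map_zero, mul_zero] at h
    refine exists_pow_mul_eq_zero_of_res_basicOpen_eq_zero_of_isCompact Y (hf l).isCompact
      (z l) (ratioOn f l i le_rfl) ?_
    have e := piece_inf_piece f l i
    have e' : Y.basicOpen (show Γ(Y, piece f l) from ratioOn f l i le_rfl) ≤
        piece f l ⊓ piece f i := e.ge
    have := congrArg (Reg.res f e') h
    rw [res_res, map_zero] at this
    exact this
  choose N hN using key
  -- The sum of the exponents works on all charts at once.
  refine ⟨∑ l, N l, funext fun l => ?_⟩
  rw [Pi.mul_apply, Pi.pow_apply, evalAll_X,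
    ← Finset.sum_erase_add _ _ (Finset.mem_univ l), pow_add, mul_assoc, hN, mul_zero]
  rfl

variable (f : Y ⟶ PSpace k n) [IsClosedImmersion f]

lemma isAffineOpen_piece (i : Fin (n + 1)) : IsAffineOpen (piece f i) :=
  (isAffineOpen_chart i).preimage f

lemma exists_evalOn (i : Fin (n + 1)) (a : Reg f (piece f i)) :
    ∃ (m : ℕ) (p : MvPolynomial (Fin (n + 1)) k), p.IsHomogeneous m ∧
      evalOn f i le_rfl p = a := by
  obtain ⟨b, hb⟩ := f.app_surjective (chart k n i) (isAffineOpen_chart i) a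
  obtain ⟨m, p, hp, rfl⟩ := exists_dehom i b
  refine ⟨m, p, hp, ?_⟩
  rw [← appLE_dehom f i le_rfl hp, ← hb, Scheme.Hom.app_eq_appLE]

/-- On D₊(xᵢ) the section is given by a form p, since closed immersions are surjective on functions
over affine opens. Once degrees are balanced by powers of xᵢ, the difference vanishes on this chart,
so a further power of xᵢ kills it globally. -/
lemma exists_pow_mul_eq_evalAll {d : ℤ} {v : ∀ i, Reg f (piece f i)} (hv : v ∈ sectionSpace f d)
    (i : Fin (n + 1)) : ∃ (N m : ℕ) (p : MvPolynomial (Fin (n + 1)) k), p.IsHomogeneous m ∧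
      (m : ℤ) = d + N ∧ evalAll f (X i) ^ N * v = evalAll f p := by
  obtain ⟨m, p, hp, hpv⟩ := exists_evalOn f i (v i)
  obtain ⟨a, b, hab⟩ : ∃ a b : ℕ, (m : ℤ) + a = d + b :=
    ⟨(d - m).toNat, (m - d).toNat, by omega⟩
  have hmem : evalAll f (X i ^ a * p) - evalAll f (X i ^ b) * v ∈ sectionSpace f (d + b) := by
    refine sub_mem ?_ ?_
    · have := evalAll_mem f ((isHomogeneous_X_pow i a).mul hp)
      rwa [show ((a + m : ℕ) : ℤ) = d + b by push_cast; omega] at this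
    · rw [add_comm d]
      exact mul_mem_sectionSpace f (evalAll_mem f (isHomogeneous_X_pow i b)) hv
  obtain ⟨N, hN⟩ := exists_pow_mul_eq_zero f (isAffineOpen_piece f) hmem i (by
    simp only [Pi.sub_apply, Pi.mul_apply, map_mul, map_pow, Pi.pow_apply, evalAll_X_self, one_pow,
      one_mul]
    rw [evalAll_apply, hpv, sub_self])
  refine ⟨N + b, N + (a + m), X i ^ N * (X i ^ a * p), (isHomogeneous_X_pow i N).mul
    ((isHomogeneous_X_pow i a).mul hp), by push_cast; omega, ?_⟩
  rw [mul_sub, sub_eq_zero, ← mul_assoc, map_pow, ← pow_add] at hN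
  rw [map_mul, map_pow, ← hN]

end Sections

/-! ### The section family of a closed subscheme of the plane -/

section Plane

variable {k : Type u} [Field k] {Y : Scheme.{u}}

/-- Evaluation of ternary forms. -/
abbrev evalPlane (f : Y ⟶ PSpace k 2) :
    MvPolynomial (Fin 3) k →ₐ[k] (∀ i, Reg f (piece f i)) :=
  evalAll f

lemma isSectionFamily (f : Y ⟶ PSpace k 2) [IsClosedImmersion f] :
    IsSectionFamily (sectionSpace f) (evalPlane f) where
  mul_mem := mul_mem_sectionSpace f
  map_le d := by
    rintro _ ⟨p, hp, rfl⟩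
    rcases lt_or_ge d 0 with hd | hd
    · rw [homogeneousPart_of_neg hd hp, map_zero]
      exact zero_mem _
    · lift d to ℕ using hd
      exact evalAll_mem f (mem_homogeneousPart_natCast.1 hp)
  eq_zero_of_X_mul := eq_zero_of_X_mul f
  exists_pow {d v} hv := by
    have h (i : Fin 3) := exists_pow_mul_eq_evalAll f hv i
    choose N m p hp hm hpv using h
    refine ⟨∑ i, N i, fun i => ?_⟩
    have hN := Finset.sum_erase_add Finset.univ N (Finset.mem_univ i)
    set N' := ∑ j ∈ Finset.univ.erase i, N j
    refine ⟨X i ^ N' * p i, ?_, ?_⟩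
    · have := mem_homogeneousPart_natCast.2 ((isHomogeneous_X_pow (R := k) i N').mul (hp i))
      rw [Nat.cast_add, hm i] at this
      rw [← hN]
      push_cast
      rwa [show d + ((N' : ℤ) + N i) = N' + (d + N i) by ring]
    · rw [← hN, pow_add, mul_assoc]
      refine Eq.trans ?_ (congrArg _ (hpv i)).symm
      exact (map_mul (evalAll f) _ _).trans (congrArg (· * _) (map_pow (evalAll f) _ _))

end Plane

end GoppaDuality

namespace GoppaDuality

/-! ### Sections on the plane itself, and restriction -/

section PlaneSections

variable {k : Type u} [Field k] {Y : Scheme.{u}}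

lemma eq_zero_of_evalPlane_id {d : ℤ} {p : MvPolynomial (Fin 3) k} (hp : p ∈ homogeneousPart k d)
    (h : evalPlane (𝟙 (PSpace k 2)) p = 0) : p = 0 := by
  rcases lt_or_ge d 0 with hd | hd
  · exact homogeneousPart_of_neg hd hp
  lift d to ℕ using hd
  have hp' := mem_homogeneousPart_natCast.1 hp
  refine eq_zero_of_dehom_eq_zero (0 : Fin (2 + 1)) hp' ?_
  have h1 := (appLE_dehom (𝟙 (PSpace k 2)) (0 : Fin (2 + 1)) le_rfl hp').trans (congrFun h 0)
  rw [← Scheme.Hom.app_eq_appLE, Scheme.Hom.id_app] at h1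
  exact h1

/-- The sections of `𝒪(d)` on the projective plane are the forms of degree `d`. -/
lemma sectionSpace_id_eq (d : ℤ) : sectionSpace (𝟙 (PSpace k 2)) d =
    (homogeneousPart k d).map (evalPlane (𝟙 (PSpace k 2))).toLinearMap := by
  have hM := isSectionFamily (𝟙 (PSpace k 2))
  refine le_antisymm (hM.le_map_of_saturated d (fun n _ v _ h => ?_) d le_rfl) (hM.map_le d)
  choose r hr hrv using h
  -- On the plane no nonzero form vanishes, so these are identities of polynomials rather than
  -- congruences, and no obstruction arises.
  have hrel (i j : Fin 3) : X j * r i = X i * r j := by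
    refine sub_eq_zero.1 (eq_zero_of_evalPlane_id (d := n + 1 + 1)
      (sub_mem (X_mul_mem_homogeneousPart rfl _ (hr _)) (X_mul_mem_homogeneousPart rfl _ (hr _))) ?_)
    have h1 : evalPlane (𝟙 (PSpace k 2)) (r i) = _ := hrv i
    have h2 : evalPlane (𝟙 (PSpace k 2)) (r j) = _ := hrv j
    rw [map_sub, map_mul, map_mul, h1, h2]
    ring
  obtain ⟨w, hw⟩ : ∃ w, ∀ i, r i = X i * w := by
    obtain ⟨w, h0, h1, h2⟩ := exists_eq_X_mul (hrel 0 1) (hrel 0 2)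
    refine ⟨w, fun i => ?_⟩
    fin_cases i
    exacts [h0, h1, h2]
  refine ⟨intComponent n w, intComponent_mem _ _, (sub_eq_zero.1
    (hM.eq_zero_of_X_mul fun i => ?_)).symm⟩
  have h1 := congrArg (intComponent (n + 1)) (hw i)
  rw [intComponent_self (hr i), intComponent_mul' (X_mem_homogeneousPart i),
    add_sub_cancel_right] at h1
  rw [mul_sub, sub_eq_zero, ← hrv i, h1]
  exact map_mul (evalPlane (𝟙 (PSpace k 2))) _ _

lemma restr_val (ι : Y ⟶ PSpace k 2) {d : ℤ} (s : H0P k 2 d) {p : MvPolynomial (Fin 3) k}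
    (hp : evalPlane (𝟙 (PSpace k 2)) p = s.1) : (restr ι d s).1 = evalPlane ι p := by
  funext i
  have := congrFun hp i
  refine (congrArg (Reg.pull ι (Category.comp_id ι) _ _ _) this.symm).trans ?_
  exact pull_evalOn ι (Category.comp_id ι) i _ le_rfl le_rfl p

lemma mem_range_restr (ι : Y ⟶ PSpace k 2) {d : ℤ} (t : H0 ι d) :
    t ∈ LinearMap.range (restr ι d) ↔
      t.1 ∈ (homogeneousPart k d).map (evalPlane ι).toLinearMap := by
  constructor
  · rintro ⟨s, rfl⟩
    obtain ⟨p, hp, hps⟩ := (sectionSpace_id_eq d).le (show s.1 ∈ sectionSpace _ d from s.2)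
    exact ⟨p, hp, (restr_val ι s hps).symm⟩
  · rintro ⟨p, hp, hpt⟩
    refine ⟨⟨evalPlane (𝟙 (PSpace k 2)) p, (sectionSpace_id_eq d).ge ⟨p, hp, rfl⟩⟩, ?_⟩
    exact Subtype.ext ((restr_val ι _ rfl).trans hpt)

end PlaneSections

/-! ### An invertible section of degree one -/

section UnitSection

variable {k : Type u} [Field k] {n : ℕ} {Y : Scheme.{u}}

/-- Uniqueness does the gluing: on an overlap both sides are Drazin inverses of the same function,
the transition unit having been inverted. -/
lemma drazinInverse_mem (f : Y ⟶ PSpace k n) {d : ℤ} {x y : ∀ i, Reg f (piece f i)}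
    (hx : x ∈ sectionSpace f d) (h : IsDrazinInverse x y) : y ∈ sectionSpace f (-d) := by
  rw [mem_sectionSpace]
  intro i j
  have hi := (h.map (Pi.evalRingHom _ i)).map
    (Reg.res f inf_le_left : _ →ₐ[k] Reg f (piece f i ⊓ piece f j)).toRingHom
  have hj := (h.map (Pi.evalRingHom _ j)).map
    (Reg.res f inf_le_right : _ →ₐ[k] Reg f (piece f i ⊓ piece f j)).toRingHom
  have hj' := hj.unit_mul (transition f i j ^ d)
  rw [← zpow_neg] at hj'
  have hxij := (mem_sectionSpace f).1 hx i j
  refine IsDrazinInverse.unique hi (?_ : IsDrazinInverse (Reg.res f inf_le_left (x i)) _)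
  rw [hxij]
  exact hj'

/-- The idempotents xⱼ yⱼ jointly cover everything. Use x₀ where it is invertible, x₁ on what is
left, and x₂ on the rest, with the yⱼ patched in the same way. -/
lemma mul_eq_one_of_idempotents {A : Type*} [CommRing A] {x₀ x₁ x₂ y₀ y₁ y₂ : A}
    (h₀ : y₀ * (x₀ * y₀) = y₀) (h₁ : y₁ * (x₁ * y₁) = y₁) (h₂ : y₂ * (x₂ * y₂) = y₂)
    (h : (1 - x₀ * y₀) * (1 - x₁ * y₁) * (1 - x₂ * y₂) = 0) :
    (x₀ * y₀ * x₀ + (1 - x₀ * y₀) * (x₁ * y₁ * x₁) +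
      (1 - x₀ * y₀) * ((1 - x₁ * y₁) * (x₂ * y₂ * x₂))) *
      (y₀ + (1 - x₀ * y₀) * y₁ + (1 - x₀ * y₀) * ((1 - x₁ * y₁) * y₂)) = 1 := by
  have f₀ : (1 - x₀ * y₀) * y₀ = 0 := by linear_combination -h₀
  have f₁ : (1 - x₁ * y₁) * y₁ = 0 := by linear_combination -h₁
  obtain ⟨A, hA⟩ : ∃ A, A = 1 - x₀ * y₀ := ⟨_, rfl⟩
  obtain ⟨B, hB⟩ : ∃ B, B = 1 - x₁ * y₁ := ⟨_, rfl⟩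
  rw [← hA] at f₀ h ⊢
  rw [← hB] at f₁ h ⊢
  have hA2 : A * A = A := by linear_combination A * hA - x₀ * f₀
  have hB2 : B * B = B := by linear_combination B * hB - x₁ * f₁
  have hC2 : x₂ * y₂ * (x₂ * y₂) = x₂ * y₂ := by linear_combination x₂ * h₂
  calc _ = x₀ * (x₀ * y₀ * y₀) + A * A * (x₁ * (y₁ * (x₁ * y₁)))
        + (A * A) * (B * B) * (x₂ * y₂ * (x₂ * y₂)) := by
        linear_combination (x₀ ^ 2 * y₁ + x₀ ^ 2 * B * y₂ + x₁ ^ 2 * y₁ + B * x₂ ^ 2 * y₂) * f₀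
          + (A ^ 2 * x₁ ^ 2 * y₂ + A ^ 2 * x₂ ^ 2 * y₂) * f₁
    _ = 1 := by
        rw [hA2, hB2, hC2, h₁]
        linear_combination -h + x₀ * h₀ + hA + A * hB - A * hB + A * hB

/-- On a finite scheme, `𝒪(1)` has a nowhere vanishing section. -/
lemma exists_unit_of_finite {f : Y ⟶ PSpace k 2} [IsClosedImmersion f]
    (hfin : ∀ i, Module.Finite k (Reg f (piece f i))) :
    ∃ u ∈ sectionSpace f 1, ∃ w ∈ sectionSpace f (-1), u * w = 1 := by
  have hM := isSectionFamily f
  have hD (j : Fin 3) := IsDrazinInverse.exists_of_finite (k := k) (evalPlane f (X j))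
  choose y hy using hD
  set x : Fin 3 → ∀ i, Reg f (piece f i) := fun j => evalPlane f (X j)
  have hx (j) : x j ∈ sectionSpace f 1 := hM.X_mem j
  have hy' (j) : y j ∈ sectionSpace f (-1) := drazinInverse_mem f (hx j) (hy j)
  have h1 : (1 : ∀ i, Reg f (piece f i)) ∈ sectionSpace f 0 := by
    have := evalAll_mem f (isHomogeneous_one (Fin (2 + 1)) k)
    rwa [map_one] at this
  have he (j) : x j * y j ∈ sectionSpace f 0 := hM.mul_mem (hx j) (hy' j)
  have h0 {d : ℤ} {a b} (ha : a ∈ sectionSpace f 0) (hb : b ∈ sectionSpace f d) :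
      a * b ∈ sectionSpace f d := by
    have := hM.mul_mem ha hb
    rwa [zero_add] at this
  have hprod : (1 - x 0 * y 0) * (1 - x 1 * y 1) * (1 - x 2 * y 2) = 0 := by
    -- On D₊(xᵢ) the coordinate xᵢ is the function 1, so its Drazin inverse is 1 as well.
    have key (i : Fin 3) : (1 - x i * y i) i = 0 := by
      have hone : x i i = 1 := evalAll_X_self f i
      obtain ⟨-, N, hN⟩ := (hy i).map (Pi.evalRingHom _ i)
      simp only [Pi.evalRingHom_apply] at hN
      rw [Pi.sub_apply, Pi.one_apply, Pi.mul_apply, hone]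
      change x i i ^ N * (x i i * y i i) = x i i ^ N at hN
      rw [hone, one_pow, one_mul] at hN
      rw [hN, sub_self]
    rw [← Fin.prod_univ_three (fun j => 1 - x j * y j)]
    funext i
    rw [Finset.prod_apply]
    exact Finset.prod_eq_zero (Finset.mem_univ i) (key i)
  refine ⟨x 0 * y 0 * x 0 + (1 - x 0 * y 0) * (x 1 * y 1 * x 1) +
      (1 - x 0 * y 0) * ((1 - x 1 * y 1) * (x 2 * y 2 * x 2)),
    add_mem (add_mem (h0 (he 0) (hx 0)) (h0 (sub_mem h1 (he 0)) (h0 (he 1) (hx 1))))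
      (h0 (sub_mem h1 (he 0)) (h0 (sub_mem h1 (he 1)) (h0 (he 2) (hx 2)))),
    y 0 + (1 - x 0 * y 0) * y 1 + (1 - x 0 * y 0) * ((1 - x 1 * y 1) * y 2),
    add_mem (add_mem (hy' 0) (h0 (sub_mem h1 (he 0)) (hy' 1)))
      (h0 (sub_mem h1 (he 0)) (h0 (sub_mem h1 (he 1)) (hy' 2))), ?_⟩
  have e0 := (hy 0).1
  have e1 := (hy 1).1
  have e2 := (hy 2).1
  change y 0 * (x 0 * y 0) = y 0 at e0
  change y 1 * (x 1 * y 1) = y 1 at e1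
  change y 2 * (x 2 * y 2) = y 2 at e2
  exact mul_eq_one_of_idempotents e0 e1 e2 hprod

end UnitSection

/-! ### Geometric complete intersections as section families -/

section CompleteIntersection

variable {k : Type u} [Field k] {Y : Scheme.{u}} {ι : Y ⟶ PSpace k 2} {d₁ d₂ : ℕ}

/-- If F were zero, G would be a common divisor, hence a unit, contradicting its positive degree. -/
lemma ne_zero_of_isRelPrime {F G : MvPolynomial (Fin 3) k} (hFG : IsRelPrime F G)
    (hG : G.IsHomogeneous d₂) (hd : 0 < d₂) : F ≠ 0 := by
  rintro rfl
  have hu : IsUnit G := hFG (dvd_zero G) dvd_rfl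
  rw [MvPolynomial.isUnit_iff_totalDegree_of_isReduced] at hu
  have h0 : G ≠ 0 := by
    rintro rfl
    simpa using hu.1
  have := hG.totalDegree h0
  omega

variable {F G : MvPolynomial (Fin 3) k} {hF : F.IsHomogeneous d₁}
  {hG : G.IsHomogeneous d₂}

lemma evalOn_eq_zero_iff_mem (i : Fin (2 + 1))
    (hker : RingHom.ker (ι.app (chart k 2 i)).hom = Ideal.span {dehom i F hF, dehom i G hG})
    {m : ℕ} {p : MvPolynomial (Fin (2 + 1)) k} (hp : p.IsHomogeneous m) :
    evalOn ι i le_rfl p = 0 ↔ dehom i p hp ∈ Ideal.span {dehom i F hF, dehom i G hG} := by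
  rw [← hker, RingHom.mem_ker, ← appLE_dehom ι i le_rfl hp, Scheme.Hom.app_eq_appLE]
  rfl

lemma evalOn_eq_zero_of_mem_span (i : Fin (2 + 1))
    (hker : RingHom.ker (ι.app (chart k 2 i)).hom = Ideal.span {dehom i F hF, dehom i G hG})
    {p : MvPolynomial (Fin (2 + 1)) k} (hp : p ∈ Ideal.span {F, G}) :
    evalOn ι i le_rfl p = 0 := by
  obtain ⟨a, b, rfl⟩ := Ideal.mem_span_pair.1 hp
  have h1 := (evalOn_eq_zero_iff_mem i hker hF).2 (Ideal.subset_span (by simp))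
  have h2 := (evalOn_eq_zero_iff_mem i hker hG).2 (Ideal.subset_span (by simp))
  refine (map_add (evalOn ι i le_rfl) _ _).trans ?_
  refine (congrArg₂ (· + ·) (map_mul (evalOn ι i le_rfl) a F)
    (map_mul (evalOn ι i le_rfl) b G)).trans ?_
  rw [h1, h2, mul_zero, mul_zero, add_zero]

lemma evalOn_id_dehom (i : Fin (2 + 1)) {m : ℕ} {p : MvPolynomial (Fin (2 + 1)) k}
    (hp : p.IsHomogeneous m) : evalOn (𝟙 (PSpace k 2)) i le_rfl p = dehom i p hp := by
  rw [← appLE_dehom _ i le_rfl hp, ← Scheme.Hom.app_eq_appLE, Scheme.Hom.id_app]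
  rfl

/-- Clear denominators: a relation p = aF + bG on the chart, with a and b written as forms over
powers of xᵢ, homogenizes to one in the common degree m + α + d₁ + β + d₂. -/
lemma exists_pow_mul_mem_span (i : Fin (2 + 1))
    (hker : RingHom.ker (ι.app (chart k 2 i)).hom = Ideal.span {dehom i F hF, dehom i G hG})
    {m : ℕ} {p : MvPolynomial (Fin (2 + 1)) k} (hp : p.IsHomogeneous m)
    (h : evalOn ι i le_rfl p = 0) : ∃ N : ℕ, X i ^ N * p ∈ Ideal.span {F, G} := by
  rw [evalOn_eq_zero_iff_mem i hker hp, Ideal.mem_span_pair] at h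
  obtain ⟨a, b, hab⟩ := h
  obtain ⟨α, A, hA, rfl⟩ := exists_dehom i a
  obtain ⟨β, B, hB, rfl⟩ := exists_dehom i b
  let e := evalOn (𝟙 (PSpace k 2)) i le_rfl
  have heX (N : ℕ) : e (X i ^ N) = 1 := by
    rw [map_pow]
    exact (congrArg (· ^ N) (evalAll_X_self (𝟙 (PSpace k 2)) i)).trans (one_pow N)
  have hab' : e A * e F + e B * e G = e p := by
    simp only [e]
    rw [evalOn_id_dehom i hA, evalOn_id_dehom i hB, evalOn_id_dehom i hp]
    rw [← hab]
    exact congrArg₂ (fun x y => dehom i A hA * x + dehom i B hB * y) (evalOn_id_dehom i hF)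
      (evalOn_id_dehom i hG)
  have hq : (X i ^ (α + d₁ + β + d₂) * p - X i ^ (m + β + d₂) * (A * F) -
      X i ^ (m + α + d₁) * (B * G) : MvPolynomial (Fin (2 + 1)) k).IsHomogeneous
        (m + α + d₁ + β + d₂) := by
    rw [← mem_homogeneousSubmodule]
    refine sub_mem (sub_mem ?_ ?_) ?_ <;> rw [mem_homogeneousSubmodule]
    · convert (isHomogeneous_X_pow i _).mul hp using 1
      ring
    · convert (isHomogeneous_X_pow i _).mul (hA.mul hF) using 1
      ring
    · convert (isHomogeneous_X_pow i _).mul (hB.mul hG) using 1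
      ring
  have h0 := eq_zero_of_dehom_eq_zero i hq (by
    rw [← evalOn_id_dehom i hq]
    change e _ = 0
    simp only [map_sub, map_mul, heX, one_mul]
    rw [← hab']
    ring)
  refine ⟨α + d₁ + β + d₂, Ideal.mem_span_pair.2 ⟨X i ^ (m + β + d₂) * A,
    X i ^ (m + α + d₁) * B, ?_⟩⟩
  linear_combination -h0

/-- Functions on the piece are values of forms with xᵢ = 1. Multiplication by xᵢ does not change
such values, so the images of forms of growing degree form a chain, and the Hilbert function bounds
it by d₁d₂. -/
lemma finite_reg_piece [IsClosedImmersion ι] (hFG : IsRelPrime F G) (hF0 : F ≠ 0) (i : Fin (2 + 1))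
    (hker : RingHom.ker (ι.app (chart k 2 i)).hom = Ideal.span {dehom i F hF, dehom i G hG}) :
    Module.Finite k (Reg ι (piece ι i)) := by
  let T : MvPolynomial (Fin 3) k →ₗ[k] Reg ι (piece ι i) := (evalOn ι i le_rfl).toLinearMap
  have hX (N : ℕ) (p) : evalOn ι i le_rfl (X i ^ N * p) = evalOn ι i le_rfl p := by
    rw [map_mul, map_pow]
    have : evalOn ι i le_rfl (X i) = 1 := evalAll_X_self ι i
    rw [this, one_pow, one_mul]
  refine finite_of_directed_of_finrank_le
    (fun m : ℕ => (homogeneousPart k (m + d₁ + d₂ : ℕ)).map T) ?_ (fun m => inferInstance) (d₁ * d₂)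
    (finrank_map_homogeneousPart_le T hF hG hFG hF0
      fun p hp => evalOn_eq_zero_of_mem_span i hker hp) ?_
  · refine monotone_nat_of_le_succ fun m => ?_
    rintro _ ⟨p, hp, rfl⟩
    refine ⟨X i * p, X_mul_mem_homogeneousPart (by push_cast; ring) i hp, ?_⟩
    have := hX 1 p
    rw [pow_one] at this
    exact this
  · intro v
    obtain ⟨m, p, hp, rfl⟩ := exists_evalOn ι i v
    refine ⟨m, X i ^ (d₁ + d₂) * p, ?_, hX _ p⟩
    refine mem_homogeneousPart_natCast.2 ?_
    convert (isHomogeneous_X_pow (R := k) i (d₁ + d₂)).mul hp using 1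
    ring

lemma evalPlane_eq_zero_of_mem_span
    (hker : ∀ i, RingHom.ker (ι.app (chart k 2 i)).hom = Ideal.span {dehom i F hF, dehom i G hG})
    {p : MvPolynomial (Fin 3) k} (hp : p ∈ Ideal.span {F, G}) : evalPlane ι p = 0 := by
  funext i
  have h : evalOn ι i le_rfl p = 0 := evalOn_eq_zero_of_mem_span i (hker i) hp
  exact h

lemma exists_pow_mul_mem_span_of_evalPlane_eq_zero
    (hker : ∀ i, RingHom.ker (ι.app (chart k 2 i)).hom = Ideal.span {dehom i F hF, dehom i G hG})
    {n : ℤ} {p : MvPolynomial (Fin 3) k} (hp : p ∈ homogeneousPart k n) (h : evalPlane ι p = 0) :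
    ∃ N : ℕ, ∀ i, X i ^ N * p ∈ Ideal.span {F, G} := by
  rcases lt_or_ge n 0 with hn | hn
  · exact ⟨0, fun i => by rw [homogeneousPart_of_neg hn hp, mul_zero]; exact zero_mem _⟩
  lift n to ℕ using hn
  have key (i : Fin 3) := exists_pow_mul_mem_span i (hker i) (mem_homogeneousPart_natCast.1 hp)
    (congrFun h i)
  choose N hN using key
  refine ⟨∑ i, N i, fun i => ?_⟩
  rw [← Finset.sum_erase_add _ _ (Finset.mem_univ i), pow_add, mul_assoc]
  exact Ideal.mul_mem_left _ _ (hN i)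

lemma isCompleteIntersectionFamily [IsClosedImmersion ι] (hFG : IsRelPrime F G) (hd : 0 < d₂)
    (hker : ∀ i, RingHom.ker (ι.app (chart k 2 i)).hom =
      Ideal.span {dehom i F hF, dehom i G hG}) :
    IsCompleteIntersectionFamily (sectionSpace ι) (evalPlane ι) d₁ d₂ F G where
  toIsSectionFamily := isSectionFamily ι
  isHomogeneous₁ := hF
  isHomogeneous₂ := hG
  ne_zero := ne_zero_of_isRelPrime hFG hG hd
  isRelPrime := hFG
  map_eq_zero := evalPlane_eq_zero_of_mem_span hker
  exists_pow_mul_mem := exists_pow_mul_mem_span_of_evalPlane_eq_zero hker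
  exists_unit := exists_unit_of_finite fun i =>
    finite_reg_piece hFG (ne_zero_of_isRelPrime hFG hG hd) i (hker i)

/-- The sections of the `𝒪(d)` on a plane complete intersection. -/
theorem IsCompleteIntersection.exists_family (hΓ : IsCompleteIntersection ι d₁ d₂) :
    ∃ F G : MvPolynomial (Fin 3) k,
      IsCompleteIntersectionFamily (sectionSpace ι) (evalPlane ι) d₁ d₂ F G := by
  obtain ⟨F, G, hF, hG, hFG, hker⟩ := hΓ.exists_equations
  have := hΓ.isClosedImmersion
  exact ⟨F, G, isCompleteIntersectionFamily hFG hΓ.pos₂ hker⟩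

end CompleteIntersection

end GoppaDuality

namespace GoppaDuality

/-! ### Linear algebra of the Gale sequence -/

section GaleLinearAlgebra

variable {k V V' A B : Type*} [Field k] [AddCommGroup V] [Module k V] [AddCommGroup V']
  [Module k V'] [AddCommGroup A] [Module k A] [AddCommGroup B] [Module k B]

lemma injective_comp_subtype (ρ : V →ₗ[k] A) {W : Submodule k V}
    (h : IsCompl W (LinearMap.ker ρ)) : Function.Injective (ρ.comp W.subtype) := by
  rw [← LinearMap.ker_eq_bot, LinearMap.ker_comp]
  exact Submodule.disjoint_iff_comap_eq_bot.1 h.disjoint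

lemma exists_mem_eq_of_codisjoint (ρ : V →ₗ[k] A) {W : Submodule k V}
    (h : Codisjoint W (LinearMap.ker ρ)) (v : V) : ∃ w ∈ W, ρ w = ρ v := by
  obtain ⟨w, hw, x, hx, rfl⟩ := Submodule.mem_sup.1 (h.eq_top ▸ Submodule.mem_top : v ∈ _ ⊔ _)
  exact ⟨w, hw, by rw [map_add, LinearMap.mem_ker.1 hx, add_zero]⟩

lemma range_comp_subtype (ρ : V →ₗ[k] A) {W : Submodule k V}
    (h : Codisjoint W (LinearMap.ker ρ)) :
    LinearMap.range (ρ.comp W.subtype) = LinearMap.range ρ := by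
  refine le_antisymm (LinearMap.range_comp_le_range _ _) ?_
  rintro _ ⟨v, rfl⟩
  obtain ⟨w, hw, hwv⟩ := exists_mem_eq_of_codisjoint ρ h v
  exact ⟨⟨w, hw⟩, hwv⟩

lemma isCompl_ker_of_range_le (ρ : V →ₗ[k] A) {W : Submodule k V}
    (hi : Function.Injective (ρ.comp W.subtype))
    (hr : LinearMap.range ρ ≤ LinearMap.range (ρ.comp W.subtype)) :
    IsCompl W (LinearMap.ker ρ) := by
  refine ⟨?_, codisjoint_iff_le_sup.2 fun v _ => ?_⟩
  · rw [← LinearMap.ker_eq_bot, LinearMap.ker_comp, ← Submodule.disjoint_iff_comap_eq_bot] at hi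
    exact hi
  · obtain ⟨w, hw⟩ := hr ⟨v, rfl⟩
    refine Submodule.mem_sup.2 ⟨w, w.2, v - w, ?_, by abel⟩
    rw [LinearMap.mem_ker, map_sub, sub_eq_zero]
    exact hw.symm

variable {ρ : V →ₗ[k] A} {ρ' : V' →ₗ[k] B} {S : A →ₗ[k] Module.Dual k B}

/-- Complements of the kernels have the same images as the whole spaces, so exactness in the middle
is precisely the annihilator condition `hS`. -/
lemma exact_of_isCompl (hS : ∀ a, a ∈ LinearMap.range ρ ↔ ∀ v, S a (ρ' v) = 0)
    {W : Submodule k V} {W' : Submodule k V'} (hW : IsCompl W (LinearMap.ker ρ))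
    (hW' : IsCompl W' (LinearMap.ker ρ')) :
    Function.Exact (ρ.comp W.subtype) ((ρ'.comp W'.subtype).dualMap.comp S) := by
  rw [LinearMap.exact_iff, range_comp_subtype ρ hW.codisjoint]
  ext a
  rw [hS a, LinearMap.mem_ker]
  constructor
  · intro h v
    obtain ⟨w, hw, hwv⟩ := exists_mem_eq_of_codisjoint ρ' hW'.codisjoint v
    rw [← hwv]
    exact LinearMap.congr_fun h ⟨w, hw⟩
  · intro h
    ext w
    exact h w

/-- Surjectivity onto the dual of W' is injectivity of restriction on W'. If ρ' had a value outside
ρ'(W'), a separating functional would be S a for some a. Exactness puts a in the range of ρ, and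
`hS` then makes S a vanish on all values of ρ'. -/
lemma isCompl_of_exact (hS : ∀ a, a ∈ LinearMap.range ρ ↔ ∀ v, S a (ρ' v) = 0)
    (hb : Function.Bijective S) {W : Submodule k V} {W' : Submodule k V'}
    (he : Function.Exact (ρ.comp W.subtype) ((ρ'.comp W'.subtype).dualMap.comp S))
    (hs : Function.Surjective ((ρ'.comp W'.subtype).dualMap.comp S)) :
    IsCompl W' (LinearMap.ker ρ') := by
  refine isCompl_ker_of_range_le ρ' ?_ ?_
  · rw [← LinearMap.dualMap_surjective_iff]
    exact Function.Surjective.of_comp hs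
  · intro b hb'
    by_contra hbn
    obtain ⟨f, hf, hf'⟩ := Submodule.exists_dual_map_eq_bot_of_notMem hbn inferInstance
    obtain ⟨a, rfl⟩ := hb.2 f
    have ha : a ∈ LinearMap.range (ρ.comp W.subtype) := (he a).1 (by
      ext w
      exact (Submodule.eq_bot_iff _).1 hf' _ ⟨_, ⟨w, rfl⟩, rfl⟩)
    obtain ⟨v, rfl⟩ := hb'
    exact hf ((hS a).1 (LinearMap.range_comp_le_range _ _ ha) v)

lemma finrank_add_finrank_of_exact [Module.Finite k A] {W : Submodule k V} {W' : Submodule k V'}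
    [Module.Finite k W']
    (hi : Function.Injective (ρ.comp W.subtype))
    (he : Function.Exact (ρ.comp W.subtype) ((ρ'.comp W'.subtype).dualMap.comp S))
    (hs : Function.Surjective ((ρ'.comp W'.subtype).dualMap.comp S)) :
    Module.finrank k W + Module.finrank k W' = Module.finrank k A := by
  rw [← LinearMap.finrank_range_of_inj hi, ← LinearMap.exact_iff.1 he,
    ← Subspace.dual_finrank_eq (V := W'), ← finrank_top k (Module.Dual k W'),
    ← LinearMap.range_eq_top.2 hs, add_comm]
  exact LinearMap.finrank_range_add_finrank_ker _

end GaleLinearAlgebra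

/-! ### Global functions as sections of degree zero -/

section GlobalFunctions

variable {k : Type u} [Field k] {n : ℕ} {Y : Scheme.{u}}

lemma iSup_chart : ⨆ i, chart k n i = ⊤ := by
  refine Proj.iSup_basicOpen_eq_top' (grading k n) (fun i : Fin (n + 1) => X i)
    (fun i => ⟨1, (mem_homogeneousSubmodule 1 _).2 (isHomogeneous_X k i)⟩) ?_
  rw [eq_top_iff]
  rintro p -
  induction p using MvPolynomial.induction_on with
  | C a =>
    exact Subalgebra.algebraMap_mem _
      (⟨C a, (mem_homogeneousSubmodule 0 _).2 (isHomogeneous_C _ a)⟩ : grading k n 0)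
  | add p q hp hq => exact add_mem hp hq
  | mul_X p i hp => exact mul_mem hp (Algebra.subset_adjoin ⟨i, rfl⟩)

lemma iSup_piece (f : Y ⟶ PSpace k n) : ⨆ i, piece f i = ⊤ := by
  rw [← Scheme.Hom.preimage_iSup, iSup_chart]
  rfl

lemma Reg.ext_of_cover (f : Y ⟶ PSpace k n) {U : Y.Opens} {I : Type*} (V : I → Y.Opens)
    (hV : ∀ i, V i ≤ U) (h : U ≤ ⨆ i, V i) {a b : Reg f U}
    (hab : ∀ i, Reg.res f (hV i) a = Reg.res f (hV i) b) : a = b :=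
  Y.sheaf.eq_of_locally_eq' V U (fun i => homOfLE (hV i)) h a b hab

lemma exists_smul_one_eq (f : Y ⟶ PSpace k n) {t : ∀ i, Reg f (piece f i)}
    (ht : t ∈ sectionSpace f 0) : ∃ a : Reg f ⊤, a • (1 : ∀ i, Reg f (piece f i)) = t := by
  obtain ⟨a, ha, -⟩ := Y.sheaf.existsUnique_gluing' (piece f) ⊤ (fun i => homOfLE le_top)
    (iSup_piece f).ge t (fun i j => by
      have := ht i j
      rw [zpow_zero, Units.val_one, one_mul] at this
      exact this)
  exact ⟨a, funext fun i => (mul_one (Reg.res f le_top a)).trans (ha i)⟩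

lemma one_mem_sectionSpace (f : Y ⟶ PSpace k n) :
    (1 : ∀ i, Reg f (piece f i)) ∈ sectionSpace f 0 := by
  have := evalAll_mem f (isHomogeneous_one (Fin (n + 1)) k)
  rwa [map_one] at this

/-- Global functions are the sections of `𝒪(0)`. -/
def globalEquiv (f : Y ⟶ PSpace k n) : Reg f ⊤ ≃ₗ[k] sectionSpace f 0 :=
  LinearEquiv.ofBijective
    { toFun := fun a => ⟨a • 1, (H0 f 0).smul_mem a (one_mem_sectionSpace f)⟩
      map_add' := fun a b => Subtype.ext (add_smul a b _)
      map_smul' := fun c a => Subtype.ext (smul_assoc c a _) } <| by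
    constructor
    · intro a b hab
      refine Reg.ext_of_cover f (piece f) (fun _ => le_top) (iSup_piece f).ge fun i => ?_
      have := congrFun (congrArg Subtype.val hab) i
      exact (mul_one (Reg.res f _ a)).symm.trans (this.trans (mul_one (Reg.res f _ b)))
    · rintro ⟨t, ht⟩
      obtain ⟨a, ha⟩ := exists_smul_one_eq f ht
      exact ⟨a, Subtype.ext ha⟩

lemma smul_eq_mul_of_smul_one (f : Y ⟶ PSpace k n) (a : Reg f ⊤) (t : ∀ i, Reg f (piece f i)) :
    a • t = t * a • (1 : ∀ i, Reg f (piece f i)) := by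
  rw [mul_smul_comm, mul_one]

end GlobalFunctions

/-! ### The canonical module and Serre duality -/

section Duality

variable {k : Type u} [Field k] {Γ : Scheme.{u}} {ι : Γ ⟶ PSpace k 2} {d₁ d₂ : ℕ}
  {F G : MvPolynomial (Fin 3) k}

/-- The map `t ↦ (a ↦ l (a t))` into the canonical module. -/
def functionalMap (l : (∀ i, Reg ι (piece ι i)) →ₗ[k] k) (m : ℤ) :
    H0 ι m →ₗ[Reg ι ⊤] CanonicalModule ι where
  toFun t := (show Module.Dual k (Reg ι ⊤) from
    { toFun := fun a => l (a • t.1)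
      map_add' := fun a b => by rw [add_smul, map_add]
      map_smul' := fun c a => by rw [smul_assoc, map_smul, RingHom.id_apply] })
  map_add' s t := LinearMap.ext fun a =>
    (congrArg l (smul_add a s.1 t.1)).trans (map_add l _ _)
  map_smul' b t := LinearMap.ext fun a => congrArg l
    ((smul_smul a b t.1).trans (congrArg (· • t.1) (mul_comm a b)))

variable {l : (∀ i, Reg ι (piece ι i)) →ₗ[k] k}

lemma IsCompleteIntersectionFamily.finite_reg
    (hM : IsCompleteIntersectionFamily (sectionSpace ι) (evalPlane ι) d₁ d₂ F G) :
    Module.Finite k (Reg ι ⊤) := by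
  have := hM.finite 0
  exact Module.Finite.equiv (globalEquiv ι).symm

lemma IsCompleteIntersectionFamily.finrank_H0
    (hM : IsCompleteIntersectionFamily (sectionSpace ι) (evalPlane ι) d₁ d₂ F G) (d : ℤ) :
    Module.finrank k (H0 ι d) = Module.finrank k (Reg ι ⊤) :=
  (hM.finrank_eq d 0).trans (globalEquiv ι).finrank_eq.symm

lemma IsCompleteIntersectionFamily.finite_H0
    (hM : IsCompleteIntersectionFamily (sectionSpace ι) (evalPlane ι) d₁ d₂ F G) (d : ℤ) :
    Module.Finite k (H0 ι d) :=
  hM.finite d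

/-- The case e = 0 of nondegeneracy gives injectivity, and both sides have the dimension of the ring
of global functions. -/
lemma bijective_functionalMap
    (hM : IsCompleteIntersectionFamily (sectionSpace ι) (evalPlane ι) d₁ d₂ F G)
    (hl : ∀ v ∈ sectionSpace ι ((d₁ : ℤ) + d₂ - 3), l v = 0 →
      v ∈ (homogeneousPart k ((d₁ : ℤ) + d₂ - 3)).map (evalPlane ι).toLinearMap) :
    Function.Bijective (functionalMap l ((d₁ : ℤ) + d₂ - 3)) := by
  have hi : Function.Injective (functionalMap l ((d₁ : ℤ) + d₂ - 3)) := by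
    rw [injective_iff_map_eq_zero]
    intro s hs
    refine Subtype.ext (hM.eq_zero_of_forall_mul hl (add_zero _) s.2 fun t ht => ?_)
    obtain ⟨a, rfl⟩ := exists_smul_one_eq ι ht
    rw [← smul_eq_mul_of_smul_one]
    exact LinearMap.congr_fun (f := (show Module.Dual k (Reg ι ⊤) from functionalMap l _ s)) hs a
  refine ⟨hi, ?_⟩
  have := hM.finite_reg
  have := hM.finite_H0 ((d₁ : ℤ) + d₂ - 3)
  have hdim : Module.finrank k (H0 ι ((d₁ : ℤ) + d₂ - 3)) =
      Module.finrank k (Module.Dual k (Reg ι ⊤)) := by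
    rw [Subspace.dual_finrank_eq, hM.finrank_H0]
  let T : H0 ι ((d₁ : ℤ) + d₂ - 3) →ₗ[k] Module.Dual k (Reg ι ⊤) :=
    (functionalMap l ((d₁ : ℤ) + d₂ - 3)).restrictScalars k
  exact (LinearMap.injective_iff_surjective_of_finrank_eq_finrank (f := T) hdim).1 hi

variable {φ : H0 ι ((d₁ : ℤ) + d₂ - 3) ≃ₗ[Reg ι ⊤] CanonicalModule ι}

lemma serreMap_apply (hφ : ∀ t, CanonicalModule.trace ι (φ t) = l t.1) {d e : ℤ}
    (h : d + e = (d₁ : ℤ) + d₂ - 3) (s : H0 ι d) (t : H0 ι e) :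
    serreMap ι h φ s t = l (s.1 * t.1) :=
  hφ (H0.mul ι h s t)

lemma bijective_serreMap
    (hM : IsCompleteIntersectionFamily (sectionSpace ι) (evalPlane ι) d₁ d₂ F G)
    (hl : ∀ v ∈ sectionSpace ι ((d₁ : ℤ) + d₂ - 3), l v = 0 →
      v ∈ (homogeneousPart k ((d₁ : ℤ) + d₂ - 3)).map (evalPlane ι).toLinearMap)
    (hφ : ∀ t, CanonicalModule.trace ι (φ t) = l t.1) {d e : ℤ}
    (h : d + e = (d₁ : ℤ) + d₂ - 3) : Function.Bijective (serreMap ι h φ) := by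
  have hi : Function.Injective (serreMap ι h φ) := by
    rw [injective_iff_map_eq_zero]
    intro s hs
    refine Subtype.ext (hM.eq_zero_of_forall_mul hl h s.2 fun t ht => ?_)
    exact (serreMap_apply hφ h s ⟨t, ht⟩).symm.trans (LinearMap.congr_fun hs _)
  refine ⟨hi, ?_⟩
  have := hM.finite_H0 d
  have := hM.finite_H0 e
  exact (LinearMap.injective_iff_surjective_of_finrank_eq_finrank (by
    rw [Subspace.dual_finrank_eq, hM.finrank_H0, hM.finrank_H0])).1 hi

/-- Products of forms are forms, which l kills. The converse is `mem_map_of_forall_mul`. -/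
lemma mem_range_restr_iff_serreMap
    (hM : IsCompleteIntersectionFamily (sectionSpace ι) (evalPlane ι) d₁ d₂ F G)
    (hl₀ : ∀ v ∈ (homogeneousPart k ((d₁ : ℤ) + d₂ - 3)).map (evalPlane ι).toLinearMap, l v = 0)
    (hl : ∀ v ∈ sectionSpace ι ((d₁ : ℤ) + d₂ - 3), l v = 0 →
      v ∈ (homogeneousPart k ((d₁ : ℤ) + d₂ - 3)).map (evalPlane ι).toLinearMap)
    (hφ : ∀ t, CanonicalModule.trace ι (φ t) = l t.1) {d e : ℤ}
    (h : d + e = (d₁ : ℤ) + d₂ - 3) (s : H0 ι d) :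
    s ∈ LinearMap.range (restr ι d) ↔ ∀ v, serreMap ι h φ s (restr ι e v) = 0 := by
  rw [mem_range_restr]
  constructor
  · rintro ⟨p, hp, hps⟩ v
    rw [serreMap_apply hφ, ← hps]
    exact hl₀ _ (IsSectionFamily.map_mul_mem h hp ((mem_range_restr ι _).1 ⟨v, rfl⟩))
  · intro hs
    refine hM.mem_map_of_forall_mul hl h s.2 fun t ht => ?_
    obtain ⟨v, hv⟩ := (mem_range_restr ι ⟨t, hM.map_le e ht⟩).2 ht
    rw [← hs v, serreMap_apply hφ, hv]

/-- The part of Gale duality for plane complete intersections concerned with linear series. -/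
theorem IsCompleteIntersection.exists_duality (hΓ : IsCompleteIntersection ι d₁ d₂) :
    Module.Finite k (Reg ι ⊤) ∧
    ∃ φ : H0 ι ((d₁ : ℤ) + d₂ - 3) ≃ₗ[Reg ι ⊤] CanonicalModule ι,
      (∀ s : H0P k 2 ((d₁ : ℤ) + d₂ - 3), CanonicalModule.trace ι (φ (restr ι _ s)) = 0) ∧
      ∀ (d e : ℤ) (h : d + e = (d₁ : ℤ) + d₂ - 3) (W : Submodule k (H0P k 2 d)),
        IsCompl W (LinearMap.ker (restr ι d)) →
        (∃ W' : Submodule k (H0P k 2 e), IsGaleSequence ι h φ W W') ∧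
        ∀ W' : Submodule k (H0P k 2 e), IsGaleSequence ι h φ W W' →
          IsCompl W' (LinearMap.ker (restr ι e)) ∧
          Module.finrank k W + Module.finrank k W' = Module.finrank k (Reg ι ⊤) := by
  obtain ⟨F, G, hM⟩ := hΓ.exists_family
  obtain ⟨l, hl₀, hl⟩ := hM.exists_functional
  let φ := LinearEquiv.ofBijective _ (bijective_functionalMap hM hl)
  have hφ (t) : CanonicalModule.trace ι (φ t) = l t.1 := congrArg l (one_smul (Reg ι ⊤) t.1)
  refine ⟨hM.finite_reg, φ, fun s => ?_, fun d e h W hW => ⟨?_, fun W' hW' => ?_⟩⟩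
  · rw [hφ]
    exact hl₀ _ ((mem_range_restr ι _).1 ⟨s, rfl⟩)
  · obtain ⟨W', hW'⟩ := Submodule.exists_isCompl (LinearMap.ker (restr ι e))
    have hb := bijective_serreMap hM hl hφ h
    refine ⟨W', injective_comp_subtype _ hW, hb,
      exact_of_isCompl (mem_range_restr_iff_serreMap hM hl₀ hl hφ h) hW hW'.symm,
      (LinearMap.dualMap_surjective_of_injective (injective_comp_subtype _ hW'.symm)).comp hb.2⟩
  · have hc := isCompl_of_exact (mem_range_restr_iff_serreMap hM hl₀ hl hφ h) hW'.bijective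
      hW'.exact hW'.surjective
    refine ⟨hc, ?_⟩
    have := hM.finite_H0 d
    have := hM.finite_H0 e
    have : Module.Finite k W' :=
      Module.Finite.of_injective _ (injective_comp_subtype _ hc)
    rw [← hM.finrank_H0 d]
    exact finrank_add_finrank_of_exact hW'.injective hW'.exact hW'.surjective

end Duality

end GoppaDuality

namespace GoppaDuality

/-! ### Nonvanishing loci of sections -/

section Nonvanishing

variable {k : Type u} [Field k] {n : ℕ} {Y Z : Scheme.{u}}

lemma basicOpen_isUnit_mul {U : Y.Opens} {u : Γ(Y, U)} (hu : IsUnit u) (a : Γ(Y, U)) :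
    Y.basicOpen (u * a) = Y.basicOpen a := by
  rw [Scheme.basicOpen_mul, Scheme.basicOpen_of_isUnit _ hu, inf_eq_right]
  exact Y.basicOpen_le a

/-- The local expressions of a section on two charts differ by a unit on the overlap, so any one
chart sees the whole locus inside it. -/
lemma nonvanishing_inf_piece (f : Y ⟶ PSpace k n) {d : ℤ} (s : H0 f d) (l : Fin (n + 1)) :
    nonvanishing f s ⊓ piece f l = Y.basicOpen (show Γ(Y, piece f l) from s.1 l) := by
  have key (i) : Y.basicOpen (show Γ(Y, piece f i) from s.1 i) ⊓ piece f l =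
      piece f i ⊓ Y.basicOpen (show Γ(Y, piece f l) from s.1 l) := by
    have h1 := Y.basicOpen_res (show Γ(Y, piece f i) from s.1 i)
      (homOfLE (inf_le_left : piece f i ⊓ piece f l ≤ _)).op
    have h2 := Y.basicOpen_res (show Γ(Y, piece f l) from s.1 l)
      (homOfLE (inf_le_right : piece f i ⊓ piece f l ≤ _)).op
    have h3 := basicOpen_isUnit_mul (Y := Y) (transition f i l ^ d).isUnit
      (Reg.res f inf_le_right (s.1 l))
    have h4 := congrArg (fun a : Γ(Y, piece f i ⊓ piece f l) => Y.basicOpen a) (s.2 i l)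
    have h5 := (h1.symm.trans h4).trans (h3.trans h2)
    have l1 := Y.basicOpen_le (show Γ(Y, piece f i) from s.1 i)
    have l2 := Y.basicOpen_le (show Γ(Y, piece f l) from s.1 l)
    calc _ = piece f i ⊓ piece f l ⊓ Y.basicOpen (show Γ(Y, piece f i) from s.1 i) := by
          rw [inf_right_comm, inf_eq_right.2 l1]
      _ = _ := h5
      _ = _ := by rw [inf_assoc, inf_eq_right.2 l2]
  rw [nonvanishing, iSup_inf_eq]
  simp only [key]
  rw [← iSup_inf_eq, iSup_piece, top_inf_eq]

lemma nonvanishing_pull {f : Y ⟶ PSpace k n} {g : Z ⟶ PSpace k n} (h : Z ⟶ Y) (w : h ≫ f = g)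
    {d : ℤ} (s : H0 f d) : nonvanishing g (H0.pull h w d s) = h ⁻¹ᵁ nonvanishing f s := by
  rw [nonvanishing, nonvanishing, Scheme.Hom.preimage_iSup]
  refine iSup_congr fun i => ?_
  refine (Scheme.basicOpen_appLE h (piece g i) (piece f i) (piece_le h w i) (s.1 i)).trans ?_
  rw [inf_eq_right]
  subst w
  exact fun x hx => Y.basicOpen_le (show Γ(Y, piece f i) from s.1 i) hx

lemma isUnit_res_nonvanishing (f : Y ⟶ PSpace k n) {d : ℤ} (s : H0 f d) (l : Fin (n + 1))
    {V : Y.Opens} (h : V ≤ nonvanishing f s) (hl : V ≤ piece f l) :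
    IsUnit (Reg.res f hl (s.1 l)) := by
  have hV : V ≤ Y.basicOpen (show Γ(Y, piece f l) from s.1 l) :=
    (le_inf h hl).trans (nonvanishing_inf_piece f s l).le
  have h1 : IsUnit ((Y.presheaf.map (homOfLE (Y.basicOpen_le _)).op).hom
    (show Γ(Y, piece f l) from s.1 l)) := RingedSpace.isUnit_res_basicOpen Y.toRingedSpace _
  have h2 := h1.map (Y.presheaf.map (homOfLE hV).op).hom
  rw [map_map] at h2
  exact h2

/-- The sections that vanish outside a given open set. -/
def sectionsVanishingOutside (f : Y ⟶ PSpace k n) (d : ℤ) (U : Y.Opens) :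
    Submodule k (H0 f d) where
  carrier := {s | nonvanishing f s ≤ U}
  add_mem' {s t} hs ht := by
    change nonvanishing f (s + t) ≤ U
    refine iSup_le fun i x hx => ?_
    have hxi : x ∈ piece f i := Y.basicOpen_le _ hx
    rw [Y.mem_basicOpen _ x hxi] at hx
    have h : Y.presheaf.germ (piece f i) x hxi (show Γ(Y, piece f i) from (s + t).1 i) =
      Y.presheaf.germ (piece f i) x hxi (show Γ(Y, piece f i) from s.1 i) +
      Y.presheaf.germ (piece f i) x hxi (show Γ(Y, piece f i) from t.1 i) := map_add _ _ _
    rw [h] at hx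
    -- Stalks are local: where a sum does not vanish, one of the summands does not.
    rcases IsLocalRing.isUnit_or_isUnit_of_isUnit_add hx with h | h
    · exact hs (le_iSup (fun i => Y.basicOpen (show Γ(Y, piece f i) from s.1 i)) i
        ((Y.mem_basicOpen _ x hxi).2 h))
    · exact ht (le_iSup (fun i => Y.basicOpen (show Γ(Y, piece f i) from t.1 i)) i
        ((Y.mem_basicOpen _ x hxi).2 h))
  zero_mem' := by
    change nonvanishing f (0 : H0 f d) ≤ U
    refine iSup_le fun i => ?_
    exact (Y.basicOpen_zero (piece f i)).le.trans bot_le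
  smul_mem' c s hs := by
    change nonvanishing f (c • s) ≤ U
    refine iSup_le fun i => ?_
    refine le_trans ?_ ((le_iSup (fun i => Y.basicOpen (show Γ(Y, piece f i) from s.1 i)) i).trans
      hs)
    have h : (c • s).1 i = algebraMap k (Reg f (piece f i)) c * s.1 i :=
      (show (c • s).1 i = c • s.1 i from rfl).trans (Algebra.smul_def c (s.1 i))
    rw [h]
    exact (Y.basicOpen_mul (show Γ(Y, piece f i) from algebraMap k (Reg f (piece f i)) c)
      (s.1 i)).le.trans inf_le_right

end Nonvanishing

end GoppaDuality

namespace GoppaDuality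

/-! ### Morphisms to projective space through charts -/

section MorphismsToProjectiveSpace

variable {k : Type u} [Field k] {n r : ℕ} {Y Z : Scheme.{u}}

/-- Functions on a chart are polynomials in the ratios over k. Agreement over the base takes care of
the coefficients. -/
lemma appLE_eq_of_ratioOn_eq {g g' : Y ⟶ PSpace k r}
    (hk : g ≫ toSpecField k r = g' ≫ toSpecField k r) (i : Fin (r + 1)) {V : Y.Opens}
    (e : V ≤ piece g i) (e' : V ≤ piece g' i)
    (h : ∀ j, (show Γ(Y, V) from ratioOn g i j e) = (show Γ(Y, V) from ratioOn g' i j e')) :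
    g.appLE (chart k r i) V e = g'.appLE (chart k r i) V e' := by
  ext a
  obtain ⟨m, p, hp, rfl⟩ := exists_dehom i a
  refine (appLE_dehom g i e hp).trans (Eq.trans ?_ (appLE_dehom g' i e' hp).symm)
  have hc : (constants g V : k →+* Γ(Y, V)) = constants g' V := by
    unfold constants
    rw [hk]
  change eval₂ (constants g V : k →+* Γ(Y, V)) _ p = eval₂ (constants g' V : k →+* Γ(Y, V)) _ p
  rw [hc]
  exact congrArg (fun x => eval₂ (constants g' V : k →+* Γ(Y, V)) x p) (funext h)

/-- A morphism of `k`-schemes to projective space is determined by the pullbacks of the ratios of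
coordinates. -/
lemma hom_ext_of_ratioOn_eq {g g' : Y ⟶ PSpace k r}
    (hk : g ≫ toSpecField k r = g' ≫ toSpecField k r)
    (hp : ∀ i, piece g i = piece g' i)
    (h : ∀ i j, (show Γ(Y, piece g i) from ratioOn g i j le_rfl) =
      (show Γ(Y, piece g i) from ratioOn g' i j (hp i).le)) : g = g' := by
  refine (Y.openCoverOfIsOpenCover (piece g) (iSup_piece g)).hom_ext _ _ fun i => ?_
  change (piece g i).ι ≫ g = (piece g i).ι ≫ g'
  rw [← Scheme.Hom.resLE_comp_ι g (le_refl (piece g i)), ← Scheme.Hom.resLE_comp_ι g' (hp i).le]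
  congr 1
  have : IsIso (chart k r i).toSpecΓ := by
    rw [← (isAffineOpen_chart i).isoSpec_hom]
    infer_instance
  rw [← cancel_mono (chart k r i).toSpecΓ, ← Scheme.Opens.toSpecΓ_SpecMap_appLE,
    ← Scheme.Opens.toSpecΓ_SpecMap_appLE, appLE_eq_of_ratioOn_eq hk i le_rfl (hp i).le (h i)]

lemma toSpecΓ_comp_injective {R : CommRingCat.{u}} {a b : R ⟶ Γ(Y, ⊤)}
    (h : Y.toSpecΓ ≫ Spec.map a = Y.toSpecΓ ≫ Spec.map b) : a = b := by
  have := congrArg (fun x => (Scheme.ΓSpecIso R).inv ≫ x.appTop) h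
  simpa using this

lemma exists_awayHom {B : Type u} [CommRing B] (ψ : MvPolynomial (Fin (r + 1)) k →+* B)
    (i : Fin (r + 1)) (hψ : ψ (X i) = 1) :
    ∃ ψ' : HomogeneousLocalization.Away (grading k r) (X i) →+* B,
      ∀ (m : ℕ) (p : MvPolynomial (Fin (r + 1)) k) (hp : p.IsHomogeneous m),
        ψ' (awayDehom i p hp) = ψ p := by
  have h1 : ψ (X i) * 1 = 1 := by rw [mul_one, hψ]
  refine ⟨(Localization.awayLift ψ (X i) (isUnit_iff_exists_inv.mpr ⟨1, h1⟩)).comp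
    (algebraMap _ (Localization.Away (X i : MvPolynomial (Fin (r + 1)) k))), fun m p hp => ?_⟩
  have h2 : algebraMap (HomogeneousLocalization.Away (grading k r) (X i))
      (Localization.Away (X i : MvPolynomial (Fin (r + 1)) k)) (awayDehom i p hp) =
      Localization.mk p (⟨X i ^ m, m, rfl⟩ :
        Submonoid.powers (X i : MvPolynomial (Fin (r + 1)) k)) := by
    rw [HomogeneousLocalization.algebraMap_apply, awayDehom, HomogeneousLocalization.Away.val_mk]
  rw [RingHom.comp_apply, h2, Localization.awayLift_mk ψ (X i) p 1 h1 m, one_pow, mul_one]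

/-- The functions on `D₊(xᵢ)` as elements of a localization. -/
def chartSection (k : Type u) [Field k] {r : ℕ} (i : Fin (r + 1)) :
    CommRingCat.of (HomogeneousLocalization.Away (grading k r) (X i)) ⟶
      Γ(PSpace k r, chart k r i) :=
  Proj.awayToSection (grading k r) (X i)

lemma exists_hom_chart {i : Fin (r + 1)}
    (ψ : CommRingCat.of (HomogeneousLocalization.Away (grading k r) (X i)) ⟶ Γ(Y, ⊤)) :
    ∃ g : Y ⟶ chart k r i, g ≫ (chart k r i).toSpecΓ ≫ Spec.map (chartSection k i) =
      Y.toSpecΓ ≫ Spec.map ψ := by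
  let E := Proj.basicOpenIsoSpec (grading k r) (X i)
    ((mem_homogeneousSubmodule 1 _).2 (isHomogeneous_X k i)) one_pos
  have hE : E.hom = (chart k r i).toSpecΓ ≫ Spec.map (chartSection k i) :=
    Proj.basicOpenIsoSpec_hom _ _ _ _
  refine ⟨Y.toSpecΓ ≫ Spec.map ψ ≫ E.inv, ?_⟩
  rw [← hE]
  exact (Category.assoc _ _ _).trans (congrArg (Y.toSpecΓ ≫ ·)
    ((Category.assoc _ _ _).trans ((congrArg (Spec.map ψ ≫ ·) E.inv_hom_id).trans
      (Category.comp_id _))))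

lemma comp_toSpecField (f : Y ⟶ PSpace k n) : f ≫ toSpecField k n =
    Y.toSpecΓ ≫ Spec.map (CommRingCat.ofHom (constants f ⊤ : k →+* Γ(Y, ⊤))) := by
  have h1 := Scheme.toSpecΓ_naturality (f ≫ toSpecField k n)
  have h2 : CommRingCat.ofHom (constants f ⊤ : k →+* Γ(Y, ⊤)) =
      (Scheme.ΓSpecIso (CommRingCat.of k)).inv ≫ (f ≫ toSpecField k n).appTop := by
    ext c
    change ((f ≫ toSpecField k n).appLE ⊤ ⊤ le_top).hom _ = _
    rw [show (f ≫ toSpecField k n).appLE ⊤ ⊤ le_top = (f ≫ toSpecField k n).appTop from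
      (Scheme.Hom.app_eq_appLE _).symm]
    rfl
  refine Eq.trans ?_ (congrArg (fun a => Y.toSpecΓ ≫ Spec.map a) h2.symm)
  rw [Spec.map_comp, ← reassoc_of% h1, toSpecΓ_SpecMap_ΓSpecIso_inv]
  exact (Category.comp_id _).symm

/-- A morphism to projective space whose image lies in a standard chart. -/
lemma exists_hom_to_chart (f : Y ⟶ PSpace k n) (i : Fin (r + 1)) (b : Fin (r + 1) → Reg f ⊤)
    (hb : b i = 1) :
    ∃ (g : Y ⟶ PSpace k r) (e : ⊤ ≤ piece g i), g ≫ toSpecField k r = f ≫ toSpecField k n ∧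
      ∀ j, (show Γ(Y, ⊤) from ratioOn g i j e) = b j := by
  let ψ : MvPolynomial (Fin (r + 1)) k →+* Γ(Y, ⊤) := (aeval (R := k) (S₁ := Reg f ⊤) b).toRingHom
  have hψX (j) : ψ (X j) = b j := aeval_X b j
  have hψC (c) : ψ (C c) = constants f ⊤ c := aeval_C b c
  obtain ⟨ψ', hψ'⟩ := exists_awayHom ψ i ((hψX i).trans hb)
  obtain ⟨g₀, hg₀⟩ := exists_hom_chart (CommRingCat.ofHom ψ')
  have e : ⊤ ≤ (g₀ ≫ (chart k r i).ι) ⁻¹ᵁ chart k r i := by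
    intro x _
    exact (g₀ x).2
  refine ⟨g₀ ≫ (chart k r i).ι, e, ?_, fun j => ?_⟩
  · have h1 : (chart k r i).ι ≫ toSpecField k r = (chart k r i).toSpecΓ ≫
        Spec.map (chartSection k i) ≫ Spec.map (CommRingCat.ofHom (awayConstants k r (X i))) :=
      (chart_ι_toSpecField i).trans (congrArg _ (Spec.map_comp _ _))
    rw [Category.assoc, h1, reassoc_of% hg₀, ← Spec.map_comp, comp_toSpecField]
    congr 2
    ext c
    have h2 := hψ' 0 (C c) (isHomogeneous_C _ c)
    rw [awayDehom_eq_eval₂, eval₂_C, hψC] at h2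
    exact h2
  · have h1 : chartSection k i ≫ (g₀ ≫ (chart k r i).ι).appLE (chart k r i) ⊤ e =
        CommRingCat.ofHom ψ' := by
      have : IsIso (⊤ : Y.Opens).ι := by
        rw [← Scheme.topIso_hom]
        infer_instance
      apply toSpecΓ_comp_injective
      rw [← cancel_epi (⊤ : Y.Opens).ι, ← hg₀, Spec.map_comp, ← Category.assoc,
        ← Scheme.Opens.toSpecΓ_top, Scheme.Opens.toSpecΓ_SpecMap_appLE_assoc,
        ← Category.assoc (⊤ : Y.Opens).ι]
      congr 1
      rw [← cancel_mono (chart k r i).ι, Scheme.Hom.resLE_comp_ι, Category.assoc]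
    have h2 := ConcreteCategory.congr_hom h1 (awayDehom i (X j) (isHomogeneous_X k j))
    exact h2.trans ((hψ' 1 (X j) (isHomogeneous_X k j)).trans (hψX j))

end MorphismsToProjectiveSpace

end GoppaDuality

namespace GoppaDuality

/-! ### Morphisms given by sections of a line bundle -/

section InducedMorphisms

variable {k : Type u} [Field k] {n r : ℕ} {Y Z : Scheme.{u}} {f : Y ⟶ PSpace k n} {d : ℤ}
  {s : Fin (r + 1) → H0 f d}

lemma H0.pull_pull {X₀ : Scheme.{u}} {f : Y ⟶ PSpace k n} {g : Z ⟶ PSpace k n}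
    {g' : X₀ ⟶ PSpace k n} (h : Z ⟶ Y) (w : h ≫ f = g) (h' : X₀ ⟶ Z) (w' : h' ≫ g = g')
    (w'' : (h' ≫ h) ≫ f = g') (s : H0 f d) :
    H0.pull h' w' d (H0.pull h w d s) = H0.pull (h' ≫ h) w'' d s := by
  refine Subtype.ext (funext fun i => ?_)
  exact appLE_appLE h' h (piece_le h w i) (piece_le h' w' i) (piece_le (h' ≫ h) w'' i) (s.1 i)

lemma H0.pull_congr {g : Z ⟶ PSpace k n} {h h' : Z ⟶ Y} (hh : h = h') (w : h ≫ f = g)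
    (w' : h' ≫ f = g) : H0.pull h w d = H0.pull h' w' d := by
  subst hh
  rfl

lemma IsInducedBy.comp {g : Y ⟶ PSpace k r} (hg : IsInducedBy g f s) (h : Z ⟶ Y)
    {f' : Z ⟶ PSpace k n} (w : h ≫ f = f') :
    IsInducedBy (h ≫ g) f' (fun i => H0.pull h w d (s i)) where
  over_base := by
    rw [← w, Category.assoc, Category.assoc, hg.over_base]
  preimage i := by
    rw [nonvanishing_pull, ← hg.preimage]
    rfl
  ratio i j l := by
    have e : (h ≫ g) ⁻¹ᵁ chart k r i ⊓ piece f' l ≤ h ⁻¹ᵁ (g ⁻¹ᵁ chart k r i ⊓ piece f l) :=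
      inf_le_inf le_rfl (piece_le h w l)
    have h1 := congrArg (Reg.pull h w _ _ e) (hg.ratio i j l)
    rw [map_mul, ← pull_res h w (piece_le h w l) e inf_le_right inf_le_right,
      ← pull_res h w (piece_le h w l) e inf_le_right inf_le_right] at h1
    refine h1.trans (congrArg (· * _) ?_)
    exact appLE_appLE h g _ e inf_le_left _

/-- A morphism given by sections of a line bundle is determined by them. -/
lemma IsInducedBy.unique {g g' : Y ⟶ PSpace k r} (hg : IsInducedBy g f s)
    (hg' : IsInducedBy g' f s) : g = g' := by
  have hp (i) : piece g i = piece g' i := (hg.preimage i).trans (hg'.preimage i).symm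
  refine hom_ext_of_ratioOn_eq (hg.over_base.trans hg'.over_base.symm) hp fun i j => ?_
  refine Reg.ext_of_cover f (fun l => piece g i ⊓ piece f l) (fun l => inf_le_left) ?_
    (fun l => ?_)
  · rw [← inf_iSup_eq, iSup_piece, inf_top_eq]
  have hu : IsUnit (Reg.res f (inf_le_right : piece g i ⊓ piece f l ≤ _) ((s i).1 l)) :=
    isUnit_res_nonvanishing f (s i) l (inf_le_left.trans (hg.preimage i).le) inf_le_right
  refine hu.mul_right_cancel ?_
  have h1 := hg.ratio i j l
  have e : piece g i ⊓ piece f l ≤ piece g' i ⊓ piece f l := inf_le_inf (hp i).le le_rfl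
  have h2 := congrArg (Reg.res f e) (hg'.ratio i j l)
  rw [map_mul, res_res, res_res] at h2
  refine Eq.trans ?_ (h1.symm.trans (h2.trans ?_))
  · exact congrArg (· * _) (res_ratioOn g i j le_rfl inf_le_left)
  · refine congrArg (· * _) ?_
    exact (res_ratioOn g' i j inf_le_left e).trans
      (res_ratioOn g' i j (hp i).le inf_le_left).symm

lemma isInducedBy_of_openCover {g : Y ⟶ PSpace k r} (𝒰 : Y.OpenCover)
    (H : ∀ a, IsInducedBy (𝒰.f a ≫ g) (𝒰.f a ≫ f) (fun i => H0.pull (𝒰.f a) rfl d (s i))) :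
    IsInducedBy g f s where
  over_base := 𝒰.hom_ext _ _ fun a => by simpa using (H a).over_base
  preimage i := by
    ext y
    obtain ⟨a, x, rfl⟩ := 𝒰.exists_eq y
    have := (H a).preimage i
    rw [nonvanishing_pull] at this
    exact (SetLike.ext_iff.1 this x : _)
  ratio i j l := by
    refine Scheme.OpenCover.ext_elem (X := Y) _ _ 𝒰 fun a => ?_
    have h := (H a).ratio i j l
    have e : (𝒰.f a ≫ g) ⁻¹ᵁ chart k r i ⊓ piece (𝒰.f a ≫ f) l ≤
      (𝒰.f a) ⁻¹ᵁ (g ⁻¹ᵁ chart k r i ⊓ piece f l) := le_rfl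
    have h1 := pull_res (𝒰.f a) (rfl : 𝒰.f a ≫ f = _) (piece_le _ rfl l) e inf_le_right
      inf_le_right ((s j).1 l)
    have h2 := pull_res (𝒰.f a) (rfl : 𝒰.f a ≫ f = _) (piece_le _ rfl l) e inf_le_right
      inf_le_right ((s i).1 l)
    have h3 := (h1.symm.trans h).trans (congrArg (_ * ·) h2)
    rw [Scheme.Hom.app_eq_appLE]
    refine h3.trans (Eq.trans ?_ (map_mul (Reg.pull (𝒰.f a) (rfl : 𝒰.f a ≫ f = _) _ _ e)
      _ _).symm)
    refine congrArg (· * _) ?_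
    exact (appLE_appLE (𝒰.f a) g _ e inf_le_left _).symm

/-- Here c is the local expression of sᵢ, so ratios of sections are ratios of coordinates. A second
trivialization only introduces a common unit, and another reference coordinate is handled by the
cocycle rule. -/
lemma isInducedBy_of_chart {g : Y ⟶ PSpace k r} (hk : g ≫ toSpecField k r = f ≫ toSpecField k n)
    {i : Fin (r + 1)} (e : ⊤ ≤ piece g i) {l : Fin (n + 1)} (hl : ⊤ ≤ piece f l)
    {c : Reg f ⊤} (hc : IsUnit c)
    (h : ∀ j, Reg.res f hl ((s j).1 l) = c * (show Reg f ⊤ from ratioOn g i j e)) :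
    IsInducedBy g f s where
  over_base := hk
  preimage j := by
    have h1 : Y.basicOpen (show Γ(Y, ⊤) from ratioOn g i j e) = piece g j := by
      have h2 := Y.basicOpen_res (show Γ(Y, piece g i) from ratioOn g i j le_rfl) (homOfLE e).op
      rw [← piece_inf_piece, top_inf_eq, inf_eq_right.2 (le_top.trans e)] at h2
      rw [← h2]
      exact congrArg (fun a : Γ(Y, ⊤) => Y.basicOpen a) (res_ratioOn g i j le_rfl e).symm
    have h2 := Y.basicOpen_res (show Γ(Y, piece f l) from (s j).1 l) (homOfLE hl).op
    rw [← nonvanishing_inf_piece, top_inf_eq, inf_eq_left.2 (le_top.trans hl)] at h2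
    refine h1.symm.trans (Eq.trans ?_ h2)
    refine (basicOpen_isUnit_mul hc _).symm.trans ?_
    exact congrArg (fun a : Γ(Y, ⊤) => Y.basicOpen a) (h j).symm
  ratio i' j l' := by
    set V : Y.Opens := g ⁻¹ᵁ chart k r i' ⊓ piece f l'
    have eV : V ≤ piece g i := le_top.trans e
    have hV : V ≤ piece f l' ⊓ piece f l := le_inf inf_le_right (le_top.trans hl)
    obtain ⟨u, hu⟩ : ∃ u : Reg f V, ∀ j, Reg.res f (inf_le_right : V ≤ _) ((s j).1 l') =
        u * (show Reg f V from ratioOn g i j eV) := by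
      refine ⟨Reg.res f hV (transition f l' l ^ d : (Reg f (piece f l' ⊓ piece f l))ˣ) *
        Reg.res f le_top c, fun j => ?_⟩
      have h1 := congrArg (Reg.res f hV) ((s j).2 l' l)
      have h2 := congrArg (Reg.res f (le_top : V ≤ ⊤)) (h j)
      rw [map_mul, res_res, res_res] at h1
      rw [map_mul, res_res] at h2
      rw [h1, h2, mul_assoc]
      refine congrArg (_ * ·) (congrArg (_ * ·) ?_)
      exact res_ratioOn g i j e le_top
    have h3 : (show Reg f V from ratioOn g i j eV) = (show Reg f V from ratioOn g i i' eV) *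
      (show Reg f V from ratioOn g i' j inf_le_left) := ratioOn_eq_mul g i i' j eV inf_le_left
    rw [hu, hu, h3]
    ring

lemma exists_isInducedBy_of_isUnit (s : Fin (r + 1) → H0 f d) (i : Fin (r + 1)) (l : Fin (n + 1))
    (hl : ⊤ ≤ piece f l) (hu : IsUnit (Reg.res f hl ((s i).1 l))) :
    ∃ g, IsInducedBy g f s := by
  obtain ⟨c, hc⟩ := hu
  obtain ⟨g, e, hk, hb⟩ := exists_hom_to_chart f i
    (fun j => (c⁻¹ : (Reg f ⊤)ˣ) * Reg.res f hl ((s j).1 l)) (by rw [← hc, Units.inv_mul])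
  refine ⟨g, isInducedBy_of_chart hk e hl c.isUnit fun j => ?_⟩
  refine Eq.trans ?_ (congrArg (fun a : Reg f ⊤ => (c : Reg f ⊤) * a) (hb j).symm)
  exact (Units.mul_inv_cancel_left c _).symm

/-- Sections of a line bundle without common zero define a morphism to projective space. -/
theorem exists_isInducedBy (s : Fin (r + 1) → H0 f d) (hs : ⨆ i, nonvanishing f (s i) = ⊤) :
    ∃ g, IsInducedBy g f s := by
  -- On each of these opens the bundle is trivialized and one section is invertible, so dividing by
  -- it gives a morphism into a chart.
  let U (x : Fin (r + 1) × Fin (n + 1)) : Y.Opens := nonvanishing f (s x.1) ⊓ piece f x.2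
  have hU : ⨆ x, U x = ⊤ := by
    rw [iSup_prod]
    simp only [U, ← inf_iSup_eq, iSup_piece, inf_top_eq, hs]
  let 𝒰 := Y.openCoverOfIsOpenCover U hU
  have H (x) : ∃ g, IsInducedBy g (𝒰.f x ≫ f) (fun i => H0.pull (𝒰.f x) rfl d (s i)) := by
    have e : (⊤ : (𝒰.X x).Opens) ≤ 𝒰.f x ⁻¹ᵁ U x := fun y _ => y.2
    refine exists_isInducedBy_of_isUnit _ x.1 x.2 (e.trans fun y hy => hy.2) ?_
    have h1 := (isUnit_res_nonvanishing f (s x.1) x.2 (inf_le_left : U x ≤ _) inf_le_right).map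
      (Reg.pull (𝒰.f x) (rfl : 𝒰.f x ≫ f = _) _ ⊤ e)
    rwa [← pull_res (𝒰.f x) rfl (piece_le _ rfl x.2) e inf_le_right (e.trans fun y hy => hy.2)]
      at h1
  choose g hg using H
  refine ⟨𝒰.glueMorphisms g fun x y => ?_, isInducedBy_of_openCover 𝒰 fun x => ?_⟩
  -- On an overlap both restrictions are induced by the same sections, so uniqueness makes them
  -- agree.
  · have h1 := (hg x).comp (Limits.pullback.fst (𝒰.f x) (𝒰.f y)) rfl
    have h2 := (hg y).comp (Limits.pullback.snd (𝒰.f x) (𝒰.f y))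
      (f' := Limits.pullback.fst (𝒰.f x) (𝒰.f y) ≫ 𝒰.f x ≫ f)
      (by rw [Limits.pullback.condition_assoc])
    refine h1.unique ?_
    convert h2 using 2 with i
    rw [H0.pull_pull _ _ _ _ (by simp), H0.pull_pull _ _ _ _
      (by simp [Limits.pullback.condition_assoc])]
    exact LinearMap.congr_fun (H0.pull_congr Limits.pullback.condition _ _) (s i)
  · rw [𝒰.ι_glueMorphisms]
    exact hg x

end InducedMorphisms

end GoppaDuality

namespace GoppaDuality

/-! ### Base loci and the factorization through projective space -/

section LinearSeries

variable {k : Type u} [Field k] {n : ℕ} {Y : Scheme.{u}}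

/-- The generic point of projective space. -/
def genericPoint (k : Type u) [Field k] (n : ℕ) : PSpace k n :=
  (⟨⊥, by
    change (⊥ : Ideal (MvPolynomial (Fin (n + 1)) k)).IsPrime
    exact Ideal.isPrime_bot, fun h => by
    have h1 : (X 0 : MvPolynomial (Fin (n + 1)) k) ∈ HomogeneousIdeal.irrelevant (grading k n) :=
      (HomogeneousIdeal.mem_irrelevant_iff _ _).2 (by
        rw [GradedRing.proj_apply, DirectSum.decompose_of_mem_ne (grading k n)
          ((mem_homogeneousSubmodule 1 _).2 (isHomogeneous_X k 0)) one_ne_zero])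
    exact X_ne_zero (R := k) (0 : Fin (n + 1)) (h h1)⟩ : ProjectiveSpectrum (grading k n))

lemma genericPoint_mem {U : Set (PSpace k n)} (hU : IsOpen U) (hne : U.Nonempty) :
    genericPoint k n ∈ U := by
  obtain ⟨x, hx⟩ := hne
  obtain ⟨_, ⟨q, rfl⟩, hxq, hq⟩ :=
    (ProjectiveSpectrum.isTopologicalBasis_basic_opens (grading k n)).exists_subset_of_mem_open hx
      hU
  refine hq ?_
  rintro (h : q = 0)
  subst h
  exact hxq (zero_mem _)

lemma dense_of_nonempty (U : (PSpace k n).Opens) (hne : (U : Set (PSpace k n)).Nonempty) :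
    Dense (U : Set (PSpace k n)) := by
  rw [dense_iff_inter_open]
  exact fun V hV hne' => ⟨_, genericPoint_mem hV hne', genericPoint_mem U.2 hne⟩

lemma nonvanishing_le_of_basis {d : ℤ} {W : Submodule k (H0P k n d)} {I : Type*}
    (b : Module.Basis I k W) {U : (PSpace k n).Opens}
    (h : ∀ i, nonvanishing (𝟙 (PSpace k n)) (b i : H0P k n d) ≤ U) {s : H0P k n d} (hs : s ∈ W) :
    nonvanishing (𝟙 (PSpace k n)) s ≤ U := by
  have h1 : Set.range (fun i => (b i : H0P k n d)) ⊆ sectionsVanishingOutside (𝟙 (PSpace k n)) d U :=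
    Set.range_subset_iff.2 h
  have h2 : Submodule.span k (Set.range fun i => (b i : H0P k n d)) = W := by
    rw [show (fun i => (b i : H0P k n d)) = W.subtype ∘ b from rfl, Set.range_comp,
      Submodule.span_image, b.span_eq, Submodule.map_top, Submodule.range_subtype]
  have h3 := Submodule.span_le.2 h1
  rw [h2] at h3
  exact h3 hs

lemma baseFreeLocus_eq_iSup {d : ℤ} {W : Submodule k (H0P k n d)} {I : Type*}
    (b : Module.Basis I k W) :
    baseFreeLocus W = ⨆ i, nonvanishing (𝟙 (PSpace k n)) (b i : H0P k n d) :=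
  le_antisymm
    (iSup₂_le fun _ hs => nonvanishing_le_of_basis b
      (le_iSup fun i => nonvanishing (𝟙 (PSpace k n)) (b i : H0P k n d)) hs)
    (iSup_le fun i => le_iSup₂_of_le (b i : H0P k n d) (b i).2 le_rfl)

/-- A nonempty open is dense, so the base-free locus can be the domain of a partial map. Γ lifts to
this domain, and the composite is induced by the restricted sections, hence is the only such
morphism. -/
lemma mapFactors_of_preimage_eq_top {ι : Y ⟶ PSpace k n} {d : ℤ} {W : Submodule k (H0P k n d)}
    (hne : (baseFreeLocus W : Set (PSpace k n)).Nonempty) (h : ι ⁻¹ᵁ baseFreeLocus W = ⊤) :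
    MapFactors ι W := by
  intro r b
  have hb := baseFreeLocus_eq_iSup b
  let U := baseFreeLocus W
  obtain ⟨g, hg⟩ := exists_isInducedBy (f := U.ι)
    (fun i => H0.pull U.ι (Category.comp_id _) d (b i : H0P k n d)) (by
      simp only [nonvanishing_pull]
      rw [← Scheme.Hom.preimage_iSup, ← hb]
      exact U.ι_preimage_self)
  have hr : Set.range ι ⊆ Set.range U.ι := by
    rintro _ ⟨y, rfl⟩
    rw [Scheme.Opens.range_ι]
    exact h.ge (trivial : y ∈ (⊤ : Y.Opens))
  have hw : IsOpenImmersion.lift U.ι ι hr ≫ U.ι = ι := IsOpenImmersion.lift_fac _ _ _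
  refine ⟨⟨U, dense_of_nonempty U hne, g⟩, rfl, hg, IsOpenImmersion.lift U.ι ι hr, hw, fun α => ?_⟩
  have h1 : IsInducedBy (IsOpenImmersion.lift U.ι ι hr ≫ g) ι
      (fun i => restr ι d (b i : H0P k n d)) := by
    convert hg.comp (IsOpenImmersion.lift U.ι ι hr) hw using 2 with i
    rw [H0.pull_pull _ _ _ _ (by rw [hw, Category.comp_id])]
    exact (LinearMap.congr_fun (H0.pull_congr hw _ _) _).symm
  exact ⟨fun hα => hα.unique h1, fun hα => hα ▸ h1⟩

end LinearSeries

/-! ### Linear series complementary to the kernel of restriction -/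

section PlaneLinearSeries

variable {k : Type u} [Field k] {Y : Scheme.{u}}

/-- The power `xᵢᵈ` as a section of `𝒪(d)`. -/
def powSection (k : Type u) [Field k] {n : ℕ} (i : Fin (n + 1)) (d : ℕ) : H0P k n d :=
  ⟨evalAll (𝟙 (PSpace k n)) (X i ^ d), evalAll_mem (𝟙 (PSpace k n)) (isHomogeneous_X_pow i d)⟩

lemma piece_le_nonvanishing_powSection {n : ℕ} (i : Fin (n + 1)) (d : ℕ) :
    chart k n i ≤ nonvanishing (𝟙 (PSpace k n)) (powSection k i d) := by
  refine le_trans ?_ (le_iSup _ i)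
  have h : (powSection k i d).1 i = 1 := by
    change evalAll (𝟙 (PSpace k n)) (X i ^ d) i = 1
    rw [map_pow, Pi.pow_apply, evalAll_X_self, one_pow]
  rw [h]
  exact (PSpace k n).basicOpen_one.ge

lemma nonneg_of_basis {d : ℤ} {W : Submodule k (H0P k 2 d)} {r : ℕ}
    (b : Module.Basis (Fin (r + 1)) k W) : 0 ≤ d := by
  by_contra hd
  refine b.ne_zero 0 (Subtype.ext (Subtype.ext ?_))
  obtain ⟨p, hp, hps⟩ := (sectionSpace_id_eq d).le
    (show (b 0 : H0P k 2 d).1 ∈ sectionSpace _ d from (b 0 : H0P k 2 d).2)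
  rw [homogeneousPart_of_neg (not_le.1 hd) hp, map_zero] at hps
  exact hps.symm

lemma mapFactors_of_isCompl {ι : Y ⟶ PSpace k 2} {d : ℤ} {W : Submodule k (H0P k 2 d)}
    (hW : IsCompl W (LinearMap.ker (restr ι d))) : MapFactors ι W := by
  intro r b
  have htop : ι ⁻¹ᵁ baseFreeLocus W = ⊤ := by
    obtain ⟨m, rfl⟩ := Int.eq_ofNat_of_zero_le (nonneg_of_basis b)
    rw [eq_top_iff, ← iSup_piece ι]
    refine iSup_le fun i => ?_
    -- Some member of W has the same restriction to Γ as xᵢᵐ, which vanishes nowhere on D₊(xᵢ).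
    obtain ⟨w, hw, hwi⟩ := exists_mem_eq_of_codisjoint (restr ι m) hW.codisjoint (powSection k i m)
    have h1 := congrArg (nonvanishing ι) hwi
    rw [restr, nonvanishing_pull, nonvanishing_pull] at h1
    intro x hx
    have h2 : x ∈ ι ⁻¹ᵁ nonvanishing (𝟙 (PSpace k 2)) w :=
      h1.ge (piece_le_nonvanishing_powSection i m hx)
    exact (le_iSup₂_of_le (f := fun s (_ : s ∈ W) => nonvanishing (𝟙 (PSpace k 2)) s) w hw le_rfl)
      h2
  refine mapFactors_of_preimage_eq_top ?_ htop r b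
  -- An empty base-free locus would force Γ to be empty. All restrictions would then be zero,
  -- contradicting injectivity on W at a basis vector.
  by_contra hne
  have hbot : baseFreeLocus W = ⊥ := by
    ext x
    exact ⟨fun hx => (hne ⟨x, hx⟩).elim, fun hx => hx.elim⟩
  rw [hbot] at htop
  have hz : restr ι d (b 0 : H0P k 2 d) = restr ι d 0 := by
    refine Subtype.ext (funext fun i => ?_)
    exact Reg.ext_of_cover ι (fun x : PEmpty.{1} => x.elim) (fun x => x.elim)
      (fun x _ => (htop.ge (trivial : x ∈ (⊤ : Y.Opens)) : x ∈ ι ⁻¹ᵁ (⊥ : (PSpace k 2).Opens)).elim)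
      (fun x => x.elim)
  refine b.ne_zero 0 (injective_comp_subtype (restr ι d) hW ?_)
  exact hz

end PlaneLinearSeries

end GoppaDuality

end

theorem mainTheorem3 {k : Type u} [Field k] {d₁ d₂ : ℕ} {Γ : Scheme.{u}} (ι : Γ ⟶ PSpace k 2)
    (hΓ : IsCompleteIntersection ι d₁ d₂) :
    Module.Finite k (Reg ι ⊤) ∧
    ∃ φ : H0 ι ((d₁ : ℤ) + d₂ - 3) ≃ₗ[Reg ι ⊤] CanonicalModule ι,
      (∀ s : H0P k 2 ((d₁ : ℤ) + d₂ - 3), CanonicalModule.trace ι (φ (restr ι _ s)) = 0) ∧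
      ∀ (d : ℤ) (W : Submodule k (H0P k 2 d)), IsCompl W (LinearMap.ker (restr ι d)) →
        (∃ W' : Submodule k (H0P k 2 ((d₁ : ℤ) + d₂ - d - 3)),
          IsGaleSequence ι (show d + ((d₁ : ℤ) + d₂ - d - 3) = (d₁ : ℤ) + d₂ - 3 by ring)
            φ W W') ∧
        ∀ W' : Submodule k (H0P k 2 ((d₁ : ℤ) + d₂ - d - 3)),
          IsGaleSequence ι (show d + ((d₁ : ℤ) + d₂ - d - 3) = (d₁ : ℤ) + d₂ - 3 by ring)
            φ W W' →
          IsCompl W' (LinearMap.ker (restr ι ((d₁ : ℤ) + d₂ - d - 3))) ∧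
          Module.finrank k W + Module.finrank k W' = Module.finrank k (Reg ι ⊤) ∧
          MapFactors ι W ∧ MapFactors ι W' := by
  obtain ⟨hfin, φ, hφ, h⟩ := hΓ.exists_duality
  refine ⟨hfin, φ, hφ, fun d W hW => ?_⟩
  obtain ⟨h1, h2⟩ := h d ((d₁ : ℤ) + d₂ - d - 3) (by ring) W hW
  refine ⟨h1, fun W' hW' => ?_⟩
  obtain ⟨h3, h4⟩ := h2 W' hW'
  exact ⟨h3, h4, mapFactors_of_isCompl hW, mapFactors_of_isCompl h3⟩
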